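/- **Setting.** Let $\Omega\subset\mathbb R^2$ be a bounded connected open set, the interior of a finite union of closed rectangles with sides parallel to the axes, $T>0$, $g>0$, $z$ (the topography) a $C^1$ function on $\mathbb R^2$, $h_0\in L^1(\Omega)$, $\boldsymbol u_0=(u_{0,1},u_{0,2})\in L^1(\Omega)^2$. Write $e^{(1)},e^{(2)}$ for the canonical basis. **Mesh.** A MAC mesh of $\Omega$ is a finite set $\mathcal M$ of cells $K=[x_a,x_{a+1}]\times[y_b,y_{b+1}]$ of a (possibly non-uniform) structured rectangular grid such that $\Omega$ is the interior of their union. $\mathcal E^{(i)}$ is the set of edges of the cells orthogonal to $e^{(i)}$; $\mathcal E^{(i)}_{\rm int}$ is the set of those which separate two cells of $\mathcal M$, written $\sigma=\overrightarrow{K|L}$ when $L$ follows $K$ in the direction $e^{(i)}$; the others are exterior. $D_\sigma$ is the union of the halves adjacent to $\sigma$ of the cell(s) of $\mathcal M$ having $\sigma$ as an edge. Let $\delta_{\mathcal M}=\max_K\operatorname{diam}K$ and $\eta_{\mathcal M}=\max\{|\sigma|/|\sigma'|:\sigma\in\mathcal E^{(i)},\sigma'\in\mathcal E^{(j)},i\ne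 j\}$. **Scheme.** Let $N\ge1$, $\delta t=T/N$, $t_n=n\,\delta t$. The unknowns are $h^n_K$ ($K\in\mathcal M$) and $u^n_{i,\sigma}$ ($\sigma\in\mathcal E^{(i)}$, $i=1,2$), $0\le n\le N$, with $u^n_{i,\sigma}=0$ on exterior edges. Initially $h^0_K$ is the mean of $h_0$ over $K$, and $u^0_{i,\sigma}$ is the mean of $u_{0,i}$ over $D_\sigma$ for $\sigma\in\mathcal E^{(i)}_{\rm int}$. For $0\le n<N$: $$\tfrac1{\delta t}(h^{n+1}_K-h^n_K)+\tfrac1{|K|}\sum_{\sigma\in\mathcal E(K)}F^n_{K,\sigma}=0\quad(K\in\mathcal M),$$ $$\tfrac1{\delta t}(h^{n+1}_{D_\sigma}u^{n+1}_{i,\sigma}-h^n_{D_\sigma}u^n_{i,\sigma})+\tfrac1{|D_\sigma|}\sum_{\epsilon}F^n_{\sigma,\epsilon}u^n_{i,\epsilon}+\tfrac{|\sigma|}{|D_\sigma|}(p^{n+1}_L-p^{n+1}_K)+g\,h^{n+1}_{\sigma,c}\tfrac{|\sigma|}{|D_\sigma|}(z_L-z_K)=0\quad(\sigma=\overrightarrow{K|L}\in\mathcal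 E^{(i)}_{\rm int},\ i=1,2).$$ Here $\mathcal E(K)$ is the set of edges of $K$, $p^n_K=\frac12g(h^n_K)^2$, $h_{\sigma,c}=\frac12(h_K+h_L)$ and $|D_\sigma|h_{D_\sigma}=\frac12|K|h_K+\frac12|L|h_L$. The discrete topography $z_K$ is either the value of $z$ at the mass center of $K$ for all cells of all meshes, or the mean of $z$ over $K$ for all of them. $F_{K,\sigma}=|\sigma|\,h_\sigma\,u_{i,\sigma}\,\boldsymbol n_{K,\sigma}\cdot e^{(i)}$ for $\sigma\in\mathcal E^{(i)}$, where $\boldsymbol n_{K,\sigma}$ is the unit normal outward $K$ and $h_\sigma$ is the upwind value of the height (so $F_{K,\sigma}=0$ on exterior edges). The sum over $\epsilon$ runs over the four sides of $D_\sigma$; $F_{\sigma,\epsilon}$ is the mass flux outward $D_\sigma$ and $u_{i,\epsilon}$ is the upwind value, with respect to its sign, of the $i$-th velocity components on both sides of $\epsilon$. With fluxes oriented along increasing coordinates: if $\epsilon$ is orthogonal to $e^{(i)}$ and lies in a cell $K$, its flux is the half-sum of the fluxes through the two edges of $K$ orthogonal to $e^{(i)}$; if $\epsilon$ is parallel to $e^{(i)}$,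 so that $\epsilon$ is the union of halves of an edge $\tau$ of $K$ and an edge $\tau'$ of $L$, its flux is the half-sum of the fluxes through $\tau$ and $\tau'$. The associated functions are $h=h^{n+1}_K$ on $K\times[t_n,t_{n+1})$ and $u_i=u^{n+1}_{i,\sigma}$ on $D_\sigma\times[t_n,t_{n+1})$, $0\le n<N$. **Theorem.** Let $(\mathcal M^{(m)})_{m\in\mathbb N}$ be MAC meshes of $\Omega$ and $\delta t^{(m)}=T/N^{(m)}$ time steps with $\delta t^{(m)}\to0$, $\delta_{\mathcal M^{(m)}}\to0$ and $\eta_{\mathcal M^{(m)}}\le\eta$ for some $\eta>0$ and all $m$. Let $(h^{(m)},\boldsymbol u^{(m)})$ be corresponding solutions of the scheme, and suppose that there are constants $C,C'>0$ such that for all $m$ and $0\le n<N^{(m)}$ $$1/C<(h^{(m)})^n_K\le C,\quad 1/C'<1/(h^{(m)})^n_K\le C'\quad\forall K\in\mathcal M^{(m)},$$ and a constant $C''$ such that $|(u_i^{(m)})^n_\sigma|\le C''$ for all $m$, $0\le n<N^{(m)}$, $i=1,2$ and all edges $\sigma$ orthogonal to $e^{(i)}$. Suppose that $(h^{(m)},\boldsymbol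 u^{(m)})\to(\bar h,\bar{\boldsymbol u})$ in $L^1(\Omega\times(0,T))\times L^1(\Omega\times(0,T))^2$. Then $(\bar h,\bar{\boldsymbol u})$ is a weak solution of the shallow water equations with topography: $\bar h$, $\bar h^2$, $\bar h\bar u_i$, $\bar h\bar u_i\bar u_j$ are integrable on $\Omega\times(0,T)$, $h_0$ and $h_0\boldsymbol u_0$ are integrable on $\Omega$, and for all $\varphi\in C^\infty_c(\Omega\times[0,T))$, $\boldsymbol\varphi\in C^\infty_c(\Omega\times[0,T))^2$, $$\int_0^T\!\!\int_\Omega\bigl[\bar h\,\partial_t\varphi+\bar h\bar{\boldsymbol u}\cdot\nabla\varphi\bigr]dx\,dt+\int_\Omega h_0\,\varphi(\cdot,0)\,dx=0,$$ $$-\int_0^T\!\!\int_\Omega\bigl[\bar h\bar{\boldsymbol u}\cdot\partial_t\boldsymbol\varphi+(\bar h\bar{\boldsymbol u}\otimes\bar{\boldsymbol u}):\nabla\boldsymbol\varphi+\tfrac12g\bar h^2\operatorname{div}\boldsymbol\varphi-g\bar h\,\nabla z\cdot\boldsymbol\varphi\bigr]dx\,dt-\int_\Omega h_0\boldsymbol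 u_0\cdot\boldsymbol\varphi(\cdot,0)\,dx=0.$$ If in addition $\delta t^{(m)}/\delta_{\mathcal M^{(m)}}\to0$ and $\sum_{n=0}^{N^{(m)}-1}\sum_{K\in\mathcal M^{(m)}}|K|\,|(h^{(m)})^{n+1}_K-(h^{(m)})^n_K|$ is bounded uniformly in $m$, then, with $\eta(h,\boldsymbol u)=\frac12h|\boldsymbol u|^2+\frac12gh^2+ghz$ and $\Phi(h,\boldsymbol u)=(\eta(h,\boldsymbol u)+\frac12gh^2)\boldsymbol u$, the functions $\eta(\bar h,\bar{\boldsymbol u})$, $\Phi(\bar h,\bar{\boldsymbol u})$ and $\eta(h_0,\boldsymbol u_0)$ are integrable, and for all $\varphi\in C^\infty_c(\Omega\times[0,T))$ with $\varphi\ge0$, $$-\int_0^T\!\!\int_\Omega\bigl[\eta(\bar h,\bar{\boldsymbol u})\,\partial_t\varphi+\Phi(\bar h,\bar{\boldsymbol u})\cdot\nabla\varphi\bigr]dx\,dt-\int_\Omega\eta(h_0,\boldsymbol u_0)\,\varphi(\cdot,0)\,dx\le0.$$ -/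

import Mathlib

open MeasureTheory Filter Topology Set
open scoped ContDiff

noncomputable section

/-- A structured, possibly non uniform, rectangular grid of a planar domain. The grid lines in
direction `k` are `x k = X k a`, `a : ℤ`, and the domain is made of the rectangles
`[X 0 (K 0), X 0 (K 0 + 1)] × [X 1 (K 1), X 1 (K 1 + 1)]` with `K ∈ cells`
(grid lines which touch no cell of `cells` play no role). -/
structure MACGrid where
  X : Fin 2 → ℤ → ℝ
  strictMono : ∀ k, StrictMono (X k)
  cells : Finset (Fin 2 → ℤ)

namespace MACGrid

/-- The shift of indices by one in direction `k`. -/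
def e (k : Fin 2) : Fin 2 → ℤ := Pi.single k 1

/-- Length of the `a`-th grid interval in direction `k`. -/
def len (M : MACGrid) (k : Fin 2) (a : ℤ) : ℝ := M.X k (a + 1) - M.X k a

/-- The mass center `x_K` of the cell `K`. -/
def center (M : MACGrid) (K : Fin 2 → ℤ) : Fin 2 → ℝ :=
  fun k => (M.X k (K k) + M.X k (K k + 1)) / 2

/-- The rectangle `K`, taken half-open so that the cells are pairwise disjoint. -/
def cell (M : MACGrid) (K : Fin 2 → ℤ) : Set (Fin 2 → ℝ) :=
  {x | ∀ k, x k ∈ Ico (M.X k (K k)) (M.X k (K k + 1))}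

/-- The closed rectangle `K`. -/
def closedCell (M : MACGrid) (K : Fin 2 → ℤ) : Set (Fin 2 → ℝ) :=
  {x | ∀ k, x k ∈ Icc (M.X k (K k)) (M.X k (K k + 1))}

/-- The open domain covered by the grid. -/
def domain (M : MACGrid) : Set (Fin 2 → ℝ) :=
  interior (⋃ K ∈ M.cells, M.closedCell K)

/-- The area `|K|`. -/
def cellArea (M : MACGrid) (K : Fin 2 → ℤ) : ℝ := M.len 0 (K 0) * M.len 1 (K 1)

/-- The Euclidean diameter of the rectangle `K`. -/
def cellDiam (M : MACGrid) (K : Fin 2 → ℤ) : ℝ :=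
  Real.sqrt (M.len 0 (K 0) ^ 2 + M.len 1 (K 1) ^ 2)

/-- The edges orthogonal to the direction `i`. The index `σ` stands for the edge
`x i = X i (σ i)`, `x j ∈ [X j (σ j), X j (σ j + 1)]` (`j ≠ i`), which lies between the cells
`σ - e i` and `σ`; it is an edge of the mesh if one of these two belongs to the mesh. -/
def edges (M : MACGrid) (i : Fin 2) : Finset (Fin 2 → ℤ) :=
  M.cells ∪ M.cells.image (fun K => K + e i)

/-- The interior edges orthogonal to the direction `i`: both adjacent cells belong to the mesh. -/
def intEdges (M : MACGrid) (i : Fin 2) : Finset (Fin 2 → ℤ) :=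
  M.cells ∩ M.cells.image (fun K => K + e i)

/-- The length `|σ|` of an edge orthogonal to the direction `i` (`1 - i` is the other direction). -/
def edgeLen (M : MACGrid) (i : Fin 2) (σ : Fin 2 → ℤ) : ℝ := M.len (1 - i) (σ (1 - i))

/-- The mesh size: the largest diameter of a cell. -/
def size (M : MACGrid) : ℝ := sSup (M.cellDiam '' (M.cells : Set (Fin 2 → ℤ)))

/-- The regularity parameter: the largest ratio of lengths of two orthogonal edges of the mesh. -/
def regularity (M : MACGrid) : ℝ :=
  sSup {r | ∃ i : Fin 2, ∃ σ ∈ M.edges i, ∃ σ' ∈ M.edges (1 - i),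
    r = M.edgeLen i σ / M.edgeLen (1 - i) σ'}

/-- The dual cell `D_σ` of an edge `σ` orthogonal to the direction `i`: the union of the halves
adjacent to `σ` of those among the cells `σ - e i` and `σ` which belong to the mesh. -/
def dualCell (M : MACGrid) (i : Fin 2) (σ : Fin 2 → ℤ) : Set (Fin 2 → ℝ) :=
  {x | (σ - e i ∈ M.cells ∧ x ∈ M.cell (σ - e i) ∧ M.center (σ - e i) i ≤ x i) ∨
    (σ ∈ M.cells ∧ x ∈ M.cell σ ∧ x i < M.center σ i)}

/-- The area `|D_σ|` for an interior edge. -/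
def dualArea (M : MACGrid) (i : Fin 2) (σ : Fin 2 → ℤ) : ℝ :=
  (M.cellArea (σ - e i) + M.cellArea σ) / 2

/-- The height `h_{D_σ}` in the dual cell of an interior edge `σ`:
`|D_σ| h_{D_σ} = |D_{K,σ}| h_K + |D_{L,σ}| h_L`. -/
def dualHeight (M : MACGrid) (i : Fin 2) (h : (Fin 2 → ℤ) → ℝ) (σ : Fin 2 → ℤ) : ℝ :=
  (M.cellArea (σ - e i) / 2 * h (σ - e i) + M.cellArea σ / 2 * h σ) / M.dualArea i σ

/-- The centered height `h_{σ,c}` at an interior edge, used in the topography term. -/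
def centeredHeight (i : Fin 2) (h : (Fin 2 → ℤ) → ℝ) (σ : Fin 2 → ℤ) : ℝ :=
  (h (σ - e i) + h σ) / 2

/-- The upwind mass flux `|σ| h_σ u_{i,σ}` through `σ`, counted positively in direction `i`,
i.e. from the cell `σ - e i` to the cell `σ`. It vanishes where `u i` does, in particular at
exterior edges. -/
def massFlux (M : MACGrid) (h : (Fin 2 → ℤ) → ℝ) (u : Fin 2 → (Fin 2 → ℤ) → ℝ)
    (i : Fin 2) (σ : Fin 2 → ℤ) : ℝ :=
  M.edgeLen i σ * (if 0 ≤ u i σ then h (σ - e i) else h σ) * u i σ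

/-- The discrete divergence `div_K (h u)`. -/
def divCell (M : MACGrid) (h : (Fin 2 → ℤ) → ℝ) (u : Fin 2 → (Fin 2 → ℤ) → ℝ)
    (K : Fin 2 → ℤ) : ℝ :=
  (∑ i, (M.massFlux h u i (K + e i) - M.massFlux h u i K)) / M.cellArea K

/-- The mass flux through the dual edge which separates `D_σ` and `D_{σ + e j}`, where `σ` and
`σ + e j` are orthogonal to the direction `i`, counted positively in direction `j`.
If `j = i`, the dual edge lies in the cell `σ`, between its edges `σ` and `σ + e i`.
If `j ≠ i`, it is the union of halves of the two edges orthogonal to `j` which lie on top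
(in direction `j`) of the cells `σ - e i` and `σ`. -/
def dualFlux (M : MACGrid) (h : (Fin 2 → ℤ) → ℝ) (u : Fin 2 → (Fin 2 → ℤ) → ℝ)
    (i j : Fin 2) (σ : Fin 2 → ℤ) : ℝ :=
  if j = i then (M.massFlux h u i σ + M.massFlux h u i (σ + e i)) / 2
  else (M.massFlux h u j (σ - e i + e j) + M.massFlux h u j (σ + e j)) / 2

/-- The momentum flux `F_ε u_{i,ε}` through the same dual edge, with `u_{i,ε}` upwinded with
respect to the sign of the mass flux. -/
def momentumFlux (M : MACGrid) (h : (Fin 2 → ℤ) → ℝ) (u : Fin 2 → (Fin 2 → ℤ) → ℝ)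
    (i j : Fin 2) (σ : Fin 2 → ℤ) : ℝ :=
  M.dualFlux h u i j σ * (if 0 ≤ M.dualFlux h u i j σ then u i σ else u i (σ + e j))

/-- The discrete convection operator: `|D_σ|⁻¹` times the sum of the outward momentum fluxes
through the four dual edges of `D_σ`. -/
def convection (M : MACGrid) (h : (Fin 2 → ℤ) → ℝ) (u : Fin 2 → (Fin 2 → ℤ) → ℝ)
    (i : Fin 2) (σ : Fin 2 → ℤ) : ℝ :=
  (∑ j, (M.momentumFlux h u i j σ - M.momentumFlux h u i j (σ - e j))) / M.dualArea i σ

/-- The discrete partial derivative in direction `i` at an interior edge. -/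
def discreteGrad (M : MACGrid) (i : Fin 2) (q : (Fin 2 → ℤ) → ℝ) (σ : Fin 2 → ℤ) : ℝ :=
  M.edgeLen i σ / M.dualArea i σ * (q σ - q (σ - e i))

/-- `(h, u)` is a solution of the decoupled explicit scheme on the grid `M`, with `N` time steps
of length `δt`, initial data `h₀`, `u₀`, gravity constant `g` and discrete topography `zM`.
Here `h n K` is the height in the cell `K` at step `n`, and `u n i σ` is the `i`-th velocity
component at the edge `σ` orthogonal to the direction `i`, extended by zero. -/
structure IsSolution (M : MACGrid) (g δt : ℝ) (N : ℕ)
    (h₀ : (Fin 2 → ℝ) → ℝ) (u₀ : Fin 2 → (Fin 2 → ℝ) → ℝ) (zM : (Fin 2 → ℤ) → ℝ)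
    (h : ℕ → (Fin 2 → ℤ) → ℝ) (u : ℕ → Fin 2 → (Fin 2 → ℤ) → ℝ) : Prop where
  init_height : ∀ K ∈ M.cells, h 0 K = ⨍ x in M.cell K, h₀ x
  init_velocity : ∀ i, ∀ σ ∈ M.intEdges i, u 0 i σ = ⨍ x in M.dualCell i σ, u₀ i x
  boundary : ∀ n ≤ N, ∀ i, ∀ σ ∉ M.intEdges i, u n i σ = 0
  mass : ∀ n < N, ∀ K ∈ M.cells,
    (h (n + 1) K - h n K) / δt + M.divCell (h n) (u n) K = 0
  momentum : ∀ n < N, ∀ i, ∀ σ ∈ M.intEdges i,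
    (M.dualHeight i (h (n + 1)) σ * u (n + 1) i σ - M.dualHeight i (h n) σ * u n i σ) / δt
      + M.convection (h n) (u n) i σ
      + M.discreteGrad i (fun K => 1 / 2 * g * h (n + 1) K ^ 2) σ
      + g * centeredHeight i (h (n + 1)) σ * M.discreteGrad i zM σ = 0

/-- The piecewise constant height, equal to `h^{n+1}_K` on `K × [t_n, t_{n+1})`. -/
def heightFun (M : MACGrid) (δt : ℝ) (N : ℕ) (h : ℕ → (Fin 2 → ℤ) → ℝ) :
    (Fin 2 → ℝ) × ℝ → ℝ := fun q =>
  ∑ n ∈ Finset.range N, ∑ K ∈ M.cells,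
    (M.cell K ×ˢ Ico (n * δt) ((n + 1) * δt)).indicator (fun _ => h (n + 1) K) q

/-- The `i`-th component of the piecewise constant velocity, equal to `u^{n+1}_{i,σ}` on
`D_σ × [t_n, t_{n+1})`. -/
def velocityFun (M : MACGrid) (δt : ℝ) (N : ℕ) (u : ℕ → Fin 2 → (Fin 2 → ℤ) → ℝ)
    (i : Fin 2) : (Fin 2 → ℝ) × ℝ → ℝ := fun q =>
  ∑ n ∈ Finset.range N, ∑ σ ∈ M.edges i,
    (M.dualCell i σ ×ˢ Ico (n * δt) ((n + 1) * δt)).indicator (fun _ => u (n + 1) i σ) q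

end MACGrid

namespace ShallowWater

/-- Test functions `φ ∈ C_c^∞(Ω × [0,T))`, as restrictions to `t ≥ 0` of smooth functions whose
support is a compact subset of `Ω × (-∞, T)`. -/
structure IsTest (Ω : Set (Fin 2 → ℝ)) (T : ℝ) (φ : (Fin 2 → ℝ) × ℝ → ℝ) : Prop where
  smooth : ContDiff ℝ ∞ φ
  compact : HasCompactSupport φ
  support : tsupport φ ⊆ Ω ×ˢ Iio T

/-- Time derivative. -/
def dt (φ : (Fin 2 → ℝ) × ℝ → ℝ) (q : (Fin 2 → ℝ) × ℝ) : ℝ := fderiv ℝ φ q (0, 1)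

/-- Partial derivative in the space direction `k` of a function of space and time. -/
def dx (k : Fin 2) (φ : (Fin 2 → ℝ) × ℝ → ℝ) (q : (Fin 2 → ℝ) × ℝ) : ℝ :=
  fderiv ℝ φ q (Pi.single k 1, 0)

/-- Partial derivative in direction `k` of a function of space. -/
def pd (k : Fin 2) (z : (Fin 2 → ℝ) → ℝ) (x : Fin 2 → ℝ) : ℝ := fderiv ℝ z x (Pi.single k 1)

/-- Weak solutions of the shallow water equations with topography `z` on `Ω × (0,T)`,
including the integrability which gives a meaning to the integrals. -/
structure IsWeakSolution (Ω : Set (Fin 2 → ℝ)) (T g : ℝ) (z h₀ : (Fin 2 → ℝ) → ℝ)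
    (u₀ : Fin 2 → (Fin 2 → ℝ) → ℝ) (h : (Fin 2 → ℝ) × ℝ → ℝ)
    (u : Fin 2 → (Fin 2 → ℝ) × ℝ → ℝ) : Prop where
  integrable_h : IntegrableOn h (Ω ×ˢ Ioo 0 T)
  integrable_h_sq : IntegrableOn (fun q => h q ^ 2) (Ω ×ˢ Ioo 0 T)
  integrable_hu : ∀ i, IntegrableOn (fun q => h q * u i q) (Ω ×ˢ Ioo 0 T)
  integrable_huu : ∀ i j, IntegrableOn (fun q => h q * u i q * u j q) (Ω ×ˢ Ioo 0 T)
  integrable_h₀ : IntegrableOn h₀ Ω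
  integrable_h₀u₀ : ∀ i, IntegrableOn (fun x => h₀ x * u₀ i x) Ω
  mass : ∀ φ, IsTest Ω T φ →
    (∫ q in Ω ×ˢ Ioo 0 T, (h q * dt φ q + ∑ k, h q * u k q * dx k φ q))
      + ∫ x in Ω, h₀ x * φ (x, 0) = 0
  momentum : ∀ φ : Fin 2 → (Fin 2 → ℝ) × ℝ → ℝ, (∀ i, IsTest Ω T (φ i)) →
    -(∫ q in Ω ×ˢ Ioo 0 T,
        ((∑ i, h q * u i q * dt (φ i) q)
          + (∑ i, ∑ j, h q * u i q * u j q * dx j (φ i) q)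
          + 1 / 2 * g * h q ^ 2 * (∑ i, dx i (φ i) q)
          - g * h q * (∑ i, pd i z q.1 * φ i q)))
      - ∫ x in Ω, ∑ i, h₀ x * u₀ i x * φ i (x, 0) = 0

/-- The entropy `η = ½ h |u|² + ½ g h² + g h z`, as a function of the values of `h`, `u`, `z`. -/
def entropy (g h : ℝ) (u : Fin 2 → ℝ) (z : ℝ) : ℝ :=
  1 / 2 * h * (∑ i, u i ^ 2) + 1 / 2 * g * h ^ 2 + g * h * z

/-- The entropy flux `Φ = (η + ½ g h²) u`. -/
def entropyFlux (g h : ℝ) (u : Fin 2 → ℝ) (z : ℝ) (k : Fin 2) : ℝ :=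
  (entropy g h u z + 1 / 2 * g * h ^ 2) * u k

/-- The weak entropy inequality, including the integrability which gives a meaning to it. -/
structure IsWeakEntropy (Ω : Set (Fin 2 → ℝ)) (T g : ℝ) (z h₀ : (Fin 2 → ℝ) → ℝ)
    (u₀ : Fin 2 → (Fin 2 → ℝ) → ℝ) (h : (Fin 2 → ℝ) × ℝ → ℝ)
    (u : Fin 2 → (Fin 2 → ℝ) × ℝ → ℝ) : Prop where
  integrable_entropy :
    IntegrableOn (fun q => entropy g (h q) (fun i => u i q) (z q.1)) (Ω ×ˢ Ioo 0 T)
  integrable_flux : ∀ k,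
    IntegrableOn (fun q => entropyFlux g (h q) (fun i => u i q) (z q.1) k) (Ω ×ˢ Ioo 0 T)
  integrable_init : IntegrableOn (fun x => entropy g (h₀ x) (fun i => u₀ i x) (z x)) Ω
  ineq : ∀ φ, IsTest Ω T φ → (∀ x t, 0 ≤ t → 0 ≤ φ (x, t)) →
    -(∫ q in Ω ×ˢ Ioo 0 T,
        (entropy g (h q) (fun i => u i q) (z q.1) * dt φ q
          + ∑ k, entropyFlux g (h q) (fun i => u i q) (z q.1) k * dx k φ q))
      - ∫ x in Ω, entropy g (h₀ x) (fun i => u₀ i x) (z x) * φ (x, 0) ≤ 0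

end ShallowWater

end

/-!
The proof follows the idea of Lax and Wendroff. Tested against the values of a smooth function on
the grid and summed by parts, each equation of the scheme becomes a sum in which difference
quotients of the test function meet the discrete unknowns. Such a sum is the integral of a piecewise constant
function on `Ω × (0, T)`; if these functions are bounded and converge almost everywhere, dominated
convergence gives the limit of the sum, and the limit of the discrete equation is the weak equation.

The terms of the scheme are products of unknowns taken in different neighbouring cells: upwind
values, half-sums, shifts by an index. So the convergence which is needed is `LocTendsto`: at almost
every point, the values attached to all cells at a bounded distance, in number of cells, from that
point have the same limit. It is deduced from convergence in `L¹` by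
`tendsto_sum_setIntegral_abs_sub`: in `L¹` the limit can be replaced by a continuous function,
which hardly varies between neighbouring cells, and neighbouring cells have comparable areas because
of the bound of the regularity parameter. The same argument applies to the initial data, whose
discretizations are averages. A subsequence then converges almost everywhere, and as the limit
equations do not involve the sequence, a subsequence is enough. `ConvergentScheme` gathers the
outcome, `exists_convergentScheme` provides it, and `ConvergentScheme.sumLim_sum` is the passage to
the limit. With it, `mass_identity` and `momentum_identity` give the weak equations in
`ConvergentScheme.isWeakSolution`.

For the entropy inequality, the fluxes through the dual edges are such that the mass balance holds
on the dual cells too (`dual_mass`). Under a CFL condition, which holds for fine meshes since the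
ratio of the time step to the mesh size tends to zero, this makes upwinding dissipate kinetic energy
(`kinetic_energy_le`, `kinetic_ineq`). The mass equation tested against `h φ` gives the balance of
potential energy, up to the square of the time increments of `h`: one factor is of the order of
the CFL ratio, the other one is controlled by the total variation in time (`rem_le`). The work of
the pressure occurs in both balances, and the upwind choice of the height gives their sum the right sign
(`work_le`). The work of the topography is turned into a time derivative by the mass equation tested
against `z φ`. The sum of all these relations has the entropy inequality as its limit, in
`ConvergentScheme.isWeakEntropy`.
-/

section

/-! ### Geometry of the grid -/

namespace MACGrid

@[simp] lemma e_same (i : Fin 2) : e i i = 1 := by simp [e]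

lemma e_ne {i k : Fin 2} (hk : k ≠ i) : e i k = 0 := by simp [e, hk]

lemma eq_one_sub {i k : Fin 2} (hk : k ≠ i) : k = 1 - i := by
  fin_cases i <;> fin_cases k <;> simp_all

lemma one_sub_ne (i : Fin 2) : 1 - i ≠ i := by fin_cases i <;> simp

lemma len_pos (M : MACGrid) (k : Fin 2) (a : ℤ) : 0 < M.len k a :=
  sub_pos.2 (M.strictMono k (lt_add_one a))

lemma cellArea_pos (M : MACGrid) (K : Fin 2 → ℤ) : 0 < M.cellArea K :=
  mul_pos (M.len_pos _ _) (M.len_pos _ _)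

lemma dualArea_pos (M : MACGrid) (i : Fin 2) (σ : Fin 2 → ℤ) : 0 < M.dualArea i σ :=
  half_pos (add_pos (M.cellArea_pos _) (M.cellArea_pos _))

lemma cellArea_eq (M : MACGrid) (i : Fin 2) (K : Fin 2 → ℤ) :
    M.cellArea K = M.len i (K i) * M.len (1 - i) (K (1 - i)) := by
  fin_cases i <;> simp [cellArea, mul_comm]

/-- A point determines the interval of a strictly increasing sequence which contains it. -/
lemma index_unique (M : MACGrid) {k : Fin 2} {a b : ℤ} {t : ℝ}
    (ha : t ∈ Ico (M.X k a) (M.X k (a + 1))) (hb : t ∈ Ico (M.X k b) (M.X k (b + 1))) : a = b := by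
  have h1 := (M.strictMono k).lt_iff_lt.1 (ha.1.trans_lt hb.2)
  have h2 := (M.strictMono k).lt_iff_lt.1 (hb.1.trans_lt ha.2)
  omega

lemma cell_unique (M : MACGrid) {K L : Fin 2 → ℤ} {x : Fin 2 → ℝ}
    (hK : x ∈ M.cell K) (hL : x ∈ M.cell L) : K = L :=
  funext fun k => M.index_unique (hK k) (hL k)

lemma cell_eq_pi (M : MACGrid) (K : Fin 2 → ℤ) :
    M.cell K = Set.pi univ fun k => Ico (M.X k (K k)) (M.X k (K k + 1)) := by
  ext x; simp [cell]

lemma closedCell_eq_Icc (M : MACGrid) (K : Fin 2 → ℤ) :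
    M.closedCell K = Icc (fun k => M.X k (K k)) (fun k => M.X k (K k + 1)) := by
  ext x; simp [closedCell, Set.mem_Icc, Pi.le_def, forall_and]

lemma cell_subset_closedCell (M : MACGrid) (K : Fin 2 → ℤ) : M.cell K ⊆ M.closedCell K :=
  fun _ hx k => ⟨(hx k).1, (hx k).2.le⟩

lemma measurableSet_cell (M : MACGrid) (K : Fin 2 → ℤ) : MeasurableSet (M.cell K) := by
  rw [cell_eq_pi]; exact MeasurableSet.univ_pi fun _ => measurableSet_Ico

lemma volume_cell (M : MACGrid) (K : Fin 2 → ℤ) :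
    volume (M.cell K) = ENNReal.ofReal (M.cellArea K) := by
  rw [cell_eq_pi, Real.volume_pi_Ico, Fin.prod_univ_two, cellArea,
    ENNReal.ofReal_mul (M.len_pos _ _).le]
  rfl

/-- The union of the half-open cells of the mesh. -/
def cellUnion (M : MACGrid) : Set (Fin 2 → ℝ) := ⋃ K ∈ M.cells, M.cell K

lemma isOpen_domain (M : MACGrid) : IsOpen M.domain := isOpen_interior

/-- Approaching a point of the domain from the upper right shows that it lies in a half-open
cell, not only in a closed one. -/
lemma domain_subset_cellUnion (M : MACGrid) : M.domain ⊆ M.cellUnion := by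
  intro x hx
  have hc : Tendsto (fun s : ℝ => x + fun _ => s) (𝓝[>] 0) (𝓝 x) := by
    have : Tendsto (fun s : ℝ => x + fun _ => s) (𝓝 0) (𝓝 (x + fun _ => (0 : ℝ))) :=
      Continuous.tendsto (by fun_prop) 0
    have h0 : x + (fun _ => (0 : ℝ)) = x := by ext; simp
    rw [h0] at this
    exact this.mono_left nhdsWithin_le_nhds
  have h1 : ∀ᶠ s : ℝ in 𝓝[>] 0, (x + fun _ => s) ∈ ⋃ K ∈ M.cells, M.closedCell K :=
    (hc.eventually (M.isOpen_domain.mem_nhds hx)).mono fun s hs => interior_subset hs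
  have h2 : ∃ᶠ s : ℝ in 𝓝[>] 0, ∃ K ∈ M.cells, (x + fun _ => s) ∈ M.closedCell K := by
    refine (h1.mono fun s hs => ?_).frequently
    simpa using hs
  obtain ⟨K, hK, hf⟩ : ∃ K ∈ M.cells, ∃ᶠ s : ℝ in 𝓝[>] 0, (x + fun _ => s) ∈ M.closedCell K := by
    by_contra! hcon
    refine h2 ?_
    have : ∀ᶠ s : ℝ in 𝓝[>] 0, ∀ K ∈ M.cells, (x + fun _ => s) ∉ M.closedCell K :=
      (Filter.eventually_all_finset M.cells).2 hcon
    filter_upwards [this] with s hs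
    rintro ⟨K, hK, hm⟩
    exact hs K hK hm
  refine mem_biUnion hK fun k => ⟨?_, ?_⟩
  · refine le_of_forall_pos_lt_add fun ε hε => ?_
    obtain ⟨s, hs, hs'⟩ := (hf.and_eventually (Ioo_mem_nhdsGT hε)).exists
    have := (hs k).1
    simp only [Pi.add_apply] at this
    linarith [hs'.2]
  · obtain ⟨s, hs, hs'⟩ := (hf.and_eventually (self_mem_nhdsWithin)).exists
    have := (hs k).2
    simp only [Pi.add_apply] at this
    have : (0:ℝ) < s := hs'
    linarith

lemma ae_mem_domain_of_cell (M : MACGrid) {K : Fin 2 → ℤ} (hK : K ∈ M.cells) :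
    ∀ᵐ x : Fin 2 → ℝ, x ∈ M.cell K → x ∈ M.domain := by
  have h1 : ∀ k : Fin 2, ∀ᵐ x : Fin 2 → ℝ, x k ≠ M.X k (K k) := fun k =>
    Measure.ae_eval_ne (fun _ : Fin 2 => (volume : Measure ℝ)) k _
  filter_upwards [ae_all_iff.2 h1] with x hx hxK
  refine mem_interior.2 ⟨Set.pi univ fun k => Ioo (M.X k (K k)) (M.X k (K k + 1)), ?_,
    isOpen_set_pi finite_univ fun _ _ => isOpen_Ioo, ?_⟩
  · intro y hy
    exact mem_biUnion hK fun k => Ioo_subset_Icc_self (hy k trivial)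
  · intro k _
    exact ⟨lt_of_le_of_ne (hxK k).1 (hx k).symm, (hxK k).2⟩

lemma domain_ae_eq (M : MACGrid) : M.domain =ᵐ[volume] M.cellUnion := by
  have h : ∀ᵐ x : Fin 2 → ℝ, ∀ K ∈ M.cells, x ∈ M.cell K → x ∈ M.domain :=
    (Filter.eventually_all_finset _).2 fun K hK => M.ae_mem_domain_of_cell hK
  filter_upwards [h] with x hx
  refine propext ⟨fun h => M.domain_subset_cellUnion h, fun h => ?_⟩
  obtain ⟨K, hK, hxK⟩ := mem_iUnion₂.1 h
  exact hx K hK hxK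

open Classical in
/-- The index of the cell of the mesh which contains a point (`0` if there is none). -/
noncomputable def idx (M : MACGrid) (x : Fin 2 → ℝ) : Fin 2 → ℤ :=
  if h : ∃ K ∈ M.cells, x ∈ M.cell K then h.choose else 0

lemma idx_eq (M : MACGrid) {K : Fin 2 → ℤ} (hK : K ∈ M.cells) {x : Fin 2 → ℝ}
    (hx : x ∈ M.cell K) : M.idx x = K := by
  have h : ∃ K ∈ M.cells, x ∈ M.cell K := ⟨K, hK, hx⟩
  rw [idx, dif_pos h]
  exact M.cell_unique h.choose_spec.2 hx

lemma idx_spec (M : MACGrid) {x : Fin 2 → ℝ} (hx : x ∈ M.domain) :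
    M.idx x ∈ M.cells ∧ x ∈ M.cell (M.idx x) := by
  obtain ⟨K, hK, hxK⟩ := mem_iUnion₂.1 (M.domain_subset_cellUnion hx)
  rw [M.idx_eq hK hxK]; exact ⟨hK, hxK⟩

lemma mem_cells_of_mem_domain (M : MACGrid) {K : Fin 2 → ℤ} {x : Fin 2 → ℝ}
    (hx : x ∈ M.domain) (hxK : x ∈ M.cell K) : K ∈ M.cells := by
  obtain ⟨h1, h2⟩ := M.idx_spec hx
  rwa [M.cell_unique h2 hxK] at h1

lemma cellDiam_le_size (M : MACGrid) {K : Fin 2 → ℤ} (hK : K ∈ M.cells) :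
    M.cellDiam K ≤ M.size :=
  le_csSup (M.cells.finite_toSet.image _).bddAbove ⟨K, hK, rfl⟩

lemma len_le_size (M : MACGrid) {K : Fin 2 → ℤ} (hK : K ∈ M.cells) (k : Fin 2) :
    M.len k (K k) ≤ M.size := by
  refine le_trans ?_ (M.cellDiam_le_size hK)
  refine Real.le_sqrt_of_sq_le ?_
  fin_cases k
  · simpa using sq_nonneg (M.len 1 (K 1))
  · simpa using sq_nonneg (M.len 0 (K 0))

lemma dist_le_size (M : MACGrid) {K : Fin 2 → ℤ} (hK : K ∈ M.cells) {x y : Fin 2 → ℝ}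
    (hx : x ∈ M.closedCell K) (hy : y ∈ M.closedCell K) : dist x y ≤ M.size := by
  have h0 : 0 ≤ M.size := (M.len_pos 0 _).le.trans (M.len_le_size hK 0)
  refine (dist_pi_le_iff h0).2 fun k => ?_
  refine le_trans ?_ (M.len_le_size hK k)
  rw [Real.dist_eq, abs_le, len]
  constructor <;> linarith [(hx k).1, (hx k).2, (hy k).1, (hy k).2]

/-- A point of a cell of the mesh has a point at distance `O(size)` in each adjacent cell of the
grid, even if that cell does not belong to the mesh. -/
lemma exists_near_step (M : MACGrid) {K : Fin 2 → ℤ} {p : Fin 2 → ℝ} (k : Fin 2)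
    (hp : p ∈ M.cell K) (hK : K ∈ M.cells) :
    (∃ p' ∈ M.cell (K + e k), dist p p' ≤ 2 * M.size) ∧
      ∃ p' ∈ M.cell (K - e k), dist p p' ≤ 2 * M.size := by
  have hl := M.len_le_size hK k
  have hl0 := M.len_pos k (K k)
  have hp1 := (hp k).1
  have hp2 := (hp k).2
  have key : ∀ t : ℝ, |p k - t| ≤ 2 * M.size → dist p (Function.update p k t) ≤ 2 * M.size := by
    intro t ht
    refine (dist_pi_le_iff (by linarith)).2 fun j => ?_
    by_cases hj : j = k
    · subst hj; simpa [Real.dist_eq] using ht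
    · simp [Function.update_of_ne hj]; linarith
  unfold len at hl hl0
  constructor
  · refine ⟨Function.update p k (M.X k (K k + 1)), fun j => ?_, key _ ?_⟩
    · by_cases hj : j = k
      · subst hj
        simp only [Function.update_self, Pi.add_apply, e_same]
        exact ⟨le_rfl, M.strictMono _ (lt_add_one _)⟩
      · simp only [Function.update_of_ne hj, Pi.add_apply, e_ne hj, add_zero]; exact hp j
    · rw [abs_le]; constructor <;> linarith
  · have h3 := M.strictMono k (sub_one_lt (K k))
    set t := max (M.X k (K k - 1)) (M.X k (K k) - M.size) with ht
    have ht1 : t < M.X k (K k) := max_lt h3 (by linarith)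
    have ht2 : M.X k (K k) - M.size ≤ t := le_max_right _ _
    refine ⟨Function.update p k t, fun j => ?_, key _ ?_⟩
    · by_cases hj : j = k
      · subst hj
        simp only [Function.update_self, Pi.sub_apply, e_same, sub_add_cancel]
        exact ⟨le_max_left _ _, ht1⟩
      · simp only [Function.update_of_ne hj, Pi.sub_apply, e_ne hj, sub_zero]; exact hp j
    · rw [abs_le]; constructor <;> linarith

lemma exists_near_line (M : MACGrid) (k : Fin 2) (n : ℕ) {K : Fin 2 → ℤ} {p : Fin 2 → ℝ}
    (hp : p ∈ M.cell K) (hKc : K ∈ M.cells)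
    (hb : Metric.closedBall p (2 * M.size * n) ⊆ M.domain)
    {a : ℤ} (ha : |a| ≤ n) :
    ∃ p' ∈ M.cell (K + a • e k), dist p p' ≤ 2 * M.size * n := by
  induction n generalizing a with
  | zero =>
    have : a = 0 := by simpa using ha
    subst this
    exact ⟨p, by simpa using hp, by simp⟩
  | succ n ih =>
    have h0 : 0 ≤ M.size := (M.len_pos 0 _).le.trans (M.len_le_size hKc 0)
    have hle : 2 * M.size * n ≤ 2 * M.size * (n + 1 : ℕ) := by
      push_cast; nlinarith
    have hb' : Metric.closedBall p (2 * M.size * n) ⊆ M.domain :=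
      (Metric.closedBall_subset_closedBall hle).trans hb
    have hstep : ∀ b : ℤ, |b| ≤ n → (∃ p' ∈ M.cell (K + b • e k + e k),
        dist p p' ≤ 2 * M.size * (n + 1 : ℕ)) ∧ ∃ p' ∈ M.cell (K + b • e k - e k),
        dist p p' ≤ 2 * M.size * (n + 1 : ℕ) := by
      intro b hbn
      obtain ⟨p₁, hp₁, hd₁⟩ := ih hb' hbn
      have hc₁ := M.mem_cells_of_mem_domain (hb' (by rwa [Metric.mem_closedBall, dist_comm])) hp₁
      obtain ⟨⟨q, hq, hdq⟩, ⟨q', hq', hdq'⟩⟩ := M.exists_near_step k hp₁ hc₁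
      refine ⟨⟨q, hq, ?_⟩, ⟨q', hq', ?_⟩⟩
      · push_cast; linarith [dist_triangle p p₁ q]
      · push_cast; linarith [dist_triangle p p₁ q']
    push_cast at ha
    rcases lt_trichotomy a 0 with h | h | h
    · have := (hstep (a + 1) (by rw [abs_of_neg h] at ha; rw [abs_le]; omega)).2
      rwa [add_smul, one_smul, ← add_assoc, add_sub_cancel_right] at this
    · subst h
      exact ⟨p, by simpa using hp, by simp only [dist_self]; positivity⟩
    · have := (hstep (a - 1) (by rw [abs_of_pos h] at ha; rw [abs_le]; omega)).1
      rwa [sub_smul, one_smul, add_assoc, sub_add_cancel] at this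

/-- Around a point which is far from the boundary, with respect to the size of the mesh, all cells
of the grid belong to the mesh. -/
lemma exists_near (M : MACGrid) (n : ℕ) {K L : Fin 2 → ℤ} {p : Fin 2 → ℝ}
    (hp : p ∈ M.cell K) (hKc : K ∈ M.cells)
    (hb : Metric.closedBall p (4 * M.size * n) ⊆ M.domain)
    (hL : ∀ k, |L k - K k| ≤ n) :
    L ∈ M.cells ∧ ∃ p' ∈ M.cell L, dist p p' ≤ 4 * M.size * n := by
  have h0 : 0 ≤ M.size := (M.len_pos 0 _).le.trans (M.len_le_size hKc 0)
  have h0n : 0 ≤ M.size * n := by positivity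
  obtain ⟨p₁, hp₁, hd₁⟩ := M.exists_near_line 0 n hp hKc
    ((Metric.closedBall_subset_closedBall (by nlinarith)).trans hb) (hL 0)
  have hsub : Metric.closedBall p₁ (2 * M.size * n) ⊆ M.domain := by
    refine Subset.trans (Metric.closedBall_subset_closedBall' ?_) hb
    rw [dist_comm] at hd₁
    linarith
  have hc₁ := M.mem_cells_of_mem_domain (hsub (Metric.mem_closedBall_self (by linarith))) hp₁
  obtain ⟨p₂, hp₂, hd₂⟩ := M.exists_near_line 1 n hp₁ hc₁ hsub (hL 1)
  have hLe : K + (L 0 - K 0) • e 0 + (L 1 - K 1) • e 1 = L := by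
    ext k; fin_cases k <;> simp [e]
  rw [hLe] at hp₂
  have hd : dist p p₂ ≤ 4 * M.size * n := by linarith [dist_triangle p p₁ p₂]
  exact ⟨M.mem_cells_of_mem_domain (hb (by rwa [Metric.mem_closedBall, dist_comm])) hp₂,
    p₂, hp₂, hd⟩

end MACGrid

/-! ### Edges, dual cells and regularity -/

namespace MACGrid

lemma center_mem_cell (M : MACGrid) (K : Fin 2 → ℤ) : M.center K ∈ M.cell K := fun k => by
  have := M.len_pos k (K k)
  unfold len at this
  constructor <;> simp only [center] <;> linarith

/-- The midpoint of the edge `σ` orthogonal to the direction `i`. -/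
noncomputable def edgeMid (M : MACGrid) (i : Fin 2) (σ : Fin 2 → ℤ) : Fin 2 → ℝ :=
  Function.update (M.center σ) i (M.X i (σ i))

lemma edgeMid_mem_cell (M : MACGrid) (i : Fin 2) (σ : Fin 2 → ℤ) : M.edgeMid i σ ∈ M.cell σ := by
  intro k
  by_cases hk : k = i
  · subst hk
    simp only [edgeMid, Function.update_self]
    exact ⟨le_rfl, M.strictMono _ (lt_add_one _)⟩
  · simp only [edgeMid, Function.update_of_ne hk]
    exact M.center_mem_cell σ k

lemma mem_intEdges (M : MACGrid) {i : Fin 2} {σ : Fin 2 → ℤ} :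
    σ ∈ M.intEdges i ↔ σ ∈ M.cells ∧ σ - e i ∈ M.cells := by
  simp only [intEdges, Finset.mem_inter, Finset.mem_image, and_congr_right_iff]
  intro _
  constructor
  · rintro ⟨K, hK, rfl⟩; simpa using hK
  · intro h; exact ⟨_, h, sub_add_cancel _ _⟩

lemma intEdges_subset_edges (M : MACGrid) (i : Fin 2) : M.intEdges i ⊆ M.edges i :=
  fun _ hσ => Finset.mem_union_left _ (Finset.mem_inter.1 hσ).1

lemma dualCell_unique (M : MACGrid) {i : Fin 2} {σ τ : Fin 2 → ℤ} {x : Fin 2 → ℝ}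
    (hσ : x ∈ M.dualCell i σ) (hτ : x ∈ M.dualCell i τ) : σ = τ := by
  rcases hσ with ⟨_, h1, h2⟩ | ⟨_, h1, h2⟩ <;> rcases hτ with ⟨_, h3, h4⟩ | ⟨_, h3, h4⟩
  · exact sub_left_injective (M.cell_unique h1 h3)
  · rw [M.cell_unique h1 h3] at h2; exact absurd h4 (not_lt.2 h2)
  · rw [M.cell_unique h1 h3] at h2; exact absurd h2 (not_lt.2 h4)
  · exact M.cell_unique h1 h3

lemma dualCell_eq_pi (M : MACGrid) {i : Fin 2} {σ : Fin 2 → ℤ} (hσ : σ ∈ M.intEdges i) :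
    M.dualCell i σ = Set.pi univ (Function.update
      (fun k => Ico (M.X k (σ k)) (M.X k (σ k + 1))) i
      (Ico (M.center (σ - e i) i) (M.center σ i))) := by
  obtain ⟨h1, h2⟩ := M.mem_intEdges.1 hσ
  have l1 := M.strictMono i (sub_one_lt (σ i))
  have l2 := M.strictMono i (lt_add_one (σ i))
  ext x
  have hj : ∀ k ≠ i, (σ - e i) k = σ k := fun k hk => by simp [e_ne hk]
  have hi : (σ - e i) i = σ i - 1 := by simp
  simp only [dualCell, h1, h2, true_and, mem_ofPred_eq, cell, Set.mem_pi, mem_univ, true_imp_iff]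
  constructor
  · rintro (⟨h, h'⟩ | ⟨h, h'⟩) k <;> by_cases hk : k = i
    · subst hk
      have := (h k).2
      simp only [Function.update_self]
      refine ⟨h', this.trans_le ?_⟩
      rw [hi, sub_add_cancel]; simp only [center]; linarith
    · rw [Function.update_of_ne hk]; have := h k; rwa [hj k hk] at this
    · subst hk
      simp only [Function.update_self]
      refine ⟨le_trans ?_ (h k).1, h'⟩
      simp only [center, hi, sub_add_cancel]; linarith
    · rw [Function.update_of_ne hk]; exact h k
  · intro h
    have hxi := h i
    simp only [Function.update_self, center, hi, sub_add_cancel] at hxi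
    rcases lt_or_ge (x i) (M.X i (σ i)) with hlt | hge
    · refine Or.inl ⟨fun k => ?_, ?_⟩
      · by_cases hk : k = i
        · subst hk
          rw [hi, sub_add_cancel]; exact ⟨by linarith [hxi.1], hlt⟩
        · have := h k
          rw [Function.update_of_ne hk] at this; rwa [hj k hk]
      · simp only [center, hi, sub_add_cancel]; exact hxi.1
    · refine Or.inr ⟨fun k => ?_, ?_⟩
      · by_cases hk : k = i
        · subst hk
          exact ⟨hge, by linarith [hxi.2]⟩
        · have := h k
          rwa [Function.update_of_ne hk] at this
      · simp only [center]; exact hxi.2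

lemma measurableSet_dualCell (M : MACGrid) (i : Fin 2) (σ : Fin 2 → ℤ) :
    MeasurableSet (M.dualCell i σ) := by
  have : M.dualCell i σ = ({x | σ - e i ∈ M.cells} ∩ (M.cell (σ - e i) ∩
      {x | M.center (σ - e i) i ≤ x i})) ∪ ({x | σ ∈ M.cells} ∩ (M.cell σ ∩
      {x | x i < M.center σ i})) := rfl
  rw [this]
  refine (MeasurableSet.inter (.const _) ((M.measurableSet_cell _).inter ?_)).union
    (MeasurableSet.inter (.const _) ((M.measurableSet_cell _).inter ?_))
  · exact measurableSet_le measurable_const (measurable_pi_apply i)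
  · exact measurableSet_lt (measurable_pi_apply i) measurable_const

lemma dualCell_subset (M : MACGrid) (i : Fin 2) (σ : Fin 2 → ℤ) :
    M.dualCell i σ ⊆ M.cell (σ - e i) ∪ M.cell σ := by
  rintro x (⟨_, h, _⟩ | ⟨_, h, _⟩)
  exacts [Or.inl h, Or.inr h]

/-- The distance of the centers of the two cells adjacent to an edge. -/
lemma center_sub_center (M : MACGrid) (i : Fin 2) (σ : Fin 2 → ℤ) :
    M.center σ i - M.center (σ - e i) i = (M.len i (σ i - 1) + M.len i (σ i)) / 2 := by
  simp only [center, len, Pi.sub_apply, e_same, sub_add_cancel]; ring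

lemma edgeLen_mul_dist (M : MACGrid) (i : Fin 2) (σ : Fin 2 → ℤ) :
    M.edgeLen i σ * (M.center σ i - M.center (σ - e i) i) = M.dualArea i σ := by
  rw [center_sub_center, dualArea, cellArea_eq M i, cellArea_eq M i, edgeLen]
  simp only [Pi.sub_apply, e_same, e_ne (one_sub_ne i), sub_zero]; ring

lemma volume_dualCell (M : MACGrid) {i : Fin 2} {σ : Fin 2 → ℤ} (hσ : σ ∈ M.intEdges i) :
    volume (M.dualCell i σ) = ENNReal.ofReal (M.dualArea i σ) := by
  have h : ∀ j, volume ((Function.update (fun k => Ico (M.X k (σ k)) (M.X k (σ k + 1))) i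
      (Ico (M.center (σ - e i) i) (M.center σ i))) j) =
      Function.update (fun k => ENNReal.ofReal (M.len k (σ k))) i
        (ENNReal.ofReal (M.center σ i - M.center (σ - e i) i)) j := by
    intro j
    by_cases hj : j = i
    · subst hj; simp
    · simp [Function.update_of_ne hj, len]
  rw [dualCell_eq_pi M hσ, volume_pi_pi, Finset.prod_congr rfl fun j _ => h j,
    ← edgeLen_mul_dist, edgeLen, ENNReal.ofReal_mul (M.len_pos _ _).le]
  fin_cases i <;> simp [Fin.prod_univ_two, mul_comm]

/-- The regularity of the mesh bounds the ratio of the lengths of orthogonal edges. -/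
lemma len_le_of_regularity (M : MACGrid) {η : ℝ} (hη : M.regularity ≤ η) {K L : Fin 2 → ℤ}
    (hK : K ∈ M.cells) (hL : L ∈ M.cells) (i : Fin 2) :
    M.len (1 - i) (K (1 - i)) ≤ η * M.len i (L i) := by
  have hfin : {r | ∃ i : Fin 2, ∃ σ ∈ M.edges i, ∃ σ' ∈ M.edges (1 - i),
      r = M.edgeLen i σ / M.edgeLen (1 - i) σ'}.Finite := by
    have : {r | ∃ i : Fin 2, ∃ σ ∈ M.edges i, ∃ σ' ∈ M.edges (1 - i),
      r = M.edgeLen i σ / M.edgeLen (1 - i) σ'} = ⋃ i : Fin 2, ⋃ σ ∈ M.edges i,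
        ⋃ σ' ∈ M.edges (1 - i), {M.edgeLen i σ / M.edgeLen (1 - i) σ'} := by
      ext r; simp
    rw [this]
    exact finite_iUnion fun i => (Finset.finite_toSet _).biUnion fun _ _ =>
      (Finset.finite_toSet _).biUnion fun _ _ => finite_singleton _
  have hle : M.edgeLen i K / M.edgeLen (1 - i) L ≤ η :=
    (le_csSup hfin.bddAbove ⟨i, K, Finset.mem_union_left _ hK, L, Finset.mem_union_left _ hL,
      rfl⟩).trans hη
  rw [edgeLen, edgeLen, div_le_iff₀ (M.len_pos _ _)] at hle
  simpa using hle

lemma len_le_sq_of_regularity (M : MACGrid) {η : ℝ} (hη0 : 0 ≤ η) (hη : M.regularity ≤ η)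
    {K L : Fin 2 → ℤ} (hK : K ∈ M.cells) (hL : L ∈ M.cells) (i : Fin 2) :
    M.len i (K i) ≤ η ^ 2 * M.len i (L i) := by
  have h1 := M.len_le_of_regularity hη hK hK (1 - i)
  have h2 := M.len_le_of_regularity hη hK hL i
  rw [sub_sub_cancel] at h1
  nlinarith

lemma size_le_of_regularity (M : MACGrid) {η : ℝ} (hη0 : 0 ≤ η) (hη : M.regularity ≤ η)
    {L : Fin 2 → ℤ} (hL : L ∈ M.cells) (i : Fin 2) :
    M.size ≤ (η + η ^ 2) * M.len i (L i) := by
  refine csSup_le ⟨_, L, hL, rfl⟩ ?_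
  rintro _ ⟨K, hK, rfl⟩
  have h1 := M.len_le_of_regularity hη hK hL i
  have h2 := M.len_le_sq_of_regularity hη0 hη hK hL i
  have l1 := M.len_pos i (K i)
  have l2 := M.len_pos (1 - i) (K (1 - i))
  have : M.cellDiam K = Real.sqrt (M.len i (K i) ^ 2 + M.len (1 - i) (K (1 - i)) ^ 2) := by
    fin_cases i <;> simp [cellDiam, add_comm]
  rw [this]
  refine le_trans (Real.sqrt_le_iff.2 ⟨by positivity, ?_⟩ :
    _ ≤ M.len i (K i) + M.len (1 - i) (K (1 - i))) (by linarith)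
  nlinarith

lemma cellArea_le_of_regularity (M : MACGrid) {η : ℝ} (hη0 : 0 ≤ η) (hη : M.regularity ≤ η)
    {K L : Fin 2 → ℤ} (hK : K ∈ M.cells) (hL : L ∈ M.cells) :
    M.cellArea K ≤ η ^ 4 * M.cellArea L := by
  have h1 := M.len_le_sq_of_regularity hη0 hη hK hL 0
  have h2 := M.len_le_sq_of_regularity hη0 hη hK hL 1
  have := mul_le_mul h1 h2 (M.len_pos _ _).le (by have := M.len_pos 0 (L 0); positivity)
  unfold cellArea
  linarith

end MACGrid

/-! ### Averages over blocks which shrink -/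

/-- Let `f m → w` in `L¹(μ)`, and let `a m j` be the value of `f m`, or its average, on a block
`B m j` of a family of disjoint blocks whose diameter tends to zero. If each `B m j` has a
companion block `P m j` at a small distance and of comparable measure, then the piecewise constant
functions equal to `a m j` on `P m j` converge to `w` in `L¹` as well. -/
lemma tendsto_sum_setIntegral_abs_sub {α ι : Type*} [Nonempty α] [MetricSpace α] [MeasurableSpace α]
    [BorelSpace α] [LocallyCompactSpace α] [SecondCountableTopology α]
    {μ : Measure α} [IsFiniteMeasure μ] [μ.Regular]
    {f : ℕ → α → ℝ} {w : α → ℝ} (hf : ∀ m, Integrable (f m) μ) (hw : Integrable w μ)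
    (hfw : Tendsto (fun m => ∫ q, |f m q - w q| ∂μ) atTop (𝓝 0))
    {J : ℕ → Finset ι} {P B : ℕ → ι → Set α} {a : ℕ → ι → ℝ} {ρ : ℕ → ℝ} {c : ℝ}
    (hPm : ∀ m, ∀ j ∈ J m, MeasurableSet (P m j)) (hBm : ∀ m, ∀ j ∈ J m, MeasurableSet (B m j))
    (hPd : ∀ m, (J m : Set ι).PairwiseDisjoint (P m))
    (hBd : ∀ m, (J m : Set ι).PairwiseDisjoint (B m))
    (hPB : ∀ m, ∀ j ∈ J m, μ.real (P m j) ≤ c * μ.real (B m j))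
    (hρ : Tendsto ρ atTop (𝓝 0)) (hne : ∀ m, ∀ j ∈ J m, (P m j).Nonempty)
    (hdiam : ∀ m, ∀ j ∈ J m, ∀ p ∈ P m j, ∀ p' ∈ P m j ∪ B m j, dist p p' ≤ ρ m)
    (ha : ∀ m, ∀ j ∈ J m, ∀ v : ℝ, μ.real (B m j) * |a m j - v| ≤ ∫ q in B m j, |f m q - v| ∂μ) :
    Tendsto (fun m => ∑ j ∈ J m, ∫ q in P m j, |a m j - w q| ∂μ) atTop (𝓝 0) := by
  set c' := max c 0 with hc'
  have hc0 : 0 ≤ c' := le_max_right _ _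
  have hPB' : ∀ m, ∀ j ∈ J m, μ.real (P m j) ≤ c' * μ.real (B m j) := fun m j hj =>
    (hPB m j hj).trans (mul_le_mul_of_nonneg_right (le_max_left _ _) measureReal_nonneg)
  set V := μ.real univ
  have hV : 0 ≤ V := measureReal_nonneg
  refine (tendsto_order.2 ⟨fun b hb => Eventually.of_forall fun m => hb.trans_le <|
    Finset.sum_nonneg fun j _ => integral_nonneg fun _ => abs_nonneg _, fun b hb => ?_⟩)
  -- the total error is at most `(1 + 2 c' + (1 + c') V) ε`
  obtain ⟨ε, hε, hεb⟩ : ∃ ε > 0, (1 + 2 * c' + (1 + c') * V) * ε < b := by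
    have : 0 < 1 + 2 * c' + (1 + c') * V := by positivity
    refine ⟨b / (2 * (1 + 2 * c' + (1 + c') * V)), by positivity, ?_⟩
    field_simp; norm_num
  obtain ⟨ψ, hψs, hψε, hψc, hψi⟩ := hw.exists_hasCompactSupport_integral_sub_le hε
  have huc : UniformContinuous ψ := hψs.uniformContinuous_of_continuous hψc
  obtain ⟨d, hd, hψd⟩ := Metric.uniformContinuous_iff.1 huc ε hε
  filter_upwards [hρ.eventually (gt_mem_nhds hd), hfw.eventually (gt_mem_nhds hε)] with m hm hm'
  refine lt_of_le_of_lt ?_ hεb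
  choose! p hp using hne m
  have hint1 : Integrable (fun q => |w q - ψ q|) μ := (hw.sub hψi).abs
  have hint2 : Integrable (fun q => |f m q - w q|) μ := ((hf m).sub hw).abs
  have hosc : ∀ j ∈ J m, ∀ q ∈ P m j ∪ B m j, |ψ q - ψ (p j)| ≤ ε := fun j hj q hq => by
    have := hψd (a := p j) (b := q) ((hdiam m j hj _ (hp j hj) q hq).trans_lt hm)
    rw [dist_comm, Real.dist_eq] at this
    exact this.le
  have key : ∀ j ∈ J m, ∫ q in P m j, |a m j - w q| ∂μ ≤
      (∫ q in P m j, |w q - ψ q| ∂μ) + ε * μ.real (P m j) +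
      c' * ((∫ q in B m j, |f m q - w q| ∂μ) + (∫ q in B m j, |w q - ψ q| ∂μ)
        + ε * μ.real (B m j)) := by
    intro j hj
    have h1 : ∫ q in P m j, |a m j - w q| ∂μ ≤ ∫ q in P m j,
        (|w q - ψ q| + (ε + |a m j - ψ (p j)|)) ∂μ := by
      refine setIntegral_mono_on ?_ ?_ (hPm m j hj) fun q hq => ?_
      · exact ((integrable_const _).sub hw).abs.integrableOn
      · exact (hint1.add (integrable_const _)).integrableOn
      · have h1 := hosc j hj q (Or.inl hq)
        have : a m j - w q = (a m j - ψ (p j)) - (ψ q - ψ (p j)) - (w q - ψ q) := by ring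
        rw [this]
        have h2 := abs_sub ((a m j - ψ (p j)) - (ψ q - ψ (p j))) (w q - ψ q)
        have h3 := abs_sub (a m j - ψ (p j)) (ψ q - ψ (p j))
        linarith
    have h2 : ∫ q in B m j, |f m q - ψ (p j)| ∂μ ≤ ∫ q in B m j,
        (|f m q - w q| + (|w q - ψ q| + ε)) ∂μ := by
      refine setIntegral_mono_on ?_ ?_ (hBm m j hj) fun q hq => ?_
      · exact ((hf m).sub (integrable_const _)).abs.integrableOn
      · exact (hint2.add (hint1.add (integrable_const _))).integrableOn
      · have h1 := hosc j hj q (Or.inr hq)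
        have : f m q - ψ (p j) = (f m q - w q) + (w q - ψ q) + (ψ q - ψ (p j)) := by ring
        rw [this]
        have h2 := abs_add_le ((f m q - w q) + (w q - ψ q)) (ψ q - ψ (p j))
        have h3 := abs_add_le (f m q - w q) (w q - ψ q)
        linarith
    rw [integral_add hint1.integrableOn (integrable_const _), setIntegral_const, smul_eq_mul] at h1
    have hint3 : Integrable (fun q => |w q - ψ q| + ε) (μ.restrict (B m j)) :=
      (hint1.add (integrable_const _)).integrableOn
    rw [integral_add hint2.integrableOn hint3, integral_add hint1.integrableOn (integrable_const _),
      setIntegral_const, smul_eq_mul] at h2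
    have h3 := ha m j hj (ψ (p j))
    have h4 := mul_le_mul_of_nonneg_right (hPB' m j hj) (abs_nonneg (a m j - ψ (p j)))
    have h5 := mul_le_mul_of_nonneg_left (h3.trans h2) hc0
    nlinarith
  have hsumP : ∀ F : α → ℝ, Integrable F μ → (∀ q, 0 ≤ F q) →
      ∑ j ∈ J m, ∫ q in P m j, F q ∂μ ≤ ∫ q, F q ∂μ := fun F hF hF0 => by
    rw [← integral_biUnion_finset _ (hPm m) (hPd m) fun _ _ => hF.integrableOn]
    exact setIntegral_le_integral hF (Eventually.of_forall hF0)
  have hsumB : ∀ F : α → ℝ, Integrable F μ → (∀ q, 0 ≤ F q) →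
      ∑ j ∈ J m, ∫ q in B m j, F q ∂μ ≤ ∫ q, F q ∂μ := fun F hF hF0 => by
    rw [← integral_biUnion_finset _ (hBm m) (hBd m) fun _ _ => hF.integrableOn]
    exact setIntegral_le_integral hF (Eventually.of_forall hF0)
  have hVP : ∑ j ∈ J m, μ.real (P m j) ≤ V := by
    simpa [V] using hsumP (fun _ => 1) (integrable_const _) (fun _ => zero_le_one)
  have hVB : ∑ j ∈ J m, μ.real (B m j) ≤ V := by
    simpa [V] using hsumB (fun _ => 1) (integrable_const _) (fun _ => zero_le_one)
  have e1 := hsumP _ hint1 fun _ => abs_nonneg _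
  have e2 := hsumB _ hint1 fun _ => abs_nonneg _
  have e3 := hsumB _ hint2 fun _ => abs_nonneg _
  have e4 : ∫ q, |w q - ψ q| ∂μ ≤ ε := by simpa [Real.norm_eq_abs] using hψε
  refine (Finset.sum_le_sum key).trans ?_
  rw [Finset.sum_add_distrib, Finset.sum_add_distrib, ← Finset.mul_sum, ← Finset.mul_sum,
    Finset.sum_add_distrib, Finset.sum_add_distrib, ← Finset.mul_sum]
  have f1 := mul_le_mul_of_nonneg_left hVP hε.le
  have f2 := mul_le_mul_of_nonneg_left hVB hε.le
  have f3 : c' * ((∑ j ∈ J m, ∫ q in B m j, |f m q - w q| ∂μ) +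
      (∑ j ∈ J m, ∫ q in B m j, |w q - ψ q| ∂μ) + ε * ∑ j ∈ J m, μ.real (B m j)) ≤
      c' * (ε + ε + ε * V) := by gcongr <;> linarith
  nlinarith

/-- Finitely many sequences which tend to zero in `L¹` tend to zero almost everywhere along a
common subsequence. -/
lemma exists_seq_tendsto_ae_of_integral {α κ : Type*} [MeasurableSpace α] {μ : Measure α}
    (S : Finset κ) {G : κ → ℕ → α → ℝ} (hG : ∀ k ∈ S, ∀ m, Integrable (G k m) μ)
    (hlim : ∀ k ∈ S, Tendsto (fun m => ∫ q, |G k m q| ∂μ) atTop (𝓝 0)) :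
    ∃ ns : ℕ → ℕ, StrictMono ns ∧
      ∀ᵐ q ∂μ, ∀ k ∈ S, Tendsto (fun m => G k (ns m) q) atTop (𝓝 0) := by
  set H : ℕ → α → ℝ := fun m q => ∑ k ∈ S, |G k m q|
  have hHi : ∀ m, Integrable (H m) μ := fun m =>
    integrable_finsetSum _ fun k hk => (hG k hk m).abs
  have hH0 : ∀ m q, 0 ≤ H m q := fun m q => Finset.sum_nonneg fun _ _ => abs_nonneg _
  have hHl : Tendsto (fun m => ∫ q, H m q ∂μ) atTop (𝓝 0) := by
    have := tendsto_finsetSum S hlim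
    simp only [Finset.sum_const_zero] at this
    refine this.congr fun m => ?_
    rw [integral_finsetSum _ fun k hk => (hG k hk m).abs]
  have hmeas : TendstoInMeasure μ H atTop 0 := by
    refine tendstoInMeasure_of_tendsto_eLpNorm one_ne_zero (fun m => (hHi m).1)
      aestronglyMeasurable_zero ?_
    have h1 : ∀ m, eLpNorm (H m - 0) 1 μ = ENNReal.ofReal (∫ q, H m q ∂μ) := fun m => by
      rw [sub_zero, eLpNorm_one_eq_lintegral_enorm, ofReal_integral_eq_lintegral_ofReal (hHi m)
        (Eventually.of_forall (hH0 m))]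
      exact lintegral_congr fun q => Real.enorm_of_nonneg (hH0 m q)
    simp_rw [h1]
    have := ENNReal.tendsto_ofReal hHl
    rwa [ENNReal.ofReal_zero] at this
  obtain ⟨ns, hns, hae⟩ := hmeas.exists_seq_tendsto_ae
  refine ⟨ns, hns, ?_⟩
  filter_upwards [hae] with q hq k hk
  refine squeeze_zero_norm (fun m => ?_) hq
  rw [Real.norm_eq_abs]
  exact Finset.single_le_sum (f := fun k => |G k (ns m) q|) (fun _ _ => abs_nonneg _) hk

open MACGrid ShallowWater

/-! ### Discrete functions and their limits -/

/-- `A m` converges to `w` near the indices `κ₀ m`: it does so along every sequence of indices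
which stays at distance at most `r` from `κ₀`. -/
def LocTendsto (κ₀ : ℕ → Fin 2 → ℤ) (r : ℕ) (A : ℕ → (Fin 2 → ℤ) → ℝ) (w : ℝ) : Prop :=
  ∀ κ : ℕ → Fin 2 → ℤ, (∀ m k, |κ m k - κ₀ m k| ≤ r) → Tendsto (fun m => A m (κ m)) atTop (𝓝 w)

namespace LocTendsto

variable {κ₀ : ℕ → Fin 2 → ℤ} {r : ℕ} {A B : ℕ → (Fin 2 → ℤ) → ℝ} {v w : ℝ}

lemma mono {r' : ℕ} (h : LocTendsto κ₀ r A w) (hr : r' ≤ r) : LocTendsto κ₀ r' A w :=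
  fun κ hκ => h κ fun m k => (hκ m k).trans (by exact_mod_cast hr)

lemma const (w : ℝ) : LocTendsto κ₀ r (fun _ _ => w) w := fun _ _ => tendsto_const_nhds

lemma add (hA : LocTendsto κ₀ r A v) (hB : LocTendsto κ₀ r B w) :
    LocTendsto κ₀ r (fun m σ => A m σ + B m σ) (v + w) := fun κ hκ => (hA κ hκ).add (hB κ hκ)

lemma mul (hA : LocTendsto κ₀ r A v) (hB : LocTendsto κ₀ r B w) :
    LocTendsto κ₀ r (fun m σ => A m σ * B m σ) (v * w) := fun κ hκ => (hA κ hκ).mul (hB κ hκ)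

lemma const_mul (c : ℝ) (hA : LocTendsto κ₀ r A v) :
    LocTendsto κ₀ r (fun m σ => c * A m σ) (c * v) := fun κ hκ => (hA κ hκ).const_mul c

lemma comp {f : ℝ → ℝ} (hf : Continuous f) (hA : LocTendsto κ₀ r A v) :
    LocTendsto κ₀ r (fun m σ => f (A m σ)) (f v) := fun κ hκ => (hf.tendsto v).comp (hA κ hκ)

lemma shift_add (hA : LocTendsto κ₀ (r + 1) A v) (i : Fin 2) :
    LocTendsto κ₀ r (fun m σ => A m (σ + e i)) v := fun κ hκ =>
  hA (fun m => κ m + e i) fun m k => by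
    have := hκ m k
    rw [abs_le] at this ⊢
    by_cases hk : k = i
    · subst hk; simp only [Pi.add_apply, e_same]; push_cast; omega
    · simp only [Pi.add_apply, e_ne hk]; push_cast; omega

lemma shift_sub (hA : LocTendsto κ₀ (r + 1) A v) (i : Fin 2) :
    LocTendsto κ₀ r (fun m σ => A m (σ - e i)) v := fun κ hκ =>
  hA (fun m => κ m - e i) fun m k => by
    have := hκ m k
    rw [abs_le] at this ⊢
    by_cases hk : k = i
    · subst hk; simp only [Pi.sub_apply, e_same]; push_cast; omega
    · simp only [Pi.sub_apply, e_ne hk]; push_cast; omega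

lemma ite (P : ℕ → (Fin 2 → ℤ) → Prop) [∀ m σ, Decidable (P m σ)]
    (hA : LocTendsto κ₀ r A v) (hB : LocTendsto κ₀ r B v) :
    LocTendsto κ₀ r (fun m σ => if P m σ then A m σ else B m σ) v := fun κ hκ => by
  have hA' := hA κ hκ
  have hB' := hB κ hκ
  rw [Metric.tendsto_atTop] at *
  intro ε hε
  obtain ⟨a, ha⟩ := hA' ε hε
  obtain ⟨b, hb⟩ := hB' ε hε
  refine ⟨max a b, fun m hm => ?_⟩
  beta_reduce
  split_ifs
  exacts [ha m (le_of_max_le_left hm), hb m (le_of_max_le_right hm)]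

end LocTendsto

/-- `X` converges to the sum of the integrals of two integrable functions. In the applications
`μ` is the Lebesgue measure on the space-time domain, and `ν` that on the space domain, which
carries the contributions of the initial data. -/
structure SumLim {α β : Type*} [MeasurableSpace α] [MeasurableSpace β] (μ : Measure α)
    (ν : Measure β) (X : ℕ → ℝ) (W : α → ℝ) (W₀ : β → ℝ) : Prop where
  integrable : Integrable W μ
  integrable_init : Integrable W₀ ν
  tendsto : Tendsto X atTop (𝓝 (∫ q, W q ∂μ + ∫ x, W₀ x ∂ν))

namespace SumLim

variable {α β : Type*} [MeasurableSpace α] [MeasurableSpace β] {μ : Measure α} {ν : Measure β}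
  {X Y : ℕ → ℝ} {V W : α → ℝ} {V₀ W₀ : β → ℝ}

lemma add (hX : SumLim μ ν X V V₀) (hY : SumLim μ ν Y W W₀) :
    SumLim μ ν (fun m => X m + Y m) (fun q => V q + W q) (fun x => V₀ x + W₀ x) :=
  ⟨hX.1.add hY.1, hX.2.add hY.2, by
    rw [integral_add hX.1 hY.1, integral_add hX.2 hY.2, add_add_add_comm]
    exact hX.3.add hY.3⟩

lemma const_mul (c : ℝ) (hX : SumLim μ ν X V V₀) :
    SumLim μ ν (fun m => c * X m) (fun q => c * V q) (fun x => c * V₀ x) :=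
  ⟨hX.1.const_mul c, hX.2.const_mul c, by
    rw [integral_const_mul, integral_const_mul, ← mul_add]; exact hX.3.const_mul c⟩

lemma sum {ι : Type*} {s : Finset ι} {X : ι → ℕ → ℝ} {W : ι → α → ℝ} {W₀ : ι → β → ℝ}
    (hX : ∀ i ∈ s, SumLim μ ν (X i) (W i) (W₀ i)) :
    SumLim μ ν (fun m => ∑ i ∈ s, X i m) (fun q => ∑ i ∈ s, W i q) (fun x => ∑ i ∈ s, W₀ i x) :=
  ⟨integrable_finsetSum _ fun i hi => (hX i hi).1, integrable_finsetSum _ fun i hi => (hX i hi).2,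
    by
      rw [integral_finsetSum _ fun i hi => (hX i hi).1,
        integral_finsetSum _ fun i hi => (hX i hi).2, ← Finset.sum_add_distrib]
      exact tendsto_finsetSum _ fun i hi => (hX i hi).3⟩

lemma congr (hX : SumLim μ ν X V V₀) (hXY : X =ᶠ[atTop] Y) (hVW : ∀ q, V q = W q)
    (hVW₀ : ∀ x, V₀ x = W₀ x) : SumLim μ ν Y W W₀ := by
  obtain rfl : V = W := funext hVW
  obtain rfl : V₀ = W₀ := funext hVW₀
  exact ⟨hX.1, hX.2, hX.3.congr' hXY⟩

end SumLim

/-- Bounded convergence, where the limit function is not assumed to be measurable. -/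
lemma sumLim_of_bounded {α : Type*} [MeasurableSpace α] {μ : Measure α} [IsFiniteMeasure μ]
    {F : ℕ → α → ℝ} {W : α → ℝ} {C : ℝ} (hF : ∀ m, AEStronglyMeasurable (F m) μ)
    (hb : ∀ᶠ m in atTop, ∀ᵐ q ∂μ, |F m q| ≤ C)
    (hl : ∀ᵐ q ∂μ, Tendsto (fun m => F m q) atTop (𝓝 (W q))) :
    Integrable W μ ∧ Tendsto (fun m => ∫ q, F m q ∂μ) atTop (𝓝 (∫ q, W q ∂μ)) := by
  refine ⟨?_, tendsto_integral_filter_of_dominated_convergence (fun _ => C)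
    (Eventually.of_forall hF) hb (integrable_const _) hl⟩
  refine ⟨aestronglyMeasurable_of_tendsto_ae atTop hF hl, ?_⟩
  refine HasFiniteIntegral.of_bounded (C := C) ?_
  obtain ⟨m₀, hm₀⟩ := eventually_atTop.1 hb
  have hb' : ∀ᵐ q ∂μ, ∀ m ≥ m₀, |F m q| ≤ C :=
    ae_all_iff.2 fun m => by
      by_cases hm : m ≥ m₀
      · filter_upwards [hm₀ m hm] with q hq _ using hq
      · exact Eventually.of_forall fun q h => absurd h hm
  filter_upwards [hb', hl] with q hq hlq
  exact le_of_tendsto hlq.abs (eventually_atTop.2 ⟨m₀, hq⟩)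

lemma sum_shift (S : Finset (Fin 2 → ℤ)) (f : (Fin 2 → ℤ) → ℝ) (s : Fin 2 → ℤ)
    (hf : ∀ σ, f σ ≠ 0 → σ ∈ S ∧ σ - s ∈ S) : ∑ σ ∈ S, f (σ + s) = ∑ σ ∈ S, f σ := by
  classical
  refine Finset.sum_bij_ne_zero (fun σ _ _ => σ + s) (fun σ _ h => (hf _ h).1)
    (fun _ _ _ _ _ _ h => add_right_cancel h) (fun σ _ h => ?_) fun _ _ _ => rfl
  exact ⟨σ - s, (hf σ h).2, by simpa using h, by simp⟩

namespace MACGrid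

/-- The measure, in the space-time domain, of a product of a set of space points covered by the
mesh and of a set of times. -/
lemma volume_restrict_prod (M : MACGrid) {T : ℝ} {A : Set (Fin 2 → ℝ)} {I : Set ℝ}
    (hA : A ⊆ M.cellUnion) (hAm : MeasurableSet A) (hI : I ⊆ Ico 0 T) (hIm : MeasurableSet I) :
    (volume.restrict (M.domain ×ˢ Ioo 0 T)) (A ×ˢ I) = volume A * volume I := by
  rw [Measure.volume_eq_prod, ← Measure.prod_restrict,
    Measure.restrict_congr_set M.domain_ae_eq, Measure.restrict_congr_set Ioo_ae_eq_Ico,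
    Measure.prod_prod, Measure.restrict_apply hAm, Measure.restrict_apply hIm,
    inter_eq_left.2 hA, inter_eq_left.2 hI]

lemma volume_restrict_domain (M : MACGrid) {A : Set (Fin 2 → ℝ)}
    (hA : A ⊆ M.cellUnion) (hAm : MeasurableSet A) :
    (volume.restrict M.domain) A = volume A := by
  rw [Measure.restrict_congr_set M.domain_ae_eq, Measure.restrict_apply hAm, inter_eq_left.2 hA]

lemma cell_subset_cellUnion (M : MACGrid) {K : Fin 2 → ℤ} (hK : K ∈ M.cells) :
    M.cell K ⊆ M.cellUnion := fun _ hx => mem_biUnion hK hx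

end MACGrid

lemma slab_subset {N n : ℕ} {τ T : ℝ} (hτ : 0 < τ) (hT : N * τ = T) (hn : n < N) :
    Ico (n * τ) ((n + 1) * τ) ⊆ Ico 0 T := by
  refine Ico_subset_Ico (by positivity) ?_
  rw [← hT]
  have : ((n + 1 : ℕ) : ℝ) ≤ N := by exact_mod_cast hn
  push_cast at this
  exact mul_le_mul_of_nonneg_right this hτ.le

lemma mem_slab_iff {n : ℕ} {τ t : ℝ} (hτ : 0 < τ) (ht : 0 ≤ t) :
    t ∈ Ico (n * τ) ((n + 1) * τ) ↔ ⌊t / τ⌋₊ = n := by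
  rw [Nat.floor_eq_iff (by positivity), mem_Ico, le_div_iff₀ hτ, div_lt_iff₀ hτ]

lemma floor_lt_of_lt {N : ℕ} {τ t T : ℝ} (hτ : 0 < τ) (hT : N * τ = T) (ht : 0 ≤ t) (htT : t < T) :
    ⌊t / τ⌋₊ < N := by
  rw [Nat.floor_lt (by positivity), div_lt_iff₀ hτ, hT]; exact htT

namespace MACGrid

/-- The piecewise constant function with values `a n K`, as a finite sum. -/
lemma sum_indicator_eq (M : MACGrid) {N : ℕ} {τ T : ℝ} (hτ : 0 < τ) (hT : N * τ = T)
    (a : ℕ → (Fin 2 → ℤ) → ℝ) {q : (Fin 2 → ℝ) × ℝ} (hq : q ∈ M.domain ×ˢ Ioo 0 T) :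
    ∑ n ∈ Finset.range N, ∑ K ∈ M.cells,
      (M.cell K ×ˢ Ico (n * τ) ((n + 1) * τ)).indicator (fun _ => a n K) q =
    a ⌊q.2 / τ⌋₊ (M.idx q.1) := by
  obtain ⟨hK, hqK⟩ := M.idx_spec hq.1
  rw [Finset.sum_eq_single_of_mem _ (Finset.mem_range.2 (floor_lt_of_lt hτ hT hq.2.1.le hq.2.2)),
    Finset.sum_eq_single_of_mem _ hK]
  · rw [indicator_of_mem]
    exact ⟨hqK, (mem_slab_iff hτ hq.2.1.le).2 rfl⟩
  · intro L _ hL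
    rw [indicator_of_notMem]
    exact fun h => hL (M.cell_unique h.1 hqK)
  · intro n _ hn
    refine Finset.sum_eq_zero fun K _ => ?_
    rw [indicator_of_notMem]
    exact fun h => hn ((mem_slab_iff hτ hq.2.1.le).1 h.2).symm

lemma sum_indicator_cell_eq (M : MACGrid) (a : (Fin 2 → ℤ) → ℝ) {x : Fin 2 → ℝ}
    (hx : x ∈ M.domain) : ∑ K ∈ M.cells, (M.cell K).indicator (fun _ => a K) x = a (M.idx x) := by
  obtain ⟨hK, hqK⟩ := M.idx_spec hx
  rw [Finset.sum_eq_single_of_mem _ hK]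
  · rw [indicator_of_mem hqK]
  · intro L _ hL
    rw [indicator_of_notMem]
    exact fun h => hL (M.cell_unique h hqK)

lemma sum_eq_integral (M : MACGrid) {N : ℕ} {τ T : ℝ} (hτ : 0 < τ) (hT : N * τ = T)
    (a : ℕ → (Fin 2 → ℤ) → ℝ) :
    AEStronglyMeasurable (fun q : (Fin 2 → ℝ) × ℝ => a ⌊q.2 / τ⌋₊ (M.idx q.1))
      (volume.restrict (M.domain ×ˢ Ioo 0 T)) ∧
    ∑ n ∈ Finset.range N, ∑ K ∈ M.cells, τ * M.cellArea K * a n K =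
      ∫ q in M.domain ×ˢ Ioo 0 T, a ⌊q.2 / τ⌋₊ (M.idx q.1) := by
  have hms : MeasurableSet (M.domain ×ˢ Ioo 0 T) :=
    M.isOpen_domain.measurableSet.prod measurableSet_Ioo
  have hmeas : ∀ n K, MeasurableSet (M.cell K ×ˢ Ico (n * τ) ((n + 1) * τ)) := fun n K =>
    (M.measurableSet_cell K).prod measurableSet_Ico
  have hae : (fun q => ∑ n ∈ Finset.range N, ∑ K ∈ M.cells,
      (M.cell K ×ˢ Ico (n * τ) ((n + 1) * τ)).indicator (fun _ => a n K) q)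
      =ᵐ[volume.restrict (M.domain ×ˢ Ioo 0 T)] fun q => a ⌊q.2 / τ⌋₊ (M.idx q.1) := by
    filter_upwards [ae_restrict_mem hms] with q hq using M.sum_indicator_eq hτ hT a hq
  have hvol : ∀ n ∈ Finset.range N, ∀ K ∈ M.cells,
      (volume.restrict (M.domain ×ˢ Ioo 0 T)) (M.cell K ×ˢ Ico (n * τ) ((n + 1) * τ)) =
        ENNReal.ofReal (τ * M.cellArea K) := fun n hn K hK => by
    rw [M.volume_restrict_prod (M.cell_subset_cellUnion hK) (M.measurableSet_cell K)
      (slab_subset hτ hT (Finset.mem_range.1 hn)) measurableSet_Ico, M.volume_cell,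
      Real.volume_Ico, ← ENNReal.ofReal_mul (M.cellArea_pos K).le]
    congr 1; ring
  have hint : ∀ n ∈ Finset.range N, ∀ K ∈ M.cells, Integrable
      ((M.cell K ×ˢ Ico (n * τ) ((n + 1) * τ)).indicator (fun _ => a n K))
      (volume.restrict (M.domain ×ˢ Ioo 0 T)) := fun n hn K hK => by
    refine (integrable_indicator_iff (hmeas n K)).2 (integrableOn_const ?_)
    rw [hvol n hn K hK]; exact ENNReal.ofReal_ne_top
  constructor
  · refine AEStronglyMeasurable.congr ?_ hae
    exact (integrable_finsetSum _ fun n hn => integrable_finsetSum _ (hint n hn)).1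
  · rw [← integral_congr_ae hae, integral_finsetSum _ fun n hn =>
      integrable_finsetSum _ (hint n hn)]
    refine Finset.sum_congr rfl fun n hn => ?_
    rw [integral_finsetSum _ (hint n hn)]
    refine Finset.sum_congr rfl fun K hK => ?_
    rw [integral_indicator_const _ (hmeas n K), Measure.real, hvol n hn K hK,
      ENNReal.toReal_ofReal (mul_pos hτ (M.cellArea_pos K)).le, smul_eq_mul]

lemma sum_cell_eq_integral (M : MACGrid) (a : (Fin 2 → ℤ) → ℝ) :
    AEStronglyMeasurable (fun x : Fin 2 → ℝ => a (M.idx x)) (volume.restrict M.domain) ∧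
    ∀ φ : (Fin 2 → ℝ) → ℝ, IntegrableOn φ M.domain → ∑ K ∈ M.cells, a K * ∫ x in M.cell K, φ x =
      ∫ x in M.domain, a (M.idx x) * φ x := by
  have hms : MeasurableSet M.domain := M.isOpen_domain.measurableSet
  have hae : (fun x => ∑ K ∈ M.cells, (M.cell K).indicator (fun _ => a K) x)
      =ᵐ[volume.restrict M.domain] fun x => a (M.idx x) := by
    filter_upwards [ae_restrict_mem hms] with x hx using M.sum_indicator_cell_eq a hx
  refine ⟨AEStronglyMeasurable.congr ?_ hae, fun φ hφ => ?_⟩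
  · exact (Measurable.stronglyMeasurable (Finset.measurable_sum _ fun K _ =>
      measurable_const.indicator (M.measurableSet_cell K))).aestronglyMeasurable
  · have hint : ∀ K ∈ M.cells, Integrable ((M.cell K).indicator fun x => a K * φ x)
        (volume.restrict M.domain) := fun K _ =>
      (Integrable.const_mul hφ _).indicator (M.measurableSet_cell K)
    have h2 : ∀ x ∈ M.domain, a (M.idx x) * φ x = ∑ K ∈ M.cells,
        (M.cell K).indicator (fun x => a K * φ x) x := fun x hx => by
      rw [← M.sum_indicator_cell_eq a hx, Finset.sum_mul]
      refine Finset.sum_congr rfl fun K _ => ?_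
      by_cases h : x ∈ M.cell K <;> simp [h]
    rw [setIntegral_congr_fun hms h2, integral_finsetSum _ hint]
    refine Finset.sum_congr rfl fun K hK => ?_
    rw [integral_indicator (M.measurableSet_cell K), integral_const_mul]
    congr 2
    rw [Measure.restrict_congr_set M.domain_ae_eq,
      Measure.restrict_restrict (M.measurableSet_cell K),
      inter_eq_left.2 (M.cell_subset_cellUnion hK)]

end MACGrid

/-! ### Convergent schemes and the passage to the limit -/

lemma MACGrid.abs_neg_e_le (i k : Fin 2) : |(-e i) k| ≤ 2 := by
  by_cases hk : k = i
  · subst hk; simp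
  · simp [e_ne hk]

/-- A sequence of discrete solutions which converges almost everywhere, together with the uniform
bounds. Compared with the sequence given in the theorem, the discrete functions have been modified
where the scheme does not see them, so that the bounds hold everywhere, and a subsequence has been
extracted. Accordingly, the equations of the scheme are asserted for `n + 1 < N` only. Pointwise
convergence holds for all values attached to cells and edges at a bounded distance, in number of
cells, from the given point. `DZ` is the discrete gradient of the topography. -/
structure ConvergentScheme (Ω : Set (Fin 2 → ℝ)) (T g : ℝ) (z h₀ : (Fin 2 → ℝ) → ℝ)
    (u₀ : Fin 2 → (Fin 2 → ℝ) → ℝ) (hbar : (Fin 2 → ℝ) × ℝ → ℝ)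
    (ubar : Fin 2 → (Fin 2 → ℝ) × ℝ → ℝ) where
  M : ℕ → MACGrid
  N : ℕ → ℕ
  τ : ℕ → ℝ
  Z : ℕ → (Fin 2 → ℤ) → ℝ
  DZ : ℕ → Fin 2 → (Fin 2 → ℤ) → ℝ
  h : ℕ → ℕ → (Fin 2 → ℤ) → ℝ
  u : ℕ → ℕ → Fin 2 → (Fin 2 → ℤ) → ℝ
  C : ℝ
  one_le_C : 1 ≤ C
  domain_eq : ∀ m, (M m).domain = Ω
  volume_lt_top : volume Ω < ⊤
  τ_pos : ∀ m, 0 < τ m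
  mul_τ : ∀ m, N m * τ m = T
  τ_lim : Tendsto τ atTop (𝓝 0)
  size_lim : Tendsto (fun m => (M m).size) atTop (𝓝 0)
  size_le : ∀ m, ∀ K ∈ (M m).cells, ∀ i, (M m).size ≤ C * (M m).len i (K i)
  h_lower : ∀ m n K, 1 / C ≤ h m n K
  h_upper : ∀ m n K, h m n K ≤ C
  u_bound : ∀ m n i σ, |u m n i σ| ≤ C
  u_ext : ∀ m n i, ∀ σ ∉ (M m).intEdges i, u m n i σ = 0
  Z_bound : ∀ m K, |Z m K| ≤ C
  DZ_bound : ∀ m i σ, |DZ m i σ| ≤ C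
  Z_sub : ∀ m i, ∀ σ ∈ (M m).intEdges i,
    Z m σ - Z m (σ - e i) = ((M m).center σ i - (M m).center (σ - e i) i) * DZ m i σ
  mass : ∀ m n, n + 1 < N m → ∀ K ∈ (M m).cells,
    (h m (n + 1) K - h m n K) / τ m + (M m).divCell (h m n) (u m n) K = 0
  momentum : ∀ m n, n + 1 < N m → ∀ i, ∀ σ ∈ (M m).intEdges i,
    ((M m).dualHeight i (h m (n + 1)) σ * u m (n + 1) i σ
        - (M m).dualHeight i (h m n) σ * u m n i σ) / τ m
      + (M m).convection (h m n) (u m n) i σ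
      + (M m).discreteGrad i (fun K => 1 / 2 * g * h m (n + 1) K ^ 2) σ
      + g * centeredHeight i (h m (n + 1)) σ * (M m).discreteGrad i (Z m) σ = 0
  Z_conv : ∀ x ∈ Ω, LocTendsto (fun m => (M m).idx x) 5 Z (z x)
  DZ_conv : ∀ x ∈ Ω, ∀ i,
    LocTendsto (fun m => (M m).idx x) 5 (fun m => DZ m i) (ShallowWater.pd i z x)
  h_conv : ∀ᵐ q ∂(volume.restrict (Ω ×ˢ Ioo 0 T)),
    LocTendsto (fun m => (M m).idx q.1) 5 (fun m => h m (⌊q.2 / τ m⌋₊ + 1)) (hbar q)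
  u_conv : ∀ i, ∀ᵐ q ∂(volume.restrict (Ω ×ˢ Ioo 0 T)),
    LocTendsto (fun m => (M m).idx q.1) 5 (fun m => u m (⌊q.2 / τ m⌋₊ + 1) i) (ubar i q)
  h₀_conv : ∀ᵐ x ∂(volume.restrict Ω),
    LocTendsto (fun m => (M m).idx x) 5 (fun m => h m 0) (h₀ x)
  u₀_conv : ∀ i, ∀ᵐ x ∂(volume.restrict Ω),
    LocTendsto (fun m => (M m).idx x) 5 (fun m => u m 0 i) (u₀ i x)

namespace ConvergentScheme

variable {Ω : Set (Fin 2 → ℝ)} {T g : ℝ} {z h₀ : (Fin 2 → ℝ) → ℝ}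
  {u₀ : Fin 2 → (Fin 2 → ℝ) → ℝ} {hbar : (Fin 2 → ℝ) × ℝ → ℝ}
  {ubar : Fin 2 → (Fin 2 → ℝ) × ℝ → ℝ} (S : ConvergentScheme Ω T g z h₀ u₀ hbar ubar)

/-- The indices of the cells which contain a given point. -/
noncomputable def idx (x : Fin 2 → ℝ) (m : ℕ) : Fin 2 → ℤ := (S.M m).idx x

/-- The index of the time step which contains a given time. -/
noncomputable def tidx (t : ℝ) (m : ℕ) : ℕ := ⌊t / S.τ m⌋₊

/-- The points of space-time at which the discrete solutions converge. -/
structure RegularAt (q : (Fin 2 → ℝ) × ℝ) : Prop where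
  mem : q ∈ Ω ×ˢ Ioo 0 T
  h_conv : LocTendsto (S.idx q.1) 5 (fun m => S.h m (S.tidx q.2 m + 1)) (hbar q)
  u_conv : ∀ i, LocTendsto (S.idx q.1) 5 (fun m => S.u m (S.tidx q.2 m + 1) i) (ubar i q)

/-- The points of space at which the discrete initial data converge. -/
structure InitRegularAt (x : Fin 2 → ℝ) : Prop where
  mem : x ∈ Ω
  h_conv : LocTendsto (S.idx x) 5 (fun m => S.h m 0) (h₀ x)
  u_conv : ∀ i, LocTendsto (S.idx x) 5 (fun m => S.u m 0 i) (u₀ i x)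

include S in
lemma isOpen : IsOpen Ω := S.domain_eq 0 ▸ (S.M 0).isOpen_domain

lemma ae_regularAt : ∀ᵐ q ∂(volume.restrict (Ω ×ˢ Ioo 0 T)), S.RegularAt q := by
  filter_upwards [S.h_conv, ae_all_iff.2 S.u_conv,
    ae_restrict_mem (S.isOpen.measurableSet.prod measurableSet_Ioo)] with q h1 h2 h3
  exact ⟨h3, h1, h2⟩

lemma ae_initRegularAt : ∀ᵐ x ∂(volume.restrict Ω), S.InitRegularAt x := by
  filter_upwards [S.h₀_conv, ae_all_iff.2 S.u₀_conv,
    ae_restrict_mem S.isOpen.measurableSet] with q h1 h2 h3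
  exact ⟨h3, h1, h2⟩

include S in
lemma finite_Ω : IsFiniteMeasure (volume.restrict Ω) := ⟨by simpa using S.volume_lt_top⟩

include S in
lemma finite_prod : IsFiniteMeasure (volume.restrict (Ω ×ˢ Ioo 0 T)) := ⟨by
  rw [Measure.restrict_apply_univ, Measure.volume_eq_prod, Measure.prod_prod, Real.volume_Ioo]
  exact ENNReal.mul_lt_top S.volume_lt_top ENNReal.ofReal_lt_top⟩

/-- The cell `σ` is at a distance at least `3`, in number of cells, from the boundary. -/
def Inner (m : ℕ) (σ : Fin 2 → ℤ) : Prop :=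
  ∀ L : Fin 2 → ℤ, (∀ k, |L k - σ k| ≤ 3) → L ∈ (S.M m).cells

/-- The discrete function `E` vanishes at the last two time steps and near the boundary. -/
def Supported (m : ℕ) (E : ℕ → (Fin 2 → ℤ) → ℝ) : Prop :=
  ∀ n σ, E n σ ≠ 0 → n + 2 < S.N m ∧ S.Inner m σ

lemma Supported.congr {m : ℕ} {E F : ℕ → (Fin 2 → ℤ) → ℝ} (hE : S.Supported m E)
    (hF : ∀ n σ, E n σ = 0 → F n σ = 0) : S.Supported m F :=
  fun n σ h => hE n σ fun h0 => h (hF n σ h0)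

lemma sum_shift_cells {m : ℕ} {E : (Fin 2 → ℤ) → ℝ}
    (hE : ∀ σ, E σ ≠ 0 → S.Inner m σ)
    {s : Fin 2 → ℤ} (hs : ∀ k, |s k| ≤ 2) :
    ∑ σ ∈ (S.M m).cells, (S.M m).cellArea (σ + s) * E σ =
      ∑ K ∈ (S.M m).cells, (S.M m).cellArea K * E (K - s) := by
  rw [← sum_shift _ (fun K => (S.M m).cellArea K * E (K - s)) s]
  · simp only [add_sub_cancel_right]
  · intro σ hσ
    have h := hE _ (right_ne_zero_of_mul hσ)
    refine ⟨h σ fun k => ?_, h _ fun k => by simp⟩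
    have := hs k
    simp only [Pi.sub_apply, sub_sub_cancel]; omega

/-- Sums over cells and time steps converge, by bounded convergence. -/
lemma sumLim_sum {E : ℕ → ℕ → (Fin 2 → ℤ) → ℝ} {W : (Fin 2 → ℝ) × ℝ → ℝ} {B : ℝ}
    {s : Fin 2 → ℤ} (hs : ∀ k, |s k| ≤ 2) (hb : ∀ m n σ, |E m n σ| ≤ B)
    (hsupp : ∀ᶠ m in atTop, S.Supported m (E m))
    (hlim : ∀ q, S.RegularAt q →
      LocTendsto (S.idx q.1) 2 (fun m => E m (S.tidx q.2 m)) (W q)) :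
    SumLim (volume.restrict (Ω ×ˢ Ioo 0 T)) (volume.restrict Ω)
      (fun m => ∑ n ∈ Finset.range (S.N m), ∑ σ ∈ (S.M m).cells,
        S.τ m * (S.M m).cellArea (σ + s) * E m n σ) W (fun _ => 0) := by
  have := S.finite_prod
  have hmain := sumLim_of_bounded (μ := volume.restrict (Ω ×ˢ Ioo 0 T)) (W := W) (C := B)
    (F := fun m q => E m ⌊q.2 / S.τ m⌋₊ ((S.M m).idx q.1 - s))
    (fun m => by
      have := ((S.M m).sum_eq_integral (S.τ_pos m) (S.mul_τ m)
        (fun n K => E m n (K - s))).1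
      rwa [S.domain_eq m] at this)
    (Eventually.of_forall fun m => Eventually.of_forall fun q => hb _ _ _)
    (by
      filter_upwards [S.ae_regularAt] with q hq
      refine hlim q hq (fun m => (S.M m).idx q.1 - s) fun m k => ?_
      simpa [idx] using hs k)
  refine ⟨hmain.1, integrable_zero _ _ _, ?_⟩
  simp only [integral_zero, add_zero]
  refine hmain.2.congr' ?_
  filter_upwards [hsupp] with m hm
  have h1 := ((S.M m).sum_eq_integral (S.τ_pos m) (S.mul_τ m)
    (fun n K => E m n (K - s))).2
  rw [S.domain_eq m] at h1
  rw [← h1]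
  refine Finset.sum_congr rfl fun n _ => ?_
  simp only [mul_assoc, ← Finset.mul_sum]
  rw [← S.sum_shift_cells (fun σ hσ => (hm _ σ hσ).2) hs]

lemma sumLim_init {E : ℕ → (Fin 2 → ℤ) → ℝ} {W : (Fin 2 → ℝ) → ℝ} {B : ℝ}
    {s : Fin 2 → ℤ} (hs : ∀ k, |s k| ≤ 2) (hb : ∀ m σ, |E m σ| ≤ B)
    (hsupp : ∀ᶠ m in atTop, ∀ σ, E m σ ≠ 0 → S.Inner m σ)
    (hlim : ∀ x, S.InitRegularAt x → LocTendsto (S.idx x) 2 E (W x)) :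
    SumLim (volume.restrict (Ω ×ˢ Ioo 0 T)) (volume.restrict Ω)
      (fun m => ∑ σ ∈ (S.M m).cells, (S.M m).cellArea (σ + s) * E m σ) (fun _ => 0) W := by
  have := S.finite_Ω
  have hmain := sumLim_of_bounded (μ := volume.restrict Ω) (W := W) (C := B)
    (F := fun m x => E m ((S.M m).idx x - s))
    (fun m => by
      have := ((S.M m).sum_cell_eq_integral (fun K => E m (K - s))).1
      rwa [S.domain_eq m] at this)
    (Eventually.of_forall fun m => Eventually.of_forall fun q => hb _ _)
    (by
      filter_upwards [S.ae_initRegularAt] with x hx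
      refine hlim x hx (fun m => (S.M m).idx x - s) fun m k => ?_
      simpa [idx] using hs k)
  refine ⟨integrable_zero _ _ _, hmain.1, ?_⟩
  simp only [integral_zero, zero_add]
  refine hmain.2.congr' ?_
  filter_upwards [hsupp] with m hm
  have h1 := ((S.M m).sum_cell_eq_integral (fun K => E m (K - s))).2 (fun _ => 1)
    (by rw [S.domain_eq m]; exact integrable_const _)
  simp only [mul_one, S.domain_eq m] at h1
  rw [S.sum_shift_cells hm hs, ← h1]
  refine Finset.sum_congr rfl fun K _ => ?_
  rw [setIntegral_const, smul_eq_mul, mul_one, Measure.real, (S.M m).volume_cell,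
    ENNReal.toReal_ofReal ((S.M m).cellArea_pos K).le, mul_comm]

lemma sum_init_le {m : ℕ} {E : (Fin 2 → ℤ) → ℝ} {B : ℝ} {s : Fin 2 → ℤ} (hs : ∀ k, |s k| ≤ 2)
    (hb : ∀ σ, |E σ| ≤ B)
    (hE : ∀ σ, E σ ≠ 0 → S.Inner m σ) :
    |∑ σ ∈ (S.M m).cells, (S.M m).cellArea (σ + s) * E σ| ≤ B * (volume Ω).toReal := by
  have := S.finite_Ω
  rw [S.sum_shift_cells hE hs]
  have h1 := ((S.M m).sum_cell_eq_integral (fun _ => B)).2 (fun _ => 1)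
    (by rw [S.domain_eq m]; exact integrable_const _)
  simp only [mul_one, S.domain_eq m, setIntegral_const, smul_eq_mul] at h1
  refine (Finset.abs_sum_le_sum_abs _ _).trans ?_
  rw [← Measure.real, mul_comm B, ← h1]
  refine Finset.sum_le_sum fun K _ => ?_
  have hv : volume.real ((S.M m).cell K) = (S.M m).cellArea K := by
    rw [Measure.real, (S.M m).volume_cell, ENNReal.toReal_ofReal ((S.M m).cellArea_pos K).le]
  rw [hv, abs_mul, abs_of_pos ((S.M m).cellArea_pos K), mul_comm]
  exact mul_le_mul_of_nonneg_right (hb _) ((S.M m).cellArea_pos K).le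

/-- The same limit for sums of quantities taken at the time level `n`: the contribution of the
first time step is negligible. -/
lemma sumLim_level {E : ℕ → ℕ → (Fin 2 → ℤ) → ℝ} {W : (Fin 2 → ℝ) × ℝ → ℝ} {B : ℝ}
    {s : Fin 2 → ℤ} (hs : ∀ k, |s k| ≤ 2) (hb : ∀ m n σ, |E m n σ| ≤ B)
    (hsupp : ∀ᶠ m in atTop, S.Supported m (E m))
    (hlim : ∀ q, S.RegularAt q →
      LocTendsto (S.idx q.1) 2 (fun m => E m (S.tidx q.2 m + 1)) (W q)) :
    SumLim (volume.restrict (Ω ×ˢ Ioo 0 T)) (volume.restrict Ω)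
      (fun m => ∑ n ∈ Finset.range (S.N m), ∑ σ ∈ (S.M m).cells,
        S.τ m * (S.M m).cellArea (σ + s) * E m n σ) W (fun _ => 0) := by
  have h1 := S.sumLim_sum (E := fun m n => E m (n + 1)) hs (fun m n => hb m (n + 1))
    (hsupp.mono fun m hm n σ hne => ⟨by have := (hm _ _ hne).1; omega, (hm _ _ hne).2⟩) hlim
  refine ⟨h1.1, h1.2, ?_⟩
  have h0 : Tendsto (fun m => S.τ m * ∑ σ ∈ (S.M m).cells, (S.M m).cellArea (σ + s) * E m 0 σ)
      atTop (𝓝 0) := by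
    have hl : Tendsto (fun m => S.τ m * (B * (volume Ω).toReal)) atTop (𝓝 0) := by
      simpa using S.τ_lim.mul_const (B * (volume Ω).toReal)
    refine squeeze_zero_norm' ?_ hl
    filter_upwards [hsupp] with m hm
    rw [Real.norm_eq_abs, abs_mul, abs_of_pos (S.τ_pos m)]
    exact mul_le_mul_of_nonneg_left (S.sum_init_le hs (hb m 0) fun σ hσ => (hm 0 σ hσ).2)
      (S.τ_pos m).le
  have h2 := h1.3.add h0
  rw [add_zero] at h2
  refine h2.congr' ?_
  filter_upwards [hsupp] with m hm
  have hz : ∀ σ, E m (S.N m) σ = 0 := fun σ => by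
    by_contra hne
    have := (hm _ _ hne).1
    omega
  have h3 := Finset.sum_range_succ' (fun n => ∑ σ ∈ (S.M m).cells,
        S.τ m * (S.M m).cellArea (σ + s) * E m n σ) (S.N m)
  rw [Finset.sum_range_succ] at h3
  simp only [hz, mul_zero, Finset.sum_const_zero, add_zero] at h3
  rw [h3, Finset.mul_sum]
  simp only [mul_assoc]

/-- The areas of the cells may be replaced by those of the dual cells. -/
lemma sumLim_sum_dual {E : ℕ → ℕ → (Fin 2 → ℤ) → ℝ} {W : (Fin 2 → ℝ) × ℝ → ℝ} {B : ℝ}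
    (i : Fin 2) (hb : ∀ m n σ, |E m n σ| ≤ B) (hsupp : ∀ᶠ m in atTop, S.Supported m (E m))
    (hlim : ∀ q, S.RegularAt q →
      LocTendsto (S.idx q.1) 2 (fun m => E m (S.tidx q.2 m)) (W q)) :
    SumLim (volume.restrict (Ω ×ˢ Ioo 0 T)) (volume.restrict Ω)
      (fun m => ∑ n ∈ Finset.range (S.N m), ∑ σ ∈ (S.M m).cells,
        S.τ m * (S.M m).dualArea i σ * E m n σ) W (fun _ => 0) := by
  refine (((S.sumLim_sum (s := - e i) (abs_neg_e_le i) hb hsupp hlim).add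
    (S.sumLim_sum (s := 0) (by simp) hb hsupp hlim)).const_mul (1 / 2)).congr
    (Eventually.of_forall fun m => ?_) (fun _ => by ring) (fun _ => by ring)
  simp only [← Finset.sum_add_distrib, Finset.mul_sum]
  refine Finset.sum_congr rfl fun n _ => Finset.sum_congr rfl fun σ _ => ?_
  rw [dualArea, add_zero, ← sub_eq_add_neg]; ring

lemma sumLim_level_dual {E : ℕ → ℕ → (Fin 2 → ℤ) → ℝ} {W : (Fin 2 → ℝ) × ℝ → ℝ} {B : ℝ}
    (i : Fin 2) (hb : ∀ m n σ, |E m n σ| ≤ B) (hsupp : ∀ᶠ m in atTop, S.Supported m (E m))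
    (hlim : ∀ q, S.RegularAt q →
      LocTendsto (S.idx q.1) 2 (fun m => E m (S.tidx q.2 m + 1)) (W q)) :
    SumLim (volume.restrict (Ω ×ˢ Ioo 0 T)) (volume.restrict Ω)
      (fun m => ∑ n ∈ Finset.range (S.N m), ∑ σ ∈ (S.M m).cells,
        S.τ m * (S.M m).dualArea i σ * E m n σ) W (fun _ => 0) := by
  refine (((S.sumLim_level (s := - e i) (abs_neg_e_le i) hb hsupp hlim).add
    (S.sumLim_level (s := 0) (by simp) hb hsupp hlim)).const_mul (1 / 2)).congr
    (Eventually.of_forall fun m => ?_) (fun _ => by ring) (fun _ => by ring)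
  simp only [← Finset.sum_add_distrib, Finset.mul_sum]
  refine Finset.sum_congr rfl fun n _ => Finset.sum_congr rfl fun σ _ => ?_
  rw [dualArea, add_zero, ← sub_eq_add_neg]; ring

end ConvergentScheme

/-! ### Test functions on the grid -/

/-- Difference quotients of a `C¹` function, between two points which both tend to `q`. -/
lemma tendsto_diffQuotient {E : Type*} [NormedAddCommGroup E] [NormedSpace ℝ E] {φ : E → ℝ} {q : E}
    (hφ : ContDiffAt ℝ 1 φ q) {a b : ℕ → E} {d : ℕ → ℝ} {v : E} (ha : Tendsto a atTop (𝓝 q))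
    (hb : Tendsto b atTop (𝓝 q)) (hd : ∀ m, d m ≠ 0) (hab : ∀ m, b m - a m = d m • v) :
    Tendsto (fun m => (φ (b m) - φ (a m)) / d m) atTop (𝓝 (fderiv ℝ φ q v)) := by
  have h1 := (hφ.hasStrictFDerivAt one_ne_zero).isLittleO.comp_tendsto (hb.prodMk_nhds ha)
  rw [tendsto_iff_norm_sub_tendsto_zero]
  have h2 : ∀ m, (φ (b m) - φ (a m)) / d m - fderiv ℝ φ q v =
      (φ (b m) - φ (a m) - fderiv ℝ φ q (b m - a m)) / d m := fun m => by
    rw [hab, map_smul, smul_eq_mul, sub_div (φ (b m) - φ (a m)), mul_div_cancel_left₀ _ (hd m)]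
  simp_rw [h2, norm_div]
  have h3 : (fun m => ‖φ (b m) - φ (a m) - fderiv ℝ φ q (b m - a m)‖) =o[atTop] fun m => ‖d m‖ := by
    refine (h1.norm_left.trans_isBigO ?_).norm_right
    refine Asymptotics.IsBigO.of_bound ‖v‖ (Eventually.of_forall fun m => ?_)
    simp only [Function.comp_apply, hab, norm_smul]
    rw [mul_comm]
  exact h3.tendsto_div_nhds_zero

namespace ShallowWater

lemma IsTest.continuous {Ω : Set (Fin 2 → ℝ)} {T : ℝ} {φ : (Fin 2 → ℝ) × ℝ → ℝ}
    (hφ : IsTest Ω T φ) : Continuous φ := hφ.smooth.continuous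

/-- A common bound for a test function and its Lipschitz constant. -/
lemma IsTest.exists_bound {Ω : Set (Fin 2 → ℝ)} {T : ℝ} {φ : (Fin 2 → ℝ) × ℝ → ℝ}
    (hφ : IsTest Ω T φ) :
    ∃ B : ℝ, 0 ≤ B ∧ (∀ q, |φ q| ≤ B) ∧ ∀ p q, |φ p - φ q| ≤ B * dist p q := by
  obtain ⟨L, hL⟩ := hφ.smooth.lipschitzWith_of_hasCompactSupport hφ.compact (by simp)
  obtain ⟨B, hB⟩ := hφ.compact.exists_bound_of_continuous hφ.continuous
  refine ⟨max B L, le_max_of_le_right L.2, fun q => (hB q).trans (le_max_left _ _), fun p q => ?_⟩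
  exact (hL.dist_le_mul p q).trans (mul_le_mul_of_nonneg_right (le_max_right _ _) dist_nonneg)

end ShallowWater

namespace ConvergentScheme

variable {Ω : Set (Fin 2 → ℝ)} {T g : ℝ} {z h₀ : (Fin 2 → ℝ) → ℝ}
  {u₀ : Fin 2 → (Fin 2 → ℝ) → ℝ} {hbar : (Fin 2 → ℝ) × ℝ → ℝ}
  {ubar : Fin 2 → (Fin 2 → ℝ) × ℝ → ℝ} (S : ConvergentScheme Ω T g z h₀ u₀ hbar ubar)

/-- The points `p m σ` converge to `x` for indices `σ` near those of the cells containing `x`. -/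
def LocPt (x : Fin 2 → ℝ) (r : ℕ) (p : ℕ → (Fin 2 → ℤ) → Fin 2 → ℝ) : Prop :=
  ∀ κ : ℕ → Fin 2 → ℤ, (∀ m k, |κ m k - S.idx x m k| ≤ r) →
    Tendsto (fun m => p m (κ m)) atTop (𝓝 x)

lemma LocPt.shift_add {S : ConvergentScheme Ω T g z h₀ u₀ hbar ubar} {x : Fin 2 → ℝ} {r : ℕ}
    {p : ℕ → (Fin 2 → ℤ) → Fin 2 → ℝ} (hp : S.LocPt x (r + 1) p) (i : Fin 2) :
    S.LocPt x r (fun m σ => p m (σ + e i)) := fun κ hκ =>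
  hp (fun m => κ m + e i) fun m k => by
    have := hκ m k
    rw [abs_le] at this ⊢
    by_cases hk : k = i
    · subst hk; simp only [Pi.add_apply, e_same]; push_cast; omega
    · simp only [Pi.add_apply, e_ne hk]; push_cast; omega

lemma LocPt.shift_sub {S : ConvergentScheme Ω T g z h₀ u₀ hbar ubar} {x : Fin 2 → ℝ} {r : ℕ}
    {p : ℕ → (Fin 2 → ℤ) → Fin 2 → ℝ} (hp : S.LocPt x (r + 1) p) (i : Fin 2) :
    S.LocPt x r (fun m σ => p m (σ - e i)) := fun κ hκ =>
  hp (fun m => κ m - e i) fun m k => by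
    have := hκ m k
    rw [abs_le] at this ⊢
    by_cases hk : k = i
    · subst hk; simp only [Pi.sub_apply, e_same]; push_cast; omega
    · simp only [Pi.sub_apply, e_ne hk]; push_cast; omega

end ConvergentScheme

/-- Near a given point of the domain, at a bounded distance in number of cells, all cells of the
grid belong to the mesh if it is fine enough, and their points converge to the given one. -/
lemma MACGrid.eventually_near {Ω : Set (Fin 2 → ℝ)} {M : ℕ → MACGrid}
    (hM : ∀ m, (M m).domain = Ω) (hsize : Tendsto (fun m => (M m).size) atTop (𝓝 0))
    {x : Fin 2 → ℝ} (hx : x ∈ Ω) (r : ℕ) {ε : ℝ} (hε : 0 < ε) :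
    ∀ᶠ m in atTop, ∀ L : Fin 2 → ℤ, (∀ k, |L k - (M m).idx x k| ≤ r) →
      L ∈ (M m).cells ∧ ∀ p ∈ (M m).closedCell L, dist p x < ε := by
  have hΩ : IsOpen Ω := hM 0 ▸ (M 0).isOpen_domain
  obtain ⟨d, hd, hball⟩ := Metric.isOpen_iff.1 hΩ x hx
  have h1 : Tendsto (fun m => (4 * r + 1) * (M m).size) atTop (𝓝 0) := by
    simpa using hsize.const_mul (4 * (r : ℝ) + 1)
  have h1' : Tendsto (fun m => 4 * (M m).size * r) atTop (𝓝 0) := by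
    simpa using (hsize.const_mul 4).mul_const (r : ℝ)
  filter_upwards [h1.eventually (gt_mem_nhds hε), h1'.eventually (gt_mem_nhds hd)]
    with m hm hm' L hL
  have hx' : x ∈ (M m).domain := by rw [hM m]; exact hx
  obtain ⟨hc, hxc⟩ := (M m).idx_spec hx'
  obtain ⟨hLc, p', hp', hd'⟩ := (M m).exists_near r hxc hc
    ((Metric.closedBall_subset_ball hm').trans (by rwa [hM m])) hL
  refine ⟨hLc, fun p hp => ?_⟩
  have h2 := (M m).dist_le_size hLc hp ((M m).cell_subset_closedCell L hp')
  rw [dist_comm] at hd'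
  linarith [dist_triangle p p' x]

namespace ConvergentScheme

variable {Ω : Set (Fin 2 → ℝ)} {T g : ℝ} {z h₀ : (Fin 2 → ℝ) → ℝ}
  {u₀ : Fin 2 → (Fin 2 → ℝ) → ℝ} {hbar : (Fin 2 → ℝ) × ℝ → ℝ}
  {ubar : Fin 2 → (Fin 2 → ℝ) × ℝ → ℝ} (S : ConvergentScheme Ω T g z h₀ u₀ hbar ubar)

lemma locPt {x : Fin 2 → ℝ} (hx : x ∈ Ω) (r : ℕ) {p : ℕ → (Fin 2 → ℤ) → Fin 2 → ℝ}
    (hp : ∀ m σ, p m σ ∈ (S.M m).cell σ) : S.LocPt x r p := by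
  intro κ hκ
  rw [Metric.tendsto_nhds]
  intro ε hε
  filter_upwards [MACGrid.eventually_near S.domain_eq S.size_lim hx r hε] with m hm
  exact (hm (κ m) (hκ m)).2 _ ((S.M m).cell_subset_closedCell _ (hp m _))

lemma locPt_center {x : Fin 2 → ℝ} (hx : x ∈ Ω) (r : ℕ) :
    S.LocPt x r (fun m => (S.M m).center) := S.locPt hx r fun m => (S.M m).center_mem_cell

lemma locPt_edgeMid {x : Fin 2 → ℝ} (hx : x ∈ Ω) (r : ℕ) (i : Fin 2) :
    S.LocPt x r (fun m => (S.M m).edgeMid i) := S.locPt hx r fun m => (S.M m).edgeMid_mem_cell i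

lemma tendsto_time {t : ℝ} (ht : 0 < t) (j : ℕ) :
    Tendsto (fun m => ((S.tidx t m + j : ℕ) : ℝ) * S.τ m) atTop (𝓝 t) := by
  have h1 : Tendsto (fun m => t - S.τ m + j * S.τ m) atTop (𝓝 t) := by
    simpa using (tendsto_const_nhds (x := t)).sub S.τ_lim |>.add (S.τ_lim.const_mul (j : ℝ))
  have h2 : Tendsto (fun m => t + j * S.τ m) atTop (𝓝 t) := by
    simpa using (tendsto_const_nhds (x := t)).add (S.τ_lim.const_mul (j : ℝ))
  refine tendsto_of_tendsto_of_tendsto_of_le_of_le h1 h2 (fun m => ?_) (fun m => ?_)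
  all_goals
    obtain ⟨ha, hb⟩ := (mem_slab_iff (S.τ_pos m) ht.le).2 (rfl : ⌊t / S.τ m⌋₊ = ⌊t / S.τ m⌋₊)
    simp only [tidx]
    push_cast
    nlinarith

/-- The values of a test function at the points `p` and at the discrete times. -/
noncomputable def test (φ : (Fin 2 → ℝ) × ℝ → ℝ) (p : ℕ → (Fin 2 → ℤ) → Fin 2 → ℝ) (m n : ℕ)
    (σ : Fin 2 → ℤ) : ℝ := φ (p m σ, n * S.τ m)

variable {φ : (Fin 2 → ℝ) × ℝ → ℝ}

lemma test_conv (hφ : IsTest Ω T φ) {q : (Fin 2 → ℝ) × ℝ} (hq : 0 < q.2)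
    {p : ℕ → (Fin 2 → ℤ) → Fin 2 → ℝ} {r : ℕ} (hp : S.LocPt q.1 r p) (j : ℕ) :
    LocTendsto (S.idx q.1) r (fun m => S.test φ p m (S.tidx q.2 m + j)) (φ q) := fun κ hκ =>
  (hφ.continuous.tendsto q).comp ((hp κ hκ).prodMk_nhds (S.tendsto_time hq j))

lemma test_conv_init (hφ : IsTest Ω T φ) {x : Fin 2 → ℝ}
    {p : ℕ → (Fin 2 → ℤ) → Fin 2 → ℝ} {r : ℕ} (hp : S.LocPt x r p) (j : ℕ) :
    LocTendsto (S.idx x) r (fun m => S.test φ p m j) (φ (x, 0)) := fun κ hκ => by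
  have h : Tendsto (fun m => (j : ℝ) * S.τ m) atTop (𝓝 0) := by simpa using S.τ_lim.const_mul (j : ℝ)
  exact (hφ.continuous.tendsto (x, 0)).comp ((hp κ hκ).prodMk_nhds h)

/-- The discrete time derivative of a test function. -/
noncomputable def testDt (φ : (Fin 2 → ℝ) × ℝ → ℝ) (p : ℕ → (Fin 2 → ℤ) → Fin 2 → ℝ) (m n : ℕ)
    (σ : Fin 2 → ℤ) : ℝ := (S.test φ p m (n + 1) σ - S.test φ p m n σ) / S.τ m

lemma testDt_conv (hφ : IsTest Ω T φ) {q : (Fin 2 → ℝ) × ℝ} (hq : 0 < q.2)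
    {p : ℕ → (Fin 2 → ℤ) → Fin 2 → ℝ} {r : ℕ} (hp : S.LocPt q.1 r p) (j : ℕ) :
    LocTendsto (S.idx q.1) r (fun m => S.testDt φ p m (S.tidx q.2 m + j)) (dt φ q) := fun κ hκ =>
  tendsto_diffQuotient (hφ.smooth.contDiffAt.of_le (by simp))
    ((hp κ hκ).prodMk_nhds (S.tendsto_time hq j))
    ((hp κ hκ).prodMk_nhds (S.tendsto_time hq (j + 1))) (fun m => (S.τ_pos m).ne') fun m => by
      ext <;> simp; ring

/-- The discrete space derivative of a test function between the points `p` and `p'`, at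
distance `d`. -/
noncomputable def testDx (φ : (Fin 2 → ℝ) × ℝ → ℝ) (p p' : ℕ → (Fin 2 → ℤ) → Fin 2 → ℝ)
    (d : ℕ → (Fin 2 → ℤ) → ℝ) (m n : ℕ) (σ : Fin 2 → ℤ) : ℝ :=
  (S.test φ p' m n σ - S.test φ p m n σ) / d m σ

lemma testDx_conv (hφ : IsTest Ω T φ) {q : (Fin 2 → ℝ) × ℝ} (hq : 0 < q.2)
    {p p' : ℕ → (Fin 2 → ℤ) → Fin 2 → ℝ} {d : ℕ → (Fin 2 → ℤ) → ℝ} {r : ℕ}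
    (hp : S.LocPt q.1 r p) (hp' : S.LocPt q.1 r p') (hd : ∀ m σ, 0 < d m σ) {k : Fin 2}
    (hpp' : ∀ m σ, p' m σ - p m σ = d m σ • Pi.single k 1) (j : ℕ) :
    LocTendsto (S.idx q.1) r (fun m => S.testDx φ p p' d m (S.tidx q.2 m + j)) (dx k φ q) :=
  fun κ hκ => tendsto_diffQuotient (hφ.smooth.contDiffAt.of_le (by simp))
    ((hp κ hκ).prodMk_nhds (S.tendsto_time hq j))
    ((hp' κ hκ).prodMk_nhds (S.tendsto_time hq j)) (fun m => (hd m _).ne') fun m => by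
      rw [Prod.mk_sub_mk, hpp', sub_self, Prod.smul_mk, smul_zero]

lemma testDt_bound {B : ℝ} (hB : ∀ p q, |φ p - φ q| ≤ B * dist p q)
    (p : ℕ → (Fin 2 → ℤ) → Fin 2 → ℝ) (m n : ℕ) (σ : Fin 2 → ℤ) : |S.testDt φ p m n σ| ≤ B := by
  rw [testDt, abs_div, abs_of_pos (S.τ_pos m), div_le_iff₀ (S.τ_pos m)]
  refine (hB _ _).trans (le_of_eq ?_)
  rw [dist_prod_same_left, Real.dist_eq, ← sub_mul]
  simp [abs_of_pos (S.τ_pos m)]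

lemma testDx_bound {B : ℝ} (hB : ∀ p q, |φ p - φ q| ≤ B * dist p q)
    {p p' : ℕ → (Fin 2 → ℤ) → Fin 2 → ℝ} {d : ℕ → (Fin 2 → ℤ) → ℝ} (hd : ∀ m σ, 0 < d m σ)
    {k : Fin 2} (hpp' : ∀ m σ, p' m σ - p m σ = d m σ • Pi.single k 1)
    (m n : ℕ) (σ : Fin 2 → ℤ) : |S.testDx φ p p' d m n σ| ≤ B := by
  rw [testDx, abs_div, abs_of_pos (hd m σ), div_le_iff₀ (hd m σ)]
  refine (hB _ _).trans (le_of_eq ?_)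
  rw [dist_prod_same_right, dist_eq_norm, hpp', norm_smul, Pi.norm_single]
  simp [abs_of_pos (hd m σ)]

/-- For fine meshes, a test function vanishes near the boundary and at the last time steps. -/
lemma eventually_supported (hφ : IsTest Ω T φ) :
    ∀ᶠ m in atTop, ∀ (n : ℕ) (σ : Fin 2 → ℤ) (x : Fin 2 → ℝ), x ∈ (S.M m).cell σ →
      φ (x, n * S.τ m) ≠ 0 →
      n + 4 < S.N m ∧ ∀ L : Fin 2 → ℤ, (∀ k, |L k - σ k| ≤ 5) → L ∈ (S.M m).cells := by
  have hc : IsCompact (tsupport φ) := hφ.compact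
  have hsub1 : Prod.fst '' tsupport φ ⊆ Ω := by
    rintro _ ⟨q, hq, rfl⟩; exact (hφ.support hq).1
  have hsub2 : Prod.snd '' tsupport φ ⊆ Iio T := by
    rintro _ ⟨q, hq, rfl⟩; exact (hφ.support hq).2
  obtain ⟨d, hd, hthick⟩ :=
    (hc.image continuous_fst).exists_cthickening_subset_open S.isOpen hsub1
  obtain ⟨d', hd', hthick'⟩ :=
    (hc.image continuous_snd).exists_cthickening_subset_open isOpen_Iio hsub2
  have l1 : Tendsto (fun m => 4 * (S.M m).size * (5 : ℕ)) atTop (𝓝 0) := by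
    simpa using (S.size_lim.const_mul 4).mul_const ((5 : ℕ) : ℝ)
  have l2 : Tendsto (fun m => 4 * S.τ m) atTop (𝓝 0) := by simpa using S.τ_lim.const_mul 4
  filter_upwards [l1.eventually (gt_mem_nhds hd), l2.eventually (gt_mem_nhds hd')]
    with m hm hm' n σ x hx hne
  have hmem : (x, (n : ℝ) * S.τ m) ∈ tsupport φ := subset_tsupport φ hne
  constructor
  · have h1 : (n : ℝ) * S.τ m + 4 * S.τ m ∈ Iio T := by
      refine hthick' (Metric.mem_cthickening_of_dist_le _ _ _ _ ⟨_, hmem, rfl⟩ ?_)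
      rw [Real.dist_eq, add_sub_cancel_left, abs_of_pos (by have := S.τ_pos m; positivity)]
      exact hm'.le
    have h2 : ((n + 4 : ℕ) : ℝ) * S.τ m < S.N m * S.τ m := by
      rw [S.mul_τ m]; push_cast; rw [add_mul]; exact h1
    exact_mod_cast lt_of_mul_lt_mul_right h2 (S.τ_pos m).le
  · intro L hL
    have hball : Metric.closedBall x (4 * (S.M m).size * (5 : ℕ)) ⊆ (S.M m).domain := by
      rw [S.domain_eq m]
      refine Subset.trans ?_ hthick
      refine (Metric.closedBall_subset_closedBall hm.le).trans ?_
      exact Metric.closedBall_subset_cthickening (mem_image_of_mem Prod.fst hmem) d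
    have hxΩ : x ∈ (S.M m).domain := by rw [S.domain_eq m]; exact hsub1 ⟨_, hmem, rfl⟩
    exact ((S.M m).exists_near 5 hx ((S.M m).mem_cells_of_mem_domain hxΩ hx) hball hL).1

/-- The index `σ` is at distance at most `2` of an index where the test function does not vanish
at one of the time levels `n`, `n + 1`, `n + 2`. -/
lemma eventually_inner (hφ : IsTest Ω T φ) :
    ∀ᶠ m in atTop, ∀ (n j : ℕ) (σ τ : Fin 2 → ℤ) (p : ℕ → (Fin 2 → ℤ) → Fin 2 → ℝ),
      p m τ ∈ (S.M m).cell τ → (∀ k, |τ k - σ k| ≤ 2) → S.test φ p m (n + j) τ ≠ 0 →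
      n + 2 < S.N m ∧ S.Inner m σ := by
  filter_upwards [S.eventually_supported hφ] with m hm n j σ τ p hp hτ hne
  obtain ⟨h1, h2⟩ := hm (n + j) τ _ hp hne
  refine ⟨by omega, fun L hL => h2 L fun k => ?_⟩
  have := hL k
  have := hτ k
  rw [abs_le] at *
  omega

end ConvergentScheme

/-! ### The mass equation -/

lemma Finset.sum_range_by_parts_zero (a w : ℕ → ℝ) (N : ℕ) (hw : w N = 0) :
    ∑ n ∈ Finset.range N, (a (n + 1) - a n) * w n =
      -∑ n ∈ Finset.range N, a (n + 1) * (w (n + 1) - w n) - a 0 * w 0 := by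
  have h := Finset.sum_range_sub (fun n => a n * w n) N
  rw [hw, mul_zero, zero_sub] at h
  rw [sub_eq_add_neg, ← h, ← Finset.sum_neg_distrib, ← Finset.sum_add_distrib]
  exact Finset.sum_congr rfl fun n _ => by ring

lemma abs_mul_le_mul {a b A B : ℝ} (ha : |a| ≤ A) (hb : |b| ≤ B) : |a * b| ≤ A * B := by
  rw [abs_mul]; exact mul_le_mul ha hb (abs_nonneg _) ((abs_nonneg _).trans ha)

namespace ConvergentScheme

variable {Ω : Set (Fin 2 → ℝ)} {T g : ℝ} {z h₀ : (Fin 2 → ℝ) → ℝ}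
  {u₀ : Fin 2 → (Fin 2 → ℝ) → ℝ} {hbar : (Fin 2 → ℝ) × ℝ → ℝ}
  {ubar : Fin 2 → (Fin 2 → ℝ) × ℝ → ℝ} (S : ConvergentScheme Ω T g z h₀ u₀ hbar ubar)
  {φ : (Fin 2 → ℝ) × ℝ → ℝ}

include S in
lemma C_pos : 0 < S.C := zero_lt_one.trans_le S.one_le_C

lemma h_pos (m n : ℕ) (K : Fin 2 → ℤ) : 0 < S.h m n K :=
  (one_div_pos.2 S.C_pos).trans_le (S.h_lower m n K)

lemma h_abs_le (m n : ℕ) (K : Fin 2 → ℤ) : |S.h m n K| ≤ S.C := by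
  rw [abs_of_pos (S.h_pos m n K)]; exact S.h_upper m n K

/-- Summation by parts in time, against a test function multiplied by a function `c` of space. -/
lemma sumLim_time (hφ : IsTest Ω T φ) {a : ℕ → ℕ → (Fin 2 → ℤ) → ℝ}
    {A : (Fin 2 → ℝ) × ℝ → ℝ} {A₀ cb : (Fin 2 → ℝ) → ℝ} {c : ℕ → (Fin 2 → ℤ) → ℝ}
    {p : ℕ → (Fin 2 → ℤ) → Fin 2 → ℝ} {B B' : ℝ} {s : Fin 2 → ℤ} {j : ℕ}
    (hs : ∀ k, |s k| ≤ 2)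
    (hp : ∀ m σ, p m σ ∈ (S.M m).cell σ) (ha : ∀ m n σ, |a m n σ| ≤ B)
    (hc : ∀ m σ, |c m σ| ≤ B')
    (ha_conv : ∀ q, S.RegularAt q →
      LocTendsto (S.idx q.1) 2 (fun m => a m (S.tidx q.2 m + 1)) (A q))
    (ha₀_conv : ∀ x, S.InitRegularAt x → LocTendsto (S.idx x) 2 (fun m => a m 0) (A₀ x))
    (hc_conv : ∀ x ∈ Ω, LocTendsto (S.idx x) 2 c (cb x)) :
    SumLim (volume.restrict (Ω ×ˢ Ioo 0 T)) (volume.restrict Ω)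
      (fun m => ∑ n ∈ Finset.range (S.N m), ∑ σ ∈ (S.M m).cells, (S.M m).cellArea (σ + s) *
        ((a m (n + 1) σ - a m n σ) * (S.test φ p m (n + j) σ * c m σ)))
      (fun q => -(A q * (cb q.1 * dt φ q))) (fun x => -(A₀ x * (cb x * φ (x, 0)))) := by
  obtain ⟨L, hL0, hLφ, hLip⟩ := hφ.exists_bound
  have hev := S.eventually_inner hφ
  have h1 := S.sumLim_sum (s := s) (B := B * (B' * L))
    (E := fun m n σ => a m (n + 1) σ * (c m σ * S.testDt φ p m (n + j) σ))
    (W := fun q => A q * (cb q.1 * dt φ q)) hs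
    (fun m n σ => abs_mul_le_mul (ha _ _ _) (abs_mul_le_mul (hc _ _) (S.testDt_bound hLip _ _ _ _)))
    (by
      filter_upwards [hev] with m hm n σ hne
      have h := right_ne_zero_of_mul (right_ne_zero_of_mul hne)
      by_cases h' : S.test φ p m (n + j) σ = 0
      · refine hm n (j + 1) σ σ p (hp m σ) (by simp) fun h0 => h ?_
        rw [testDt, h', add_assoc, h0]; simp
      · exact hm n j σ σ p (hp m σ) (by simp) h')
    (fun q hq => (ha_conv q hq).mul ((hc_conv _ hq.mem.1).mul
      (S.testDt_conv hφ hq.mem.2.1 (S.locPt hq.mem.1 2 hp) j)))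
  have h2 := S.sumLim_init (s := s) (B := B * (B' * L))
    (E := fun m σ => a m 0 σ * (c m σ * S.test φ p m j σ))
    (W := fun x => A₀ x * (cb x * φ (x, 0))) hs
    (fun m σ => abs_mul_le_mul (ha _ _ _) (abs_mul_le_mul (hc _ _) (hLφ _)))
    (by
      filter_upwards [hev] with m hm σ hne
      have h := right_ne_zero_of_mul (right_ne_zero_of_mul hne)
      exact (hm 0 j σ σ p (hp m σ) (by simp) (by rwa [zero_add])).2)
    (fun x hx => (ha₀_conv x hx).mul ((hc_conv _ hx.mem).mul
      (S.test_conv_init hφ (S.locPt hx.mem 2 hp) j)))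
  refine ((h1.add h2).const_mul (-1)).congr ?_ (fun q => by ring) (fun x => by ring)
  filter_upwards [hev] with m hm
  have hN : ∀ σ, S.test φ p m (S.N m + j) σ = 0 := fun σ => by
    by_contra hne
    have := (hm (S.N m) j σ σ p (hp m σ) (by simp) hne).1
    omega
  have hab : ∀ σ, ∑ n ∈ Finset.range (S.N m), (S.M m).cellArea (σ + s) *
      ((a m (n + 1) σ - a m n σ) * (S.test φ p m (n + j) σ * c m σ)) =
      -∑ n ∈ Finset.range (S.N m), S.τ m * (S.M m).cellArea (σ + s) *
        (a m (n + 1) σ * (c m σ * S.testDt φ p m (n + j) σ)) -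
        (S.M m).cellArea (σ + s) * (a m 0 σ * (c m σ * S.test φ p m j σ)) := fun σ => by
    rw [← Finset.mul_sum, Finset.sum_range_by_parts_zero (fun n => a m n σ)
      (fun n => S.test φ p m (n + j) σ * c m σ) _ (by rw [hN, zero_mul]), mul_sub, mul_neg,
      Finset.mul_sum, zero_add]
    congr 1
    · congr 1
      refine Finset.sum_congr rfl fun n _ => ?_
      have := (S.τ_pos m).ne'
      rw [testDt, show n + 1 + j = n + j + 1 by ring]
      field_simp
    · ring
  rw [Finset.sum_comm (s := Finset.range _), Finset.sum_comm (s := Finset.range _),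
    Finset.sum_congr rfl fun σ _ => hab σ, Finset.sum_sub_distrib, Finset.sum_neg_distrib]
  ring

/-- The upwind mass flux per unit length. -/
noncomputable def flux (i : Fin 2) (m n : ℕ) (σ : Fin 2 → ℤ) : ℝ :=
  (if 0 ≤ S.u m n i σ then S.h m n (σ - e i) else S.h m n σ) * S.u m n i σ

lemma massFlux_eq (i : Fin 2) (m n : ℕ) (σ : Fin 2 → ℤ) :
    (S.M m).massFlux (S.h m n) (S.u m n) i σ = (S.M m).edgeLen i σ * S.flux i m n σ := by
  rw [massFlux, flux, mul_assoc]

lemma flux_bound (i : Fin 2) (m n : ℕ) (σ : Fin 2 → ℤ) : |S.flux i m n σ| ≤ S.C * S.C := by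
  refine abs_mul_le_mul ?_ (S.u_bound _ _ _ _)
  split_ifs <;> exact S.h_abs_le _ _ _

lemma flux_conv {q : (Fin 2 → ℝ) × ℝ} (hq : S.RegularAt q) (i : Fin 2) :
    LocTendsto (S.idx q.1) 4 (fun m => S.flux i m (S.tidx q.2 m + 1)) (hbar q * ubar i q) :=
  (LocTendsto.ite _ (hq.h_conv.shift_sub i) (hq.h_conv.mono (by simp))).mul
    ((hq.u_conv i).mono (by simp))

lemma flux_eq_zero {i : Fin 2} {m n : ℕ} {σ : Fin 2 → ℤ} (h : σ ∉ (S.M m).intEdges i) :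
    S.flux i m n σ = 0 := by rw [flux, S.u_ext _ _ _ _ h, mul_zero]

lemma Inner.mem {S : ConvergentScheme Ω T g z h₀ u₀ hbar ubar} {m : ℕ} {σ : Fin 2 → ℤ}
    (h : S.Inner m σ) : σ ∈ (S.M m).cells := h σ (by simp)

lemma Inner.add_e {S : ConvergentScheme Ω T g z h₀ u₀ hbar ubar} {m : ℕ} {σ : Fin 2 → ℤ}
    (h : S.Inner m σ) (i : Fin 2) : σ + e i ∈ (S.M m).cells := h _ fun k => by
  have := abs_neg_e_le i k
  simp at this ⊢; omega

lemma Inner.sub_e {S : ConvergentScheme Ω T g z h₀ u₀ hbar ubar} {m : ℕ} {σ : Fin 2 → ℤ}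
    (h : S.Inner m σ) (i : Fin 2) : σ - e i ∈ (S.M m).cells := h _ fun k => by
  have := abs_neg_e_le i k
  simp at this ⊢; omega

lemma Inner.mem_intEdges {S : ConvergentScheme Ω T g z h₀ u₀ hbar ubar} {m : ℕ}
    {σ : Fin 2 → ℤ} (h : S.Inner m σ) (i : Fin 2) : σ ∈ (S.M m).intEdges i :=
  (S.M m).mem_intEdges.2 ⟨h.mem, h.sub_e i⟩

/-- Summation by parts in space, for a discrete function `w` which vanishes near the boundary. -/
lemma sum_div_mul {m : ℕ} {w : (Fin 2 → ℤ) → ℝ} (F : (Fin 2 → ℤ) → ℝ) (i : Fin 2)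
    (hw : ∀ σ, w σ ≠ 0 → S.Inner m σ) :
    ∑ K ∈ (S.M m).cells, (F (K + e i) - F K) * w K =
      -∑ K ∈ (S.M m).cells, F K * (w K - w (K - e i)) := by
  have h := sum_shift (S.M m).cells (fun K => F K * w (K - e i)) (e i) fun σ hσ => by
    have h := hw _ (right_ne_zero_of_mul hσ)
    exact ⟨by simpa using h.add_e i, h.mem⟩
  simp only [add_sub_cancel_right] at h
  simp only [sub_mul, mul_sub, Finset.sum_sub_distrib, h]
  ring

/-- The distance of two consecutive cell centers. -/
noncomputable def cdist (i : Fin 2) (m : ℕ) (σ : Fin 2 → ℤ) : ℝ :=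
  (S.M m).center σ i - (S.M m).center (σ - e i) i

lemma cdist_pos (i : Fin 2) (m : ℕ) (σ : Fin 2 → ℤ) : 0 < S.cdist i m σ := by
  rw [cdist, center_sub_center]
  linarith [(S.M m).len_pos i (σ i - 1), (S.M m).len_pos i (σ i)]

lemma center_diff (i : Fin 2) (m : ℕ) (σ : Fin 2 → ℤ) :
    (S.M m).center σ - (S.M m).center (σ - e i) = S.cdist i m σ • Pi.single i 1 := by
  ext k
  by_cases hk : k = i
  · subst hk; simp [cdist]
  · simp [hk, MACGrid.center, e_ne hk]

/-- The discrete space derivative of a test function at an edge, from its values at the centers of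
the adjacent cells. -/
noncomputable def cellDx (φ : (Fin 2 → ℝ) × ℝ → ℝ) (i : Fin 2) : ℕ → ℕ → (Fin 2 → ℤ) → ℝ :=
  S.testDx φ (fun m σ => (S.M m).center (σ - e i)) (fun m => (S.M m).center) (S.cdist i)

lemma cellDx_conv (hφ : IsTest Ω T φ) {q : (Fin 2 → ℝ) × ℝ} (hq : S.RegularAt q) (i : Fin 2)
    (j : ℕ) (r : ℕ) :
    LocTendsto (S.idx q.1) r (fun m => S.cellDx φ i m (S.tidx q.2 m + j)) (dx i φ q) :=
  S.testDx_conv hφ hq.mem.2.1 ((S.locPt_center hq.mem.1 (r + 1)).shift_sub i)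
    (S.locPt_center hq.mem.1 r) (S.cdist_pos i) (S.center_diff i) j

lemma cellDx_bound {B : ℝ} (hB : ∀ p q, |φ p - φ q| ≤ B * dist p q) (i : Fin 2) (m n : ℕ)
    (σ : Fin 2 → ℤ) : |S.cellDx φ i m n σ| ≤ B :=
  S.testDx_bound hB (S.cdist_pos i) (S.center_diff i) m n σ

/-- The mass equation, tested against a test function multiplied by a function `c` of space with
discrete gradient `Dc`. -/
lemma mass_identity (hφ : IsTest Ω T φ) {c : ℕ → (Fin 2 → ℤ) → ℝ}
    {Dc : ℕ → Fin 2 → (Fin 2 → ℤ) → ℝ} {cb : (Fin 2 → ℝ) → ℝ} {cd : Fin 2 → (Fin 2 → ℝ) → ℝ}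
    {B : ℝ} (hc : ∀ m σ, |c m σ| ≤ B) (hDc : ∀ m i σ, |Dc m i σ| ≤ B)
    (hsub : ∀ m i, ∀ σ ∈ (S.M m).intEdges i, c m σ - c m (σ - e i) = S.cdist i m σ * Dc m i σ)
    (hc_conv : ∀ x ∈ Ω, LocTendsto (S.idx x) 5 c (cb x))
    (hDc_conv : ∀ x ∈ Ω, ∀ i, LocTendsto (S.idx x) 5 (fun m => Dc m i) (cd i x)) :
    SumLim (volume.restrict (Ω ×ˢ Ioo 0 T)) (volume.restrict Ω) (fun _ => 0)
      (fun q => hbar q * (cb q.1 * dt φ q) +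
        ∑ k, hbar q * ubar k q * (φ q * cd k q.1 + dx k φ q * cb q.1))
      (fun x => h₀ x * (cb x * φ (x, 0))) := by
  obtain ⟨L, hL0, hLφ, hLip⟩ := hφ.exists_bound
  have hev := S.eventually_inner hφ
  set p : ℕ → (Fin 2 → ℤ) → Fin 2 → ℝ := fun m => (S.M m).center with hpdef
  have hp : ∀ m σ, p m σ ∈ (S.M m).cell σ := fun m => (S.M m).center_mem_cell
  have h1 := S.sumLim_time hφ (s := 0) (j := 0) (by simp) hp (S.h_abs_le) hc
    (fun q hq => hq.h_conv.mono (by simp)) (fun x hx => hx.h_conv.mono (by simp))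
    (fun x hx => (hc_conv x hx).mono (by simp))
  have h2 := fun i => S.sumLim_level_dual (B := S.C * S.C * (L * B + L * B)) i
    (E := fun m n σ => S.flux i m n σ *
      (S.test φ p m n σ * Dc m i σ + S.cellDx φ i m n σ * c m (σ - e i)))
    (W := fun q => hbar q * ubar i q * (φ q * cd i q.1 + dx i φ q * cb q.1))
    (fun m n σ => abs_mul_le_mul (S.flux_bound _ _ _ _) ((abs_add_le _ _).trans (add_le_add
      (abs_mul_le_mul (hLφ _) (hDc _ _ _)) (abs_mul_le_mul (S.cellDx_bound hLip _ _ _ _) (hc _ _)))))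
    (by
      filter_upwards [hev] with m hm n σ hne
      have h := right_ne_zero_of_mul hne
      by_cases h' : S.test φ p m n σ = 0
      · refine hm n 0 σ (σ - e i) p (hp m _) (fun k => ?_) fun h0 => h ?_
        · simpa using abs_neg_e_le i k
        · rw [h', cellDx, testDx]
          simp only [add_zero] at h0
          have h0' : S.test φ (fun m σ => (S.M m).center (σ - e i)) m n σ = 0 := h0
          rw [h0', h']; simp
      · exact hm n 0 σ σ p (hp m σ) (by simp) h')
    (fun q hq => ((S.flux_conv hq i).mono (by simp)).mul
      (((S.test_conv hφ hq.mem.2.1 (S.locPt hq.mem.1 2 hp) 1).mul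
        ((hDc_conv _ hq.mem.1 i).mono (by simp))).add
        ((S.cellDx_conv hφ hq i 1 2).mul
          (((hc_conv _ hq.mem.1).mono (by simp : 3 ≤ 5)).shift_sub i))))
  have h3 := SumLim.sum (s := Finset.univ) fun i _ => h2 i
  refine ((h1.add (h3.const_mul (-1))).const_mul
    (-1)).congr ?_ (fun q => ?_) (fun x => ?_)
  rotate_left
  · simp only [Fin.sum_univ_two]; ring
  · simp
  filter_upwards [hev] with m hm
  have hw : ∀ n σ, S.test φ p m n σ * c m σ ≠ 0 → n + 2 < S.N m ∧ S.Inner m σ := fun n σ hne =>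
    hm n 0 σ σ p (hp m σ) (by simp) (left_ne_zero_of_mul hne)
  have hstep : ∀ n ∈ Finset.range (S.N m),
      (∑ σ ∈ (S.M m).cells, (S.M m).cellArea (σ + 0) *
        ((S.h m (n + 1) σ - S.h m n σ) * (S.test φ p m (n + 0) σ * c m σ))) =
      ∑ i, ∑ σ ∈ (S.M m).cells, S.τ m * (S.M m).dualArea i σ * (S.flux i m n σ *
      (S.test φ p m n σ * Dc m i σ + S.cellDx φ i m n σ * c m (σ - e i))) := by
    intro n _
    have e1 : ∀ i, ∑ σ ∈ (S.M m).cells, S.τ m * (S.M m).dualArea i σ * (S.flux i m n σ *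
        (S.test φ p m n σ * Dc m i σ + S.cellDx φ i m n σ * c m (σ - e i))) =
        -(S.τ m * ∑ σ ∈ (S.M m).cells, ((S.M m).massFlux (S.h m n) (S.u m n) i (σ + e i) -
          (S.M m).massFlux (S.h m n) (S.u m n) i σ) * (S.test φ p m n σ * c m σ)) := by
      intro i
      rw [S.sum_div_mul _ i fun σ h => (hw n σ h).2, mul_neg, neg_neg, Finset.mul_sum]
      refine Finset.sum_congr rfl fun σ _ => ?_
      by_cases hσ : σ ∈ (S.M m).intEdges i
      · have h3 := hsub m i σ hσ
        have h4 : S.cdist i m σ * S.cellDx φ i m n σ =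
            S.test φ p m n σ - S.test φ p m n (σ - e i) := by
          rw [cellDx, testDx, mul_div_cancel₀ _ (S.cdist_pos i m σ).ne']; rfl
        rw [massFlux_eq, ← edgeLen_mul_dist]
        change _ * (_ * S.cdist i m σ) * _ = _
        linear_combination (-S.τ m * (S.M m).edgeLen i σ * S.flux i m n σ) *
          (S.test φ p m n σ * h3 - c m (σ - e i) * h4)
      · rw [massFlux_eq, S.flux_eq_zero hσ]; ring
    simp only [e1, Finset.sum_neg_distrib, ← Finset.mul_sum]
    rw [Finset.sum_comm, ← mul_neg, ← Finset.sum_neg_distrib, Finset.mul_sum]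
    refine Finset.sum_congr rfl fun σ hσ => ?_
    rw [← Finset.sum_mul]
    by_cases h0 : S.test φ p m n σ * c m σ = 0
    · rw [add_zero, add_zero, h0]; ring
    · have h3 := S.mass m n (by have := (hw n σ h0).1; omega) σ hσ
      have h4 := (S.τ_pos m).ne'
      have h5 := ((S.M m).cellArea_pos σ).ne'
      rw [divCell] at h3
      field_simp at h3
      rw [add_zero, add_zero]
      linear_combination (S.test φ p m n σ * c m σ) * h3
  rw [Finset.sum_congr rfl hstep, Finset.sum_comm]
  ring

end ConvergentScheme

/-! ### Transport on the dual meshes -/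

namespace ConvergentScheme

variable {Ω : Set (Fin 2 → ℝ)} {T g : ℝ} {z h₀ : (Fin 2 → ℝ) → ℝ}
  {u₀ : Fin 2 → (Fin 2 → ℝ) → ℝ} {hbar : (Fin 2 → ℝ) × ℝ → ℝ}
  {ubar : Fin 2 → (Fin 2 → ℝ) × ℝ → ℝ} (S : ConvergentScheme Ω T g z h₀ u₀ hbar ubar)
  {φ : (Fin 2 → ℝ) × ℝ → ℝ}

/-- The distance in direction `j` of the midpoints of the edges `σ` and `σ + e j`, both orthogonal
to the direction `i`. -/
noncomputable def edist (i j : Fin 2) (m : ℕ) (σ : Fin 2 → ℤ) : ℝ :=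
  (S.M m).edgeMid i (σ + e j) j - (S.M m).edgeMid i σ j

lemma edist_same (i : Fin 2) (m : ℕ) (σ : Fin 2 → ℤ) : S.edist i i m σ = (S.M m).len i (σ i) := by
  simp [edist, edgeMid, len]

lemma edist_ne {i j : Fin 2} (hj : j ≠ i) (m : ℕ) (σ : Fin 2 → ℤ) :
    S.edist i j m σ = ((S.M m).len j (σ j) + (S.M m).len j (σ j + 1)) / 2 := by
  simp only [edist, edgeMid, Function.update_of_ne hj, MACGrid.center, len, Pi.add_apply, e_same]
  ring

lemma edist_pos (i j : Fin 2) (m : ℕ) (σ : Fin 2 → ℤ) : 0 < S.edist i j m σ := by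
  by_cases hj : j = i
  · subst hj; rw [edist_same]; exact (S.M m).len_pos _ _
  · rw [edist_ne S hj]
    linarith [(S.M m).len_pos j (σ j), (S.M m).len_pos j (σ j + 1)]

lemma edgeMid_diff (i j : Fin 2) (m : ℕ) (σ : Fin 2 → ℤ) :
    (S.M m).edgeMid i (σ + e j) - (S.M m).edgeMid i σ = S.edist i j m σ • Pi.single j 1 := by
  ext k
  by_cases hk : k = j
  · subst hk; simp [edist]
  · by_cases hi : k = i
    · subst hi; simp [hk, edgeMid, e_ne hk]
    · simp [hk, edgeMid, Function.update_of_ne hi, MACGrid.center, e_ne hk]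

/-- The discrete derivative of a test function in direction `j`, from its values at the midpoints
of the edges orthogonal to the direction `i`. -/
noncomputable def edgeDx (φ : (Fin 2 → ℝ) × ℝ → ℝ) (i j : Fin 2) : ℕ → ℕ → (Fin 2 → ℤ) → ℝ :=
  S.testDx φ (fun m => (S.M m).edgeMid i) (fun m σ => (S.M m).edgeMid i (σ + e j)) (S.edist i j)

lemma edgeDx_conv (hφ : IsTest Ω T φ) {q : (Fin 2 → ℝ) × ℝ} (hq : S.RegularAt q) (i j : Fin 2)
    (k : ℕ) (r : ℕ) :
    LocTendsto (S.idx q.1) r (fun m => S.edgeDx φ i j m (S.tidx q.2 m + k)) (dx j φ q) :=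
  S.testDx_conv hφ hq.mem.2.1 (S.locPt_edgeMid hq.mem.1 r i)
    ((S.locPt_edgeMid hq.mem.1 (r + 1) i).shift_add j) (S.edist_pos i j) (S.edgeMid_diff i j) k

lemma edgeDx_bound {B : ℝ} (hB : ∀ p q, |φ p - φ q| ≤ B * dist p q) (i j : Fin 2) (m n : ℕ)
    (σ : Fin 2 → ℤ) : |S.edgeDx φ i j m n σ| ≤ B :=
  S.testDx_bound hB (S.edist_pos i j) (S.edgeMid_diff i j) m n σ

lemma edist_mul_edgeDx (i j : Fin 2) (m n : ℕ) (σ : Fin 2 → ℤ) :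
    S.edist i j m σ * S.edgeDx φ i j m n σ =
      S.test φ (fun m => (S.M m).edgeMid i) m n (σ + e j) -
        S.test φ (fun m => (S.M m).edgeMid i) m n σ := by
  rw [edgeDx, testDx, mul_div_cancel₀ _ (S.edist_pos i j m σ).ne']; rfl

lemma edgeDx_supported (hφ : IsTest Ω T φ) (i : Fin 2) :
    ∀ᶠ m in atTop, ∀ j, S.Supported m (fun n => S.edgeDx φ i j m (n + 1)) := by
  filter_upwards [S.eventually_inner hφ] with m hm j n σ hne
  by_cases h' : S.test φ (fun m => (S.M m).edgeMid i) m (n + 1) σ = 0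
  · refine hm n 1 σ (σ + e j) (fun m => (S.M m).edgeMid i)
      ((S.M m).edgeMid_mem_cell i _) (fun k => ?_) fun h0 => hne ?_
    · simpa using abs_neg_e_le j k
    · rw [← mul_right_inj' (S.edist_pos i j m σ).ne', edist_mul_edgeDx, h', h0]; simp
  · exact hm n 1 σ σ (fun m => (S.M m).edgeMid i) ((S.M m).edgeMid_mem_cell i _) (by simp) h'

/-- Summation by parts for the dual meshes. -/
lemma sum_dualDiv_mul {m : ℕ} {w : (Fin 2 → ℤ) → ℝ} (G : (Fin 2 → ℤ) → ℝ) (j : Fin 2)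
    (hw : ∀ σ, w σ ≠ 0 → S.Inner m σ) :
    ∑ σ ∈ (S.M m).cells, (G σ - G (σ - e j)) * w σ =
      -∑ σ ∈ (S.M m).cells, G σ * (w (σ + e j) - w σ) := by
  have h := sum_shift (S.M m).cells (fun K => G (K - e j) * w K) (e j) fun σ hσ => by
    have h := hw _ (right_ne_zero_of_mul hσ)
    exact ⟨h.mem, h.sub_e j⟩
  simp only [add_sub_cancel_right] at h
  simp only [sub_mul, mul_sub, Finset.sum_sub_distrib, h]
  ring

/-- The flux of `f (u i)` through the dual edges, with the upwind value of `u i`. -/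
noncomputable def dualTransport (f : ℝ → ℝ) (i j : Fin 2) (m n : ℕ) (σ : Fin 2 → ℤ) : ℝ :=
  (S.M m).dualFlux (S.h m n) (S.u m n) i j σ *
    (if 0 ≤ (S.M m).dualFlux (S.h m n) (S.u m n) i j σ then f (S.u m n i σ)
      else f (S.u m n i (σ + e j)))

/-- The factor `f (u i)` of `dualTransport`. -/
noncomputable def upwind (f : ℝ → ℝ) (i j : Fin 2) (m n : ℕ) (σ : Fin 2 → ℤ) : ℝ :=
  if 0 ≤ (S.M m).dualFlux (S.h m n) (S.u m n) i j σ then f (S.u m n i σ)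
    else f (S.u m n i (σ + e j))

lemma upwind_bound {f : ℝ → ℝ} {B : ℝ} (hfB : ∀ x, |x| ≤ S.C → |f x| ≤ B) (i j : Fin 2) (m n : ℕ)
    (σ : Fin 2 → ℤ) : |S.upwind f i j m n σ| ≤ B := by
  unfold upwind
  split_ifs <;> exact hfB _ (S.u_bound _ _ _ _)

lemma upwind_conv {f : ℝ → ℝ} (hf : Continuous f) {q : (Fin 2 → ℝ) × ℝ} (hq : S.RegularAt q)
    (i j : Fin 2) :
    LocTendsto (S.idx q.1) 4 (fun m => S.upwind f i j m (S.tidx q.2 m + 1)) (f (ubar i q)) :=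
  LocTendsto.ite _ (((hq.u_conv i).comp hf).mono (by simp)) (((hq.u_conv i).comp hf).shift_add j)

lemma abs_e_le (i k : Fin 2) : |(e i) k| ≤ 2 := by simpa using abs_neg_e_le i k

/-- The fluxes through the dual edges, tested against a test function. -/
lemma sumLim_dualTransport (hφ : IsTest Ω T φ) {f : ℝ → ℝ} (hf : Continuous f) {B : ℝ}
    (hfB : ∀ x, |x| ≤ S.C → |f x| ≤ B) (i j : Fin 2) :
    SumLim (volume.restrict (Ω ×ˢ Ioo 0 T)) (volume.restrict Ω)
      (fun m => ∑ n ∈ Finset.range (S.N m), ∑ σ ∈ (S.M m).cells,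
        S.τ m * (S.dualTransport f i j m n σ * (S.edist i j m σ * S.edgeDx φ i j m (n + 1) σ)))
      (fun q => hbar q * ubar j q * (f (ubar i q) * dx j φ q)) (fun _ => 0) := by
  obtain ⟨L, hL0, hLφ, hLip⟩ := hφ.exists_bound
  have hev := S.edgeDx_supported hφ i
  -- each of the two primal fluxes contributes with the density `d`, taken at a neighbouring edge
  have key : ∀ (d : ℕ → ℕ → (Fin 2 → ℤ) → ℝ) (s : Fin 2 → ℤ), (∀ k, |s k| ≤ 2) →
      (∀ m n σ, |d m n σ| ≤ S.C * S.C) →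
      (∀ q, S.RegularAt q → LocTendsto (S.idx q.1) 2 (fun m => d m (S.tidx q.2 m + 1))
        (hbar q * ubar j q)) →
      SumLim (volume.restrict (Ω ×ˢ Ioo 0 T)) (volume.restrict Ω)
        (fun m => ∑ n ∈ Finset.range (S.N m), ∑ σ ∈ (S.M m).cells,
          S.τ m * (S.M m).cellArea (σ + s) *
            (d m n σ * (S.upwind f i j m n σ * S.edgeDx φ i j m (n + 1) σ)))
        (fun q => hbar q * ubar j q * (f (ubar i q) * dx j φ q)) (fun _ => 0) := by
    intro d s hs hd hdc
    refine S.sumLim_level (B := S.C * S.C * (B * L)) hs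
      (fun m n σ => abs_mul_le_mul (hd m n σ) (abs_mul_le_mul (S.upwind_bound hfB _ _ _ _ _)
        (S.edgeDx_bound hLip _ _ _ _ _)))
      (hev.mono fun m hm => Supported.congr S (hm j) fun n σ h => by rw [h]; ring)
      (fun q hq => (hdc q hq).mul (((S.upwind_conv hf hq i j).mono (by simp)).mul
        (S.edgeDx_conv hφ hq i j 2 2)))
  by_cases hj : j = i
  · subst hj
    have k1 := key (S.flux j) 0 (by simp) (S.flux_bound j)
      fun q hq => (S.flux_conv hq j).mono (by simp)
    have k2 := key (fun m n σ => S.flux j m n (σ + e j)) 0 (by simp)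
      (fun m n σ => S.flux_bound j m n _)
      fun q hq => ((S.flux_conv hq j).mono (by simp : 3 ≤ 4)).shift_add j
    refine ((k1.add k2).const_mul (1 / 2)).congr (Eventually.of_forall fun m => ?_)
      (fun q => by ring) (fun x => by ring)
    simp only [← Finset.sum_add_distrib, Finset.mul_sum]
    refine Finset.sum_congr rfl fun n _ => Finset.sum_congr rfl fun σ _ => ?_
    have hl : (S.M m).edgeLen j (σ + e j) = (S.M m).edgeLen j σ := by
      simp [edgeLen, e_ne (one_sub_ne j)]
    have hd : (S.M m).dualFlux (S.h m n) (S.u m n) j j σ =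
        (S.M m).edgeLen j σ * (S.flux j m n σ + S.flux j m n (σ + e j)) / 2 := by
      rw [dualFlux, if_pos rfl, massFlux_eq, massFlux_eq, hl]; ring
    rw [add_zero, cellArea_eq _ j, dualTransport, ← upwind, hd, edist_same, edgeLen]
    ring
  · have hji := eq_one_sub hj
    have k1 := key (fun m n σ => S.flux j m n (σ - e i + e j)) (-e i) (abs_neg_e_le i)
      (fun m n σ => S.flux_bound j m n _) fun q hq =>
        ((S.flux_conv hq j).shift_add j).shift_sub i
    have k2 := key (fun m n σ => S.flux j m n (σ - e i + e j)) (-e i + e j) (fun k => by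
        by_cases hk : k = i
        · subst hk; simp [e_ne (Ne.symm hj)]
        · rw [eq_one_sub hk, ← hji]; simp [e_ne hj])
      (fun m n σ => S.flux_bound j m n _) fun q hq =>
        ((S.flux_conv hq j).shift_add j).shift_sub i
    have k3 := key (fun m n σ => S.flux j m n (σ + e j)) 0 (by simp)
      (fun m n σ => S.flux_bound j m n _) fun q hq =>
        ((S.flux_conv hq j).mono (by simp : 3 ≤ 4)).shift_add j
    have k4 := key (fun m n σ => S.flux j m n (σ + e j)) (e j) (abs_e_le j)
      (fun m n σ => S.flux_bound j m n _) fun q hq =>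
        ((S.flux_conv hq j).mono (by simp : 3 ≤ 4)).shift_add j
    refine ((((k1.add k2).add k3).add k4).const_mul (1 / 4)).congr
      (Eventually.of_forall fun m => ?_) (fun q => by ring) (fun x => by ring)
    simp only [← Finset.sum_add_distrib, Finset.mul_sum]
    refine Finset.sum_congr rfl fun n _ => Finset.sum_congr rfl fun σ _ => ?_
    have hij : 1 - j = i := by rw [hji, sub_sub_cancel]
    have hd : (S.M m).dualFlux (S.h m n) (S.u m n) i j σ =
        ((S.M m).len i (σ i - 1) * S.flux j m n (σ - e i + e j) +
          (S.M m).len i (σ i) * S.flux j m n (σ + e j)) / 2 := by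
      rw [dualFlux, if_neg hj, massFlux_eq, massFlux_eq]
      simp [edgeLen, hij, e_ne (Ne.symm hj)]
    have a1 : (S.M m).cellArea (σ + -e i) = (S.M m).len i (σ i - 1) * (S.M m).len j (σ j) := by
      rw [cellArea_eq _ i, ← hji]; simp [e_ne hj, ← sub_eq_add_neg]
    have a2 : (S.M m).cellArea (σ + (-e i + e j)) =
        (S.M m).len i (σ i - 1) * (S.M m).len j (σ j + 1) := by
      rw [cellArea_eq _ i, ← hji]; simp [e_ne hj, e_ne (Ne.symm hj), ← sub_eq_add_neg]
    have a3 : (S.M m).cellArea (σ + 0) = (S.M m).len i (σ i) * (S.M m).len j (σ j) := by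
      rw [cellArea_eq _ i, ← hji]; simp
    have a4 : (S.M m).cellArea (σ + e j) = (S.M m).len i (σ i) * (S.M m).len j (σ j + 1) := by
      rw [cellArea_eq _ i, ← hji]; simp [e_ne (Ne.symm hj)]
    rw [a1, a2, a3, a4, dualTransport, ← upwind, hd, edist_ne S hj]
    ring

lemma dualArea_mul_dualHeight (i : Fin 2) (m n : ℕ) (σ : Fin 2 → ℤ) :
    (S.M m).dualArea i σ * (S.M m).dualHeight i (S.h m n) σ =
      (S.M m).cellArea (σ - e i) / 2 * S.h m n (σ - e i) + (S.M m).cellArea σ / 2 * S.h m n σ := by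
  rw [dualHeight, mul_div_cancel₀ _ ((S.M m).dualArea_pos i σ).ne']

/-- The discrete transport operator of the dual mesh, applied to `f (u i)` and tested against a
test function. It is used with `f x = x` for the momentum and with `f x = x ^ 2 / 2` for the kinetic
energy. -/
lemma sumLim_transport (hφ : IsTest Ω T φ) {f : ℝ → ℝ} (hf : Continuous f) (i : Fin 2) :
    SumLim (volume.restrict (Ω ×ˢ Ioo 0 T)) (volume.restrict Ω)
      (fun m => ∑ n ∈ Finset.range (S.N m), ∑ σ ∈ (S.M m).cells,
        ((S.M m).dualArea i σ * ((S.M m).dualHeight i (S.h m (n + 1)) σ * f (S.u m (n + 1) i σ) -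
            (S.M m).dualHeight i (S.h m n) σ * f (S.u m n i σ)) +
          S.τ m * ∑ j, (S.dualTransport f i j m n σ - S.dualTransport f i j m n (σ - e j))) *
        S.test φ (fun m => (S.M m).edgeMid i) m (n + 1) σ)
      (fun q => -(hbar q * f (ubar i q) * dt φ q +
        ∑ j, hbar q * ubar j q * (f (ubar i q) * dx j φ q)))
      (fun x => -(h₀ x * f (u₀ i x) * φ (x, 0))) := by
  obtain ⟨B, hfB⟩ : ∃ B, ∀ x, |x| ≤ S.C → |f x| ≤ B := by
    obtain ⟨B, hB⟩ := (isCompact_Icc (a := -S.C) (b := S.C)).exists_bound_of_continuousOn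
      hf.continuousOn
    exact ⟨B, fun x hx => hB x (abs_le.1 hx)⟩
  have hB0 : 0 ≤ B := (abs_nonneg _).trans (hfB 0 (by simpa using S.C_pos.le))
  have hp : ∀ m σ, (S.M m).edgeMid i σ ∈ (S.M m).cell σ := fun m => (S.M m).edgeMid_mem_cell i
  have t1 := S.sumLim_time hφ (s := -e i) (j := 1) (B := S.C * B) (B' := 1)
    (a := fun m n σ => S.h m n (σ - e i) * f (S.u m n i σ)) (c := fun _ _ => 1) (cb := fun _ => 1)
    (A := fun q => hbar q * f (ubar i q)) (A₀ := fun x => h₀ x * f (u₀ i x))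
    (abs_neg_e_le i) hp (fun m n σ => abs_mul_le_mul (S.h_abs_le _ _ _) (hfB _ (S.u_bound _ _ _ _)))
    (fun _ _ => by simp)
    (fun q hq => ((hq.h_conv.mono (by simp : 3 ≤ 5)).shift_sub i).mul
      (((hq.u_conv i).mono (by simp)).comp hf))
    (fun x hx => ((hx.h_conv.mono (by simp : 3 ≤ 5)).shift_sub i).mul
      (((hx.u_conv i).mono (by simp)).comp hf))
    (fun x _ => LocTendsto.const 1)
  have t2 := S.sumLim_time hφ (s := 0) (j := 1) (B := S.C * B) (B' := 1)
    (a := fun m n σ => S.h m n σ * f (S.u m n i σ)) (c := fun _ _ => 1) (cb := fun _ => 1)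
    (A := fun q => hbar q * f (ubar i q)) (A₀ := fun x => h₀ x * f (u₀ i x))
    (by simp) hp (fun m n σ => abs_mul_le_mul (S.h_abs_le _ _ _) (hfB _ (S.u_bound _ _ _ _)))
    (fun _ _ => by simp)
    (fun q hq => (hq.h_conv.mono (by simp)).mul (((hq.u_conv i).mono (by simp)).comp hf))
    (fun x hx => (hx.h_conv.mono (by simp)).mul (((hx.u_conv i).mono (by simp)).comp hf))
    (fun x _ => LocTendsto.const 1)
  have t3 := SumLim.sum (s := Finset.univ) fun j _ => S.sumLim_dualTransport hφ hf hfB i j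
  refine (((t1.add t2).const_mul (1 / 2)).add (t3.const_mul (-1))).congr ?_ (fun q => ?_)
    (fun x => ?_)
  rotate_left
  · ring
  · simp; ring
  filter_upwards [S.eventually_inner hφ] with m hm
  rw [Finset.sum_comm (s := Finset.univ), ← Finset.sum_add_distrib, Finset.mul_sum, Finset.mul_sum,
    ← Finset.sum_add_distrib]
  refine Finset.sum_congr rfl fun n _ => ?_
  have hdiv : ∀ j, ∑ σ ∈ (S.M m).cells, S.τ m * (S.dualTransport f i j m n σ *
      (S.edist i j m σ * S.edgeDx φ i j m (n + 1) σ)) =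
      -∑ σ ∈ (S.M m).cells, S.τ m * (S.dualTransport f i j m n σ -
        S.dualTransport f i j m n (σ - e j)) *
        S.test φ (fun m => (S.M m).edgeMid i) m (n + 1) σ := fun j => by
    simp only [edist_mul_edgeDx, mul_assoc, ← Finset.mul_sum]
    rw [S.sum_dualDiv_mul _ _ fun σ hne =>
      (hm n 1 σ σ (fun m => (S.M m).edgeMid i) (hp m σ) (by simp) hne).2]
    ring
  rw [Finset.sum_congr rfl fun j _ => hdiv j, Finset.sum_neg_distrib, mul_neg, neg_mul, one_mul,
    neg_neg, Finset.sum_comm (s := Finset.univ), ← Finset.sum_add_distrib, Finset.mul_sum,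
    ← Finset.sum_add_distrib]
  refine Finset.sum_congr rfl fun σ _ => ?_
  have d1 := S.dualArea_mul_dualHeight i m (n + 1) σ
  have d0 := S.dualArea_mul_dualHeight i m n σ
  rw [← Finset.sum_mul, ← Finset.mul_sum, add_zero, ← sub_eq_add_neg]
  linear_combination S.test φ (fun m => (S.M m).edgeMid i) m (n + 1) σ *
    (f (S.u m n i σ) * d0 - f (S.u m (n + 1) i σ) * d1)

end ConvergentScheme

/-! ### The momentum equation and the weak formulation -/

namespace ConvergentScheme

variable {Ω : Set (Fin 2 → ℝ)} {T g : ℝ} {z h₀ : (Fin 2 → ℝ) → ℝ}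
  {u₀ : Fin 2 → (Fin 2 → ℝ) → ℝ} {hbar : (Fin 2 → ℝ) × ℝ → ℝ}
  {ubar : Fin 2 → (Fin 2 → ℝ) × ℝ → ℝ} (S : ConvergentScheme Ω T g z h₀ u₀ hbar ubar)
  {φ : (Fin 2 → ℝ) × ℝ → ℝ}

/-- The values of a test function at the midpoints of the edges orthogonal to the direction `i`. -/
noncomputable def edgeTest (φ : (Fin 2 → ℝ) × ℝ → ℝ) (i : Fin 2) : ℕ → ℕ → (Fin 2 → ℤ) → ℝ :=
  S.test φ fun m => (S.M m).edgeMid i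

lemma edgeTest_supported (hφ : IsTest Ω T φ) (i : Fin 2) :
    ∀ᶠ m in atTop, S.Supported m (fun n => S.edgeTest φ i m (n + 1)) := by
  filter_upwards [S.eventually_inner hφ] with m hm n σ hne
  exact hm n 1 σ σ (fun m => (S.M m).edgeMid i) ((S.M m).edgeMid_mem_cell i _) (by simp) hne

/-- The pressure gradient, tested against a test function. -/
lemma sumLim_pressure (hφ : IsTest Ω T φ) (i : Fin 2) :
    SumLim (volume.restrict (Ω ×ˢ Ioo 0 T)) (volume.restrict Ω)
      (fun m => ∑ n ∈ Finset.range (S.N m), ∑ σ ∈ (S.M m).cells,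
        S.τ m * ((S.M m).edgeLen i σ *
          (1 / 2 * g * S.h m (n + 1) σ ^ 2 - 1 / 2 * g * S.h m (n + 1) (σ - e i) ^ 2)) *
          S.edgeTest φ i m (n + 1) σ)
      (fun q => -(1 / 2 * g * hbar q ^ 2 * dx i φ q)) (fun _ => 0) := by
  obtain ⟨L, hL0, hLφ, hLip⟩ := hφ.exists_bound
  have h1 := S.sumLim_sum (s := 0) (B := S.C ^ 2 * L)
    (E := fun m n σ => S.h m (n + 1) σ ^ 2 * S.edgeDx φ i i m (n + 1) σ)
    (W := fun q => hbar q ^ 2 * dx i φ q) (by simp)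
    (fun m n σ => abs_mul_le_mul (by
      rw [abs_pow]; exact pow_le_pow_left₀ (abs_nonneg _) (S.h_abs_le _ _ _) 2)
      (S.edgeDx_bound hLip _ _ _ _ _))
    ((S.edgeDx_supported hφ i).mono fun m hm => Supported.congr S (hm i) fun n σ h => by
      rw [h, mul_zero])
    (fun q hq => ((hq.h_conv.mono (by simp)).comp (continuous_pow 2)).mul
      (S.edgeDx_conv hφ hq i i 1 2))
  refine (h1.const_mul (-(1 / 2 * g))).congr ?_ (fun q => by ring) (fun x => by ring)
  filter_upwards [S.edgeTest_supported hφ i] with m hm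
  rw [Finset.mul_sum]
  refine Finset.sum_congr rfl fun n _ => ?_
  have hl : ∀ σ, (S.M m).edgeLen i (σ - e i) = (S.M m).edgeLen i σ := fun σ => by
    simp [edgeLen, e_ne (one_sub_ne i)]
  have h2 := S.sum_dualDiv_mul (fun σ => (S.M m).edgeLen i σ * S.h m (n + 1) σ ^ 2) i
    fun σ hne => (hm n σ hne).2
  have h3 : ∑ σ ∈ (S.M m).cells, S.τ m * ((S.M m).edgeLen i σ *
      (1 / 2 * g * S.h m (n + 1) σ ^ 2 - 1 / 2 * g * S.h m (n + 1) (σ - e i) ^ 2)) *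
      S.edgeTest φ i m (n + 1) σ = S.τ m * (1 / 2 * g) * ∑ σ ∈ (S.M m).cells,
        ((S.M m).edgeLen i σ * S.h m (n + 1) σ ^ 2 - (S.M m).edgeLen i (σ - e i) *
          S.h m (n + 1) (σ - e i) ^ 2) * S.edgeTest φ i m (n + 1) σ := by
    rw [Finset.mul_sum]
    refine Finset.sum_congr rfl fun σ _ => ?_
    rw [hl]; ring
  rw [h3, h2, ← Finset.sum_neg_distrib, Finset.mul_sum, Finset.mul_sum]
  refine Finset.sum_congr rfl fun σ _ => ?_
  have h4 := S.edist_mul_edgeDx (φ := φ) i i m (n + 1) σ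
  rw [edist_same] at h4
  rw [add_zero, cellArea_eq _ i, edgeLen, edgeTest]
  linear_combination (-(1 / 2 * g) * S.τ m * (S.M m).len (1 - i) (σ (1 - i)) *
    S.h m (n + 1) σ ^ 2) * h4

/-- The topography term, multiplied by `f (u i)` and tested against a test function. -/
lemma sumLim_topography (hφ : IsTest Ω T φ) {f : ℝ → ℝ} (hf : Continuous f) (i : Fin 2) :
    SumLim (volume.restrict (Ω ×ˢ Ioo 0 T)) (volume.restrict Ω)
      (fun m => ∑ n ∈ Finset.range (S.N m), ∑ σ ∈ (S.M m).cells,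
        S.τ m * (S.M m).dualArea i σ * (g * centeredHeight i (S.h m (n + 1)) σ * S.DZ m i σ *
          f (S.u m (n + 1) i σ) * S.edgeTest φ i m (n + 1) σ))
      (fun q => g * hbar q * pd i z q.1 * f (ubar i q) * φ q) (fun _ => 0) := by
  obtain ⟨L, hL0, hLφ, hLip⟩ := hφ.exists_bound
  obtain ⟨B, hfB⟩ : ∃ B, ∀ x, |x| ≤ S.C → |f x| ≤ B := by
    obtain ⟨B, hB⟩ := (isCompact_Icc (a := -S.C) (b := S.C)).exists_bound_of_continuousOn
      hf.continuousOn
    exact ⟨B, fun x hx => hB x (abs_le.1 hx)⟩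
  refine S.sumLim_sum_dual (B := |g| * S.C * S.C * B * L) i (fun m n σ => ?_)
    ((S.edgeTest_supported hφ i).mono fun m hm => Supported.congr S hm fun n σ h => by
      rw [h, mul_zero]) (fun q hq => ?_)
  · refine abs_mul_le_mul (abs_mul_le_mul (abs_mul_le_mul (abs_mul_le_mul le_rfl ?_)
      (S.DZ_bound _ _ _)) (hfB _ (S.u_bound _ _ _ _))) (hLφ _)
    have h1 := S.h_upper m (n + 1) (σ - e i)
    have h2 := S.h_upper m (n + 1) σ
    have h3 := S.h_pos m (n + 1) (σ - e i)
    have h4 := S.h_pos m (n + 1) σ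
    rw [centeredHeight, abs_of_pos (by linarith)]
    linarith
  · have c1 : LocTendsto (S.idx q.1) 2
        (fun m => centeredHeight i (S.h m (S.tidx q.2 m + 1))) (hbar q) := by
      have := (((hq.h_conv.mono (by simp : 3 ≤ 5)).shift_sub i).add
        (hq.h_conv.mono (by simp : 2 ≤ 5))).const_mul (1 / 2)
      intro κ hκ
      have h5 := this κ hκ
      simp only [centeredHeight]
      convert h5 using 2 <;> ring
    exact (((c1.const_mul g).mul ((S.DZ_conv _ hq.mem.1 i).mono (by simp))).mul
      (((hq.u_conv i).mono (by simp)).comp hf)).mul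
      (S.test_conv hφ hq.mem.2.1 (S.locPt_edgeMid hq.mem.1 2 i) 1)

lemma discreteGrad_Z {i : Fin 2} {m : ℕ} {σ : Fin 2 → ℤ} (hσ : σ ∈ (S.M m).intEdges i) :
    (S.M m).discreteGrad i (S.Z m) σ = S.DZ m i σ := by
  rw [discreteGrad, S.Z_sub m i σ hσ, div_mul_eq_mul_div, ← mul_assoc, edgeLen_mul_dist,
    mul_div_cancel_left₀ _ ((S.M m).dualArea_pos i σ).ne']

include S in
/-- The momentum equation, tested against a vector-valued test function. -/
lemma momentum_identity {φ : Fin 2 → (Fin 2 → ℝ) × ℝ → ℝ} (hφ : ∀ i, IsTest Ω T (φ i)) :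
    SumLim (volume.restrict (Ω ×ˢ Ioo 0 T)) (volume.restrict Ω) (fun _ => 0)
      (fun q => ∑ i, (-(hbar q * ubar i q * dt (φ i) q +
        ∑ j, hbar q * ubar j q * (ubar i q * dx j (φ i) q)) + -(1 / 2 * g * hbar q ^ 2 * dx i (φ i) q)
        + g * hbar q * pd i z q.1 * 1 * φ i q))
      (fun x => ∑ i, -(h₀ x * u₀ i x * φ i (x, 0))) := by
  have h1 := SumLim.sum (s := Finset.univ) fun i _ =>
    ((S.sumLim_transport (hφ i) continuous_id i).add (S.sumLim_pressure (hφ i) i)).add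
      (S.sumLim_topography (hφ i) (f := fun _ => 1) continuous_const i)
  refine h1.congr ?_ (fun q => rfl) (fun x => by simp)
  have hev := eventually_all.2 fun i => S.edgeTest_supported (hφ i) i
  filter_upwards [hev] with m hm
  refine Finset.sum_eq_zero fun i _ => ?_
  rw [← Finset.sum_add_distrib, ← Finset.sum_add_distrib]
  refine Finset.sum_eq_zero fun n _ => ?_
  rw [← Finset.sum_add_distrib, ← Finset.sum_add_distrib]
  refine Finset.sum_eq_zero fun σ _ => ?_
  change _ * S.edgeTest (φ i) i m (n + 1) σ + _ + _ = 0
  by_cases h0 : S.edgeTest (φ i) i m (n + 1) σ = 0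
  · rw [h0]; ring
  obtain ⟨hn, hin⟩ := hm i n σ h0
  have hσ := hin.mem_intEdges i
  have h2 := S.momentum m n (by omega) i σ hσ
  rw [S.discreteGrad_Z hσ, convection, discreteGrad] at h2
  have h3 := (S.τ_pos m).ne'
  have h4 := ((S.M m).dualArea_pos i σ).ne'
  field_simp at h2
  simp only [dualTransport, id, momentumFlux] at h2 ⊢
  linear_combination (S.edgeTest (φ i) i m (n + 1) σ / 2) * h2

include S in
lemma ae_abs_hbar_le : ∀ᵐ q ∂(volume.restrict (Ω ×ˢ Ioo 0 T)), |hbar q| ≤ S.C := by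
  filter_upwards [S.ae_regularAt] with q hq
  exact le_of_tendsto (hq.h_conv (S.idx q.1) (by simp)).abs
    (Eventually.of_forall fun m => S.h_abs_le _ _ _)

include S in
lemma ae_abs_ubar_le (i : Fin 2) :
    ∀ᵐ q ∂(volume.restrict (Ω ×ˢ Ioo 0 T)), |ubar i q| ≤ S.C := by
  filter_upwards [S.ae_regularAt] with q hq
  exact le_of_tendsto (hq.u_conv i (S.idx q.1) (by simp)).abs
    (Eventually.of_forall fun m => S.u_bound _ _ _ _)

include S in
lemma ae_abs_h₀_le : ∀ᵐ x ∂(volume.restrict Ω), |h₀ x| ≤ S.C := by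
  filter_upwards [S.ae_initRegularAt] with x hx
  exact le_of_tendsto (hx.h_conv (S.idx x) (by simp)).abs
    (Eventually.of_forall fun m => S.h_abs_le _ _ _)

include S in
lemma ae_abs_u₀_le (i : Fin 2) : ∀ᵐ x ∂(volume.restrict Ω), |u₀ i x| ≤ S.C := by
  filter_upwards [S.ae_initRegularAt] with x hx
  exact le_of_tendsto (hx.u_conv i (S.idx x) (by simp)).abs
    (Eventually.of_forall fun m => S.u_bound _ _ _ _)

include S in
/-- The limit is a weak solution of the shallow water equations. -/
theorem isWeakSolution (hbar_int : IntegrableOn hbar (Ω ×ˢ Ioo 0 T))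
    (ubar_int : ∀ i, IntegrableOn (ubar i) (Ω ×ˢ Ioo 0 T)) (hh₀ : IntegrableOn h₀ Ω)
    (hu₀ : ∀ i, IntegrableOn (u₀ i) Ω) : IsWeakSolution Ω T g z h₀ u₀ hbar ubar where
  integrable_h := hbar_int
  integrable_h_sq := by
    simp only [sq]
    exact hbar_int.bdd_mul hbar_int.1 S.ae_abs_hbar_le
  integrable_hu i := (ubar_int i).bdd_mul hbar_int.1 S.ae_abs_hbar_le
  integrable_huu i j := by
    refine (ubar_int j).bdd_mul (c := S.C * S.C) (hbar_int.1.mul (ubar_int i).1) ?_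
    filter_upwards [S.ae_abs_hbar_le, S.ae_abs_ubar_le i] with q h1 h2 using abs_mul_le_mul h1 h2
  integrable_h₀ := hh₀
  integrable_h₀u₀ i := (hu₀ i).bdd_mul hh₀.1 S.ae_abs_h₀_le
  mass φ hφ := by
    have h := S.mass_identity hφ (c := fun _ _ => 1) (Dc := fun _ _ _ => 0) (cb := fun _ => 1)
      (cd := fun _ _ => 0) (B := 1) (by simp) (by simp) (by simp)
      (fun _ _ => LocTendsto.const 1) (fun _ _ _ => LocTendsto.const 0)
    have h1 := tendsto_nhds_unique h.tendsto tendsto_const_nhds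
    simpa using h1
  momentum φ hφ := by
    have h := S.momentum_identity hφ
    have h1 := tendsto_nhds_unique h.tendsto tendsto_const_nhds
    refine Eq.trans ?_ h1
    rw [← integral_neg, sub_eq_add_neg, ← integral_neg]
    congr 1
    · refine integral_congr_ae (Eventually.of_forall fun q => ?_)
      simp only [Fin.sum_univ_two]; ring
    · refine integral_congr_ae (Eventually.of_forall fun x => ?_)
      simp only [Fin.sum_univ_two]; ring

end ConvergentScheme

/-! ### The kinetic energy inequality -/

/-- The kinetic energy inequality for one step of an explicit upwind scheme, with outward mass
fluxes `a` and convected values `v`, under a CFL condition. -/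
lemma kinetic_energy_le {ι : Type*} (s : Finset ι) (a v : ι → ℝ) {H H₀ u' u P : ℝ}
    (hmass : H - H₀ + ∑ i ∈ s, a i = 0) (hmom : H * u' - H₀ * u + ∑ i ∈ s, a i * v i + P = 0)
    (hup : ∀ i ∈ s, 0 ≤ a i → a i * (v i - u) = 0) (hcfl : ∑ i ∈ s, |a i| ≤ H) :
    H * (u' ^ 2 / 2) - H₀ * (u ^ 2 / 2) + ∑ i ∈ s, a i * (v i ^ 2 / 2) + P * u' ≤ 0 := by
  have h1 : ∀ i ∈ s, a i * (v i ^ 2 / 2) - a i * v i * u' + a i * (u * u' - u ^ 2 / 2)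
      ≤ |a i| * ((u' - u) ^ 2 / 2) := by
    intro i hi
    rcases le_or_gt 0 (a i) with h | h
    · have h2 := hup i hi h
      have h3 : a i * (v i ^ 2 / 2) - a i * v i * u' + a i * (u * u' - u ^ 2 / 2) =
          a i * (v i - u) * ((v i + u) / 2 - u') := by ring
      rw [h3, h2, zero_mul]; positivity
    · rw [abs_of_neg h]
      have h3 : -a i * ((u' - u) ^ 2 / 2) - (a i * (v i ^ 2 / 2) - a i * v i * u' +
          a i * (u * u' - u ^ 2 / 2)) = -a i * (v i - u') ^ 2 / 2 := by ring
      have h4 : 0 ≤ -a i * (v i - u') ^ 2 / 2 := by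
        have : 0 < -a i := by linarith
        positivity
      linarith
  have h2 := Finset.sum_le_sum h1
  rw [Finset.sum_add_distrib, Finset.sum_sub_distrib, ← Finset.sum_mul, ← Finset.sum_mul,
    ← Finset.sum_mul] at h2
  have h3 := mul_le_mul_of_nonneg_right hcfl (by positivity : 0 ≤ (u' - u) ^ 2 / 2)
  have h4 : ∑ i ∈ s, a i = H₀ - H := by linarith
  have h5 : ∑ i ∈ s, a i * v i = H₀ * u - H * u' - P := by linarith
  rw [h4, h5] at h2
  nlinarith

namespace ConvergentScheme

variable {Ω : Set (Fin 2 → ℝ)} {T g : ℝ} {z h₀ : (Fin 2 → ℝ) → ℝ}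
  {u₀ : Fin 2 → (Fin 2 → ℝ) → ℝ} {hbar : (Fin 2 → ℝ) × ℝ → ℝ}
  {ubar : Fin 2 → (Fin 2 → ℝ) × ℝ → ℝ} (S : ConvergentScheme Ω T g z h₀ u₀ hbar ubar)
  {φ : (Fin 2 → ℝ) × ℝ → ℝ}

/-- A bound for the ratio of the time step to the length of any side of a cell. -/
noncomputable def cfl (m : ℕ) : ℝ := S.C * (S.τ m / (S.M m).size)

lemma τ_le {m : ℕ} {K : Fin 2 → ℤ} (hK : K ∈ (S.M m).cells) (i : Fin 2) :
    S.τ m ≤ S.cfl m * (S.M m).len i (K i) := by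
  have h0 : 0 < (S.M m).size := ((S.M m).len_pos i (K i)).trans_le ((S.M m).len_le_size hK i)
  have h1 := S.size_le m K hK i
  have h2 : 0 < S.τ m / (S.M m).size := div_pos (S.τ_pos m) h0
  have h3 := mul_le_mul_of_nonneg_left h1 h2.le
  rw [div_mul_cancel₀ _ h0.ne'] at h3
  rw [cfl]; linarith

lemma cfl_nonneg {m : ℕ} {K : Fin 2 → ℤ} (hK : K ∈ (S.M m).cells) : 0 ≤ S.cfl m :=
  (pos_of_mul_pos_left ((S.τ_pos m).trans_le (S.τ_le hK 0)) ((S.M m).len_pos 0 _).le).le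

/-- The mass equation, without denominators. -/
lemma mass_mul {m n : ℕ} (hn : n + 1 < S.N m) {K : Fin 2 → ℤ} (hK : K ∈ (S.M m).cells) :
    (S.M m).cellArea K * (S.h m (n + 1) K - S.h m n K) +
      S.τ m * ∑ i, ((S.M m).massFlux (S.h m n) (S.u m n) i (K + e i) -
        (S.M m).massFlux (S.h m n) (S.u m n) i K) = 0 := by
  have h3 := S.mass m n hn K hK
  have h4 := (S.τ_pos m).ne'
  have h5 := ((S.M m).cellArea_pos K).ne'
  rw [divCell] at h3
  field_simp at h3
  linear_combination h3

/-- The mass balance on the dual cells, a consequence of the choice of the dual fluxes. -/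
lemma dual_mass {m n : ℕ} (hn : n + 1 < S.N m) {σ : Fin 2 → ℤ} {i : Fin 2}
    (hσ : σ ∈ (S.M m).intEdges i) :
    (S.M m).dualArea i σ * (S.M m).dualHeight i (S.h m (n + 1)) σ -
      (S.M m).dualArea i σ * (S.M m).dualHeight i (S.h m n) σ +
      S.τ m * ∑ j, ((S.M m).dualFlux (S.h m n) (S.u m n) i j σ -
        (S.M m).dualFlux (S.h m n) (S.u m n) i j (σ - e j)) = 0 := by
  obtain ⟨hK, hK'⟩ := (S.M m).mem_intEdges.1 hσ
  have h1 := S.mass_mul hn hK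
  have h2 := S.mass_mul hn hK'
  rw [dualArea_mul_dualHeight, dualArea_mul_dualHeight]
  have e1 : σ - e 0 + e 0 = σ := sub_add_cancel _ _
  have e2 : σ - e 1 + e 1 = σ := sub_add_cancel _ _
  have e3 : σ - e 1 - e 0 + e 1 = σ - e 0 := by abel
  have e4 : σ - e 0 - e 1 + e 0 = σ - e 1 := by abel
  fin_cases i
  · simp only [Fin.sum_univ_two, Fin.zero_eta, Fin.isValue, dualFlux, ↓reduceIte, one_ne_zero, e1,
      e2, e3] at h1 h2 ⊢
    linear_combination h1 / 2 + h2 / 2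
  · simp only [Fin.sum_univ_two, Fin.mk_one, Fin.isValue, dualFlux, ↓reduceIte, zero_ne_one, e1,
      e2, e4] at h1 h2 ⊢
    linear_combination h1 / 2 + h2 / 2

lemma massFlux_le (i : Fin 2) (m n : ℕ) (σ : Fin 2 → ℤ) :
    |(S.M m).massFlux (S.h m n) (S.u m n) i σ| ≤ (S.M m).edgeLen i σ * S.C ^ 2 := by
  rw [massFlux_eq, sq]
  exact abs_mul_le_mul (abs_of_pos ((S.M m).len_pos _ _)).le (S.flux_bound i m n σ)

/-- The mass fluxes through the dual edges are small, compared with the area of the dual cell. -/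
lemma τ_dualFlux_le {m : ℕ} (n : ℕ) {σ : Fin 2 → ℤ} {i : Fin 2} (hσ : σ ∈ (S.M m).intEdges i)
    (j : Fin 2) :
    S.τ m * |(S.M m).dualFlux (S.h m n) (S.u m n) i j σ| ≤
        2 * S.cfl m * S.C ^ 2 * (S.M m).dualArea i σ ∧
      S.τ m * |(S.M m).dualFlux (S.h m n) (S.u m n) i j (σ - e j)| ≤
        2 * S.cfl m * S.C ^ 2 * (S.M m).dualArea i σ := by
  obtain ⟨hK, hK'⟩ := (S.M m).mem_intEdges.1 hσ
  have hτ := (S.τ_pos m).le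
  have hr := S.cfl_nonneg hK
  have hA := (S.M m).cellArea_pos σ
  have hA' := (S.M m).cellArea_pos (σ - e i)
  have hC : 0 ≤ S.C ^ 2 := sq_nonneg _
  have hl := S.massFlux_le
  -- the two halves of a dual edge have the lengths `l / 2` and `l' / 2`
  have key : ∀ (x y l l' : ℝ), |x| ≤ l * S.C ^ 2 → |y| ≤ l' * S.C ^ 2 →
      S.τ m * (l + l') ≤ 4 * S.cfl m * (S.M m).dualArea i σ →
      S.τ m * |(x + y) / 2| ≤ 2 * S.cfl m * S.C ^ 2 * (S.M m).dualArea i σ := by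
    intro x y l l' hx hy hll
    rw [abs_div, abs_two]
    have h1 := mul_le_mul_of_nonneg_left ((abs_add_le x y).trans (add_le_add hx hy)) hτ
    have h2 := mul_le_mul_of_nonneg_right hll hC
    nlinarith
  by_cases hj : j = i
  · subst hj
    have h1 : S.τ m * (S.M m).len (1 - j) (σ (1 - j)) ≤ S.cfl m * (S.M m).cellArea σ := by
      rw [cellArea_eq _ j, ← mul_assoc]
      exact mul_le_mul_of_nonneg_right (S.τ_le hK j) ((S.M m).len_pos _ _).le
    have h2 : S.τ m * ((S.M m).len (1 - j) (σ (1 - j)) + (S.M m).len (1 - j) (σ (1 - j))) ≤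
        4 * S.cfl m * (S.M m).dualArea j σ := by
      rw [dualArea]; nlinarith
    constructor
    · rw [dualFlux, if_pos rfl]
      refine key _ _ _ _ (hl j m n σ) (hl j m n (σ + e j)) ?_
      simpa [edgeLen, e_ne (one_sub_ne j)] using h2
    · rw [dualFlux, if_pos rfl]
      refine key _ _ _ _ (hl j m n (σ - e j)) (hl j m n (σ - e j + e j)) ?_
      simpa [edgeLen, e_ne (one_sub_ne j)] using h2
  · have hji := eq_one_sub hj
    have hij : 1 - j = i := by rw [hji, sub_sub_cancel]
    have h1 : S.τ m * (S.M m).len i (σ i) ≤ S.cfl m * (S.M m).cellArea σ := by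
      rw [cellArea_eq _ j, hij, ← mul_assoc]
      exact mul_le_mul_of_nonneg_right (S.τ_le hK j) ((S.M m).len_pos _ _).le
    have h1' : S.τ m * (S.M m).len i (σ i - 1) ≤ S.cfl m * (S.M m).cellArea (σ - e i) := by
      rw [cellArea_eq _ j, hij, ← mul_assoc]
      have := mul_le_mul_of_nonneg_right (S.τ_le hK' j) ((S.M m).len_pos i (σ i - 1)).le
      simpa using this
    have h2 : S.τ m * ((S.M m).len i (σ i - 1) + (S.M m).len i (σ i)) ≤
        4 * S.cfl m * (S.M m).dualArea i σ := by
      rw [dualArea]; nlinarith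
    constructor
    · rw [dualFlux, if_neg hj]
      refine key _ _ _ _ (hl j m n _) (hl j m n _) ?_
      simpa [edgeLen, hij, e_ne (Ne.symm hj)] using h2
    · rw [dualFlux, if_neg hj]
      refine key _ _ _ _ (hl j m n _) (hl j m n _) ?_
      simpa [edgeLen, hij, e_ne (Ne.symm hj)] using h2

lemma dualHeight_lower (i : Fin 2) (m n : ℕ) (σ : Fin 2 → ℤ) :
    (S.M m).dualArea i σ * (1 / S.C) ≤
      (S.M m).dualArea i σ * (S.M m).dualHeight i (S.h m n) σ := by
  rw [dualArea_mul_dualHeight, dualArea]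
  have h1 := mul_le_mul_of_nonneg_left (S.h_lower m n σ) ((S.M m).cellArea_pos σ).le
  have h2 := mul_le_mul_of_nonneg_left (S.h_lower m n (σ - e i)) ((S.M m).cellArea_pos (σ - e i)).le
  linarith

/-- The discrete kinetic energy inequality. -/
lemma kinetic_ineq {m : ℕ} (hcfl : 8 * S.cfl m * S.C ^ 2 ≤ 1 / S.C) {n : ℕ} (hn : n + 1 < S.N m)
    {σ : Fin 2 → ℤ} {i : Fin 2} (hσ : σ ∈ (S.M m).intEdges i) :
    (S.M m).dualArea i σ * ((S.M m).dualHeight i (S.h m (n + 1)) σ * (S.u m (n + 1) i σ ^ 2 / 2) -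
        (S.M m).dualHeight i (S.h m n) σ * (S.u m n i σ ^ 2 / 2)) +
      S.τ m * ∑ j, (S.dualTransport (fun x => x ^ 2 / 2) i j m n σ -
        S.dualTransport (fun x => x ^ 2 / 2) i j m n (σ - e j)) +
      (S.τ m * ((S.M m).edgeLen i σ *
          (1 / 2 * g * S.h m (n + 1) σ ^ 2 - 1 / 2 * g * S.h m (n + 1) (σ - e i) ^ 2)) +
        S.τ m * (S.M m).dualArea i σ * (g * centeredHeight i (S.h m (n + 1)) σ * S.DZ m i σ)) *
        S.u m (n + 1) i σ ≤ 0 := by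
  set D := fun j => (S.M m).dualFlux (S.h m n) (S.u m n) i j σ with hD
  set D' := fun j => (S.M m).dualFlux (S.h m n) (S.u m n) i j (σ - e j) with hD'
  have hτ := (S.τ_pos m)
  have hmain := kinetic_energy_le (Finset.univ : Finset (Fin 2 ⊕ Fin 2))
    (Sum.elim (fun j => S.τ m * D j) (fun j => -(S.τ m * D' j)))
    (Sum.elim (fun j => if 0 ≤ D j then S.u m n i σ else S.u m n i (σ + e j))
      (fun j => if 0 ≤ D' j then S.u m n i (σ - e j) else S.u m n i σ))
    (H := (S.M m).dualArea i σ * (S.M m).dualHeight i (S.h m (n + 1)) σ)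
    (H₀ := (S.M m).dualArea i σ * (S.M m).dualHeight i (S.h m n) σ)
    (u' := S.u m (n + 1) i σ) (u := S.u m n i σ)
    (P := S.τ m * ((S.M m).edgeLen i σ *
          (1 / 2 * g * S.h m (n + 1) σ ^ 2 - 1 / 2 * g * S.h m (n + 1) (σ - e i) ^ 2)) +
        S.τ m * (S.M m).dualArea i σ * (g * centeredHeight i (S.h m (n + 1)) σ * S.DZ m i σ))
    (by
      have h1 := S.dual_mass hn hσ
      rw [Fintype.sum_sum_type]
      simp only [Sum.elim_inl, Sum.elim_inr, Fin.sum_univ_two] at h1 ⊢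
      linear_combination h1)
    (by
      have h2 := S.momentum m n hn i σ hσ
      rw [S.discreteGrad_Z hσ, convection, discreteGrad] at h2
      have h3 := hτ.ne'
      have h4 := ((S.M m).dualArea_pos i σ).ne'
      field_simp at h2
      rw [Fintype.sum_sum_type]
      simp only [momentumFlux, Sum.elim_inl, Sum.elim_inr, Fin.sum_univ_two, sub_add_cancel]
        at h2 ⊢
      linear_combination h2 / 2)
    (by
      rintro (j | j) _ h
      · simp only [Sum.elim_inl] at h ⊢
        rw [if_pos (nonneg_of_mul_nonneg_right h hτ)]; ring
      · simp only [Sum.elim_inr] at h ⊢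
        have h' : D' j ≤ 0 := by
          by_contra! hc
          have := mul_pos hτ hc
          linarith
        rcases h'.lt_or_eq with h' | h'
        · rw [if_neg (not_le.2 h')]; ring
        · rw [h']; ring)
    (by
      refine le_trans ?_ (S.dualHeight_lower i m (n + 1) σ)
      rw [Fintype.sum_sum_type]
      simp only [Sum.elim_inl, Sum.elim_inr, Fin.sum_univ_two, abs_neg, abs_mul, abs_of_pos hτ]
      obtain ⟨a1, a2⟩ := S.τ_dualFlux_le n hσ 0
      obtain ⟨a3, a4⟩ := S.τ_dualFlux_le n hσ 1
      have h5 := mul_le_mul_of_nonneg_right hcfl ((S.M m).dualArea_pos i σ).le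
      linarith)
  refine le_trans (le_of_eq ?_) hmain
  rw [Fintype.sum_sum_type]
  have hT : ∀ j, S.dualTransport (fun x => x ^ 2 / 2) i j m n σ =
      D j * ((if 0 ≤ D j then S.u m n i σ else S.u m n i (σ + e j)) ^ 2 / 2) := fun j => by
    rw [dualTransport]; split_ifs <;> rfl
  have hT' : ∀ j, S.dualTransport (fun x => x ^ 2 / 2) i j m n (σ - e j) =
      D' j * ((if 0 ≤ D' j then S.u m n i (σ - e j) else S.u m n i σ) ^ 2 / 2) := fun j => by
    rw [dualTransport, sub_add_cancel]; split_ifs <;> rfl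
  simp only [hT, hT', Sum.elim_inl, Sum.elim_inr, Fin.sum_univ_two]
  ring

end ConvergentScheme

/-! ### The entropy inequality -/

namespace ConvergentScheme

variable {Ω : Set (Fin 2 → ℝ)} {T g : ℝ} {z h₀ : (Fin 2 → ℝ) → ℝ}
  {u₀ : Fin 2 → (Fin 2 → ℝ) → ℝ} {hbar : (Fin 2 → ℝ) × ℝ → ℝ}
  {ubar : Fin 2 → (Fin 2 → ℝ) × ℝ → ℝ} (S : ConvergentScheme Ω T g z h₀ u₀ hbar ubar)
  {φ : (Fin 2 → ℝ) × ℝ → ℝ}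

/-- The values of a test function at the centers of the cells. -/
noncomputable def cellTest (φ : (Fin 2 → ℝ) × ℝ → ℝ) : ℕ → ℕ → (Fin 2 → ℤ) → ℝ :=
  S.test φ fun m => (S.M m).center

lemma edgeMid_to_center (i : Fin 2) (m : ℕ) (σ : Fin 2 → ℤ) :
    (S.M m).center σ - (S.M m).edgeMid i σ =
      ((S.M m).len i (σ i) / 2) • (Pi.single i 1 : Fin 2 → ℝ) := by
  ext k
  by_cases hk : k = i
  · subst hk; simp [edgeMid, MACGrid.center, len]; ring
  · simp [hk, edgeMid]

lemma center_to_edgeMid (i : Fin 2) (m : ℕ) (σ : Fin 2 → ℤ) :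
    (S.M m).edgeMid i σ - (S.M m).center (σ - e i) =
      ((S.M m).len i (σ i - 1) / 2) • (Pi.single i 1 : Fin 2 → ℝ) := by
  ext k
  by_cases hk : k = i
  · subst hk; simp [edgeMid, MACGrid.center, len]; ring
  · simp [hk, edgeMid, MACGrid.center, e_ne hk]

/-- The discrete counterpart of `h² u · ∇φ`, with derivatives of `φ` on the two halves of the dual
cells. -/
lemma sumLim_pressureWork (hφ : IsTest Ω T φ) (i : Fin 2) :
    SumLim (volume.restrict (Ω ×ˢ Ioo 0 T)) (volume.restrict Ω)
      (fun m => ∑ n ∈ Finset.range (S.N m), ∑ σ ∈ (S.M m).cells,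
        S.τ m * ((S.M m).edgeLen i σ * (S.flux i m (n + 1) σ *
          (S.h m (n + 1) σ * (S.cellTest φ m (n + 1) σ - S.edgeTest φ i m (n + 1) σ) -
            S.h m (n + 1) (σ - e i) *
              (S.cellTest φ m (n + 1) (σ - e i) - S.edgeTest φ i m (n + 1) σ)))))
      (fun q => hbar q ^ 2 * ubar i q * dx i φ q) (fun _ => 0) := by
  obtain ⟨L, hL0, hLφ, hLip⟩ := hφ.exists_bound
  have hev := S.eventually_inner hφ
  have hd1 : ∀ m (σ : Fin 2 → ℤ), 0 < (S.M m).len i (σ i) / 2 := fun m σ =>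
    half_pos ((S.M m).len_pos _ _)
  have hd2 : ∀ m (σ : Fin 2 → ℤ), 0 < (S.M m).len i (σ i - 1) / 2 := fun m σ =>
    half_pos ((S.M m).len_pos _ _)
  set D₁ := S.testDx φ (fun m => (S.M m).edgeMid i) (fun m => (S.M m).center)
    (fun m σ => (S.M m).len i (σ i) / 2) with hD₁
  set D₂ := S.testDx φ (fun m σ => (S.M m).center (σ - e i)) (fun m => (S.M m).edgeMid i)
    (fun m σ => (S.M m).len i (σ i - 1) / 2) with hD₂
  have m1 : ∀ m n σ, (S.M m).len i (σ i) / 2 * D₁ m n σ =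
      S.cellTest φ m n σ - S.edgeTest φ i m n σ := fun m n σ => by
    rw [hD₁, testDx, mul_div_cancel₀ _ (hd1 m σ).ne']; rfl
  have m2 : ∀ m n σ, (S.M m).len i (σ i - 1) / 2 * D₂ m n σ =
      S.edgeTest φ i m n σ - S.cellTest φ m n (σ - e i) := fun m n σ => by
    rw [hD₂, testDx, mul_div_cancel₀ _ (hd2 m σ).ne']; rfl
  have k1 := S.sumLim_sum (s := 0) (B := S.C * S.C * S.C * L)
    (E := fun m n σ => S.flux i m (n + 1) σ * S.h m (n + 1) σ * D₁ m (n + 1) σ)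
    (W := fun q => hbar q * ubar i q * hbar q * dx i φ q) (by simp)
    (fun m n σ => abs_mul_le_mul (abs_mul_le_mul (S.flux_bound _ _ _ _) (S.h_abs_le _ _ _))
      (S.testDx_bound hLip hd1 (S.edgeMid_to_center i) m (n + 1) σ))
    (by
      filter_upwards [hev] with m hm n σ hne
      have h := right_ne_zero_of_mul hne
      by_cases h' : S.cellTest φ m (n + 1) σ = 0
      · refine hm n 1 σ σ (fun m => (S.M m).edgeMid i) ((S.M m).edgeMid_mem_cell i _) (by simp)
          fun h0 => h ?_
        rw [← mul_right_inj' (hd1 m σ).ne', m1, h', edgeTest, h0]; simp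
      · exact hm n 1 σ σ (fun m => (S.M m).center) ((S.M m).center_mem_cell _) (by simp) h')
    (fun q hq => (((S.flux_conv hq i).mono (by simp)).mul (hq.h_conv.mono (by simp))).mul
      (S.testDx_conv hφ hq.mem.2.1 (S.locPt_edgeMid hq.mem.1 2 i) (S.locPt_center hq.mem.1 2)
        hd1 (S.edgeMid_to_center i) 1))
  have k2 := S.sumLim_sum (s := -e i) (B := S.C * S.C * S.C * L)
    (E := fun m n σ => S.flux i m (n + 1) σ * S.h m (n + 1) (σ - e i) * D₂ m (n + 1) σ)
    (W := fun q => hbar q * ubar i q * hbar q * dx i φ q) (abs_neg_e_le i)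
    (fun m n σ => abs_mul_le_mul (abs_mul_le_mul (S.flux_bound _ _ _ _) (S.h_abs_le _ _ _))
      (S.testDx_bound hLip hd2 (S.center_to_edgeMid i) m (n + 1) σ))
    (by
      filter_upwards [hev] with m hm n σ hne
      have h := right_ne_zero_of_mul hne
      by_cases h' : S.cellTest φ m (n + 1) (σ - e i) = 0
      · refine hm n 1 σ σ (fun m => (S.M m).edgeMid i) ((S.M m).edgeMid_mem_cell i _) (by simp)
          fun h0 => h ?_
        rw [← mul_right_inj' (hd2 m σ).ne', m2, h', edgeTest, h0]; simp
      · refine hm n 1 σ (σ - e i) (fun m => (S.M m).center) ((S.M m).center_mem_cell _)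
          (fun k => ?_) h'
        simpa using abs_neg_e_le i k)
    (fun q hq => (((S.flux_conv hq i).mono (by simp)).mul
      ((hq.h_conv.mono (by simp : 3 ≤ 5)).shift_sub i)).mul
      (S.testDx_conv hφ hq.mem.2.1 ((S.locPt_center hq.mem.1 3).shift_sub i)
        (S.locPt_edgeMid hq.mem.1 2 i) hd2 (S.center_to_edgeMid i) 1))
  refine ((k1.add k2).const_mul (1 / 2)).congr (Eventually.of_forall fun m => ?_)
    (fun q => by ring) (fun x => by ring)
  simp only [← Finset.sum_add_distrib, Finset.mul_sum]
  refine Finset.sum_congr rfl fun n _ => Finset.sum_congr rfl fun σ _ => ?_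
  have e1 := m1 m (n + 1) σ
  have e2 := m2 m (n + 1) σ
  have a1 : (S.M m).cellArea (σ + 0) = (S.M m).len i (σ i) * (S.M m).edgeLen i σ := by
    rw [add_zero, cellArea_eq _ i, edgeLen]
  have a2 : (S.M m).cellArea (σ + -e i) = (S.M m).len i (σ i - 1) * (S.M m).edgeLen i σ := by
    rw [← sub_eq_add_neg, cellArea_eq _ i, edgeLen]; simp [e_ne (one_sub_ne i)]
  rw [a1, a2]
  linear_combination (S.τ m * (S.M m).edgeLen i σ * S.flux i m (n + 1) σ) *
    (S.h m (n + 1) σ * e1 + S.h m (n + 1) (σ - e i) * e2)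

/-- The discrete work of the pressure `h ∇(h φ) · (h u)` at one time step. -/
noncomputable def work (φ : (Fin 2 → ℝ) × ℝ → ℝ) (m n : ℕ) : ℝ :=
  ∑ i, ∑ σ ∈ (S.M m).cells, (S.M m).massFlux (S.h m n) (S.u m n) i σ *
    (S.h m n σ * S.cellTest φ m n σ - S.h m n (σ - e i) * S.cellTest φ m n (σ - e i))

lemma cellTest_supported (hφ : IsTest Ω T φ) : ∀ᶠ m in atTop, S.Supported m (S.cellTest φ m) := by
  filter_upwards [S.eventually_inner hφ] with m hm n σ hne
  exact hm n 0 σ σ (fun m => (S.M m).center) ((S.M m).center_mem_cell _) (by simp) hne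

/-- The discrete potential energy balance: the mass equation tested against `h φ`. -/
lemma potential_balance {m : ℕ} (hm : S.Supported m (S.cellTest φ m)) (n : ℕ) :
    ∑ K ∈ (S.M m).cells, (S.M m).cellArea K *
        ((S.h m (n + 1) K ^ 2 - S.h m n K ^ 2) * S.cellTest φ m n K) =
      2 * (S.τ m * S.work φ m n) + ∑ K ∈ (S.M m).cells, (S.M m).cellArea K *
        ((S.h m (n + 1) K - S.h m n K) ^ 2 * S.cellTest φ m n K) := by
  have h1 : ∀ i, ∑ σ ∈ (S.M m).cells, (S.M m).massFlux (S.h m n) (S.u m n) i σ *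
      (S.h m n σ * S.cellTest φ m n σ - S.h m n (σ - e i) * S.cellTest φ m n (σ - e i)) =
      -∑ K ∈ (S.M m).cells, ((S.M m).massFlux (S.h m n) (S.u m n) i (K + e i) -
        (S.M m).massFlux (S.h m n) (S.u m n) i K) * (S.h m n K * S.cellTest φ m n K) := fun i => by
    rw [S.sum_div_mul (w := fun K => S.h m n K * S.cellTest φ m n K) _ i
      fun σ hσ => (hm n σ (right_ne_zero_of_mul hσ)).2, neg_neg]
  rw [work, Finset.sum_congr rfl fun i _ => h1 i, Finset.sum_neg_distrib, Finset.sum_comm,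
    ← sub_eq_iff_eq_add, ← Finset.sum_sub_distrib, mul_neg, mul_neg, Finset.mul_sum,
    Finset.mul_sum, ← Finset.sum_neg_distrib]
  refine Finset.sum_congr rfl fun K hK => ?_
  rw [← Finset.sum_mul]
  by_cases h0 : S.cellTest φ m n K = 0
  · rw [h0]; ring
  · have h2 := S.mass_mul (n := n) (by have := (hm n K h0).1; omega) hK
    linear_combination (2 * S.h m n K * S.cellTest φ m n K) * h2

lemma sum_cellArea (m : ℕ) : ∑ K ∈ (S.M m).cells, (S.M m).cellArea K = (volume Ω).toReal := by
  have := S.finite_Ω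
  have h1 := ((S.M m).sum_cell_eq_integral (fun _ => 1)).2 (fun _ => 1)
    (by rw [S.domain_eq m]; exact integrable_const _)
  simp only [mul_one, S.domain_eq m, setIntegral_const, smul_eq_mul] at h1
  rw [← Measure.real, ← h1]
  refine Finset.sum_congr rfl fun K _ => ?_
  rw [Measure.real, (S.M m).volume_cell, ENNReal.toReal_ofReal ((S.M m).cellArea_pos K).le, one_mul]

lemma τ_massFlux_le {m : ℕ} {K : Fin 2 → ℤ} (hK : K ∈ (S.M m).cells) (n : ℕ) (i : Fin 2) :
    |S.τ m * (S.M m).massFlux (S.h m n) (S.u m n) i K| ≤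
        S.cfl m * S.C ^ 2 * (S.M m).cellArea K ∧
      |S.τ m * (S.M m).massFlux (S.h m n) (S.u m n) i (K + e i)| ≤
        S.cfl m * S.C ^ 2 * (S.M m).cellArea K := by
  have key : ∀ F, |F| ≤ (S.M m).edgeLen i K * S.C ^ 2 →
      |S.τ m * F| ≤ S.cfl m * S.C ^ 2 * (S.M m).cellArea K := by
    intro F hF
    rw [abs_mul, abs_of_pos (S.τ_pos m), cellArea_eq _ i]
    refine (mul_le_mul (S.τ_le hK i) hF (abs_nonneg _)
      ((S.τ_pos m).le.trans (S.τ_le hK i))).trans (le_of_eq ?_)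
    rw [edgeLen]; ring
  refine ⟨key _ (S.massFlux_le i m n K), key _ ?_⟩
  have := S.massFlux_le i m n (K + e i)
  simpa [edgeLen, e_ne (one_sub_ne i)] using this

lemma τ_work_le {L : ℝ} (hL : ∀ q, |φ q| ≤ L) (m n : ℕ) :
    |S.τ m * S.work φ m n| ≤ S.cfl m * (S.C ^ 2 * (2 * (S.C * L + S.C * L)) * (volume Ω).toReal) := by
  have h1 : ∀ i : Fin 2, |∑ σ ∈ (S.M m).cells, S.τ m * ((S.M m).massFlux (S.h m n) (S.u m n) i σ *
      (S.h m n σ * S.cellTest φ m n σ - S.h m n (σ - e i) * S.cellTest φ m n (σ - e i)))| ≤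
      S.cfl m * S.C ^ 2 * (S.C * L + S.C * L) * (volume Ω).toReal := fun i => by
    refine (Finset.abs_sum_le_sum_abs _ _).trans ?_
    rw [← S.sum_cellArea m, Finset.mul_sum]
    refine Finset.sum_le_sum fun σ hσ => ?_
    rw [← mul_assoc]
    refine (abs_mul_le_mul (S.τ_massFlux_le hσ n i).1 ((abs_sub _ _).trans (add_le_add
      (abs_mul_le_mul (S.h_abs_le _ _ _) (hL _)) (abs_mul_le_mul (S.h_abs_le _ _ _) (hL _))))).trans
      (le_of_eq (by ring))
  rw [work, Finset.mul_sum]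
  simp only [Finset.mul_sum (s := (S.M m).cells)]
  refine (Finset.abs_sum_le_sum_abs _ _).trans ((Finset.sum_le_sum fun i _ => h1 i).trans
    (le_of_eq ?_))
  simp; ring

/-- The increment of the height in one time step is of the order of the ratio of the time step to
the mesh size. -/
lemma abs_sub_le_cfl {m n : ℕ} (hn : n + 1 < S.N m) {K : Fin 2 → ℤ} (hK : K ∈ (S.M m).cells) :
    |S.h m (n + 1) K - S.h m n K| ≤ 4 * S.cfl m * S.C ^ 2 := by
  have hA := (S.M m).cellArea_pos K
  have h1 := S.mass_mul hn hK
  obtain ⟨a1, a2⟩ := S.τ_massFlux_le hK n 0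
  obtain ⟨a3, a4⟩ := S.τ_massFlux_le hK n 1
  rw [Fin.sum_univ_two] at h1
  have h2 : |(S.M m).cellArea K * (S.h m (n + 1) K - S.h m n K)| ≤
      4 * S.cfl m * S.C ^ 2 * (S.M m).cellArea K := by
    rw [abs_le] at *
    constructor <;> linarith
  rw [abs_mul, abs_of_pos hA, mul_comm] at h2
  exact le_of_mul_le_mul_right h2 hA

/-- The error made in the discrete potential energy balance. -/
noncomputable def rem (φ : (Fin 2 → ℝ) × ℝ → ℝ) (m : ℕ) : ℝ :=
  ∑ n ∈ Finset.range (S.N m), ∑ K ∈ (S.M m).cells, (S.M m).cellArea K *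
    ((S.h m (n + 1) K - S.h m n K) ^ 2 * S.cellTest φ m n K)

lemma rem_le {L : ℝ} (hL : ∀ q, |φ q| ≤ L) {m : ℕ} (hm : S.Supported m (S.cellTest φ m)) {V : ℝ}
    (hV : ∑ n ∈ Finset.range (S.N m - 1), ∑ K ∈ (S.M m).cells,
      (S.M m).cellArea K * |S.h m (n + 1) K - S.h m n K| ≤ V) (hcfl : 0 ≤ S.cfl m) :
    |S.rem φ m| ≤ S.cfl m * (4 * S.C ^ 2 * L * V) := by
  have hL0 : 0 ≤ L := (abs_nonneg _).trans (hL 0)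
  have h1 : S.rem φ m = ∑ n ∈ Finset.range (S.N m - 1), ∑ K ∈ (S.M m).cells, (S.M m).cellArea K *
      ((S.h m (n + 1) K - S.h m n K) ^ 2 * S.cellTest φ m n K) := by
    refine (Finset.sum_subset (Finset.range_subset_range.2 (Nat.sub_le _ _)) fun n _ hn => ?_).symm
    refine Finset.sum_eq_zero fun K _ => ?_
    by_cases h0 : S.cellTest φ m n K = 0
    · rw [h0]; ring
    · have := (hm n K h0).1
      simp only [Finset.mem_range] at hn
      omega
  have hc : 0 ≤ 4 * S.cfl m * S.C ^ 2 * L := by positivity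
  rw [h1]
  refine (Finset.abs_sum_le_sum_abs _ _).trans ?_
  refine le_trans ?_ ((mul_le_mul_of_nonneg_left hV hc).trans (le_of_eq (by ring)))
  rw [Finset.mul_sum]
  refine Finset.sum_le_sum fun n hn => (Finset.abs_sum_le_sum_abs _ _).trans ?_
  rw [Finset.mul_sum]
  refine Finset.sum_le_sum fun K hK => ?_
  have hA := (S.M m).cellArea_pos K
  have hn' : n + 1 < S.N m := by have := Finset.mem_range.1 hn; omega
  have h2 := S.abs_sub_le_cfl hn' hK
  have h3 : |(S.M m).cellArea K * ((S.h m (n + 1) K - S.h m n K) ^ 2 * S.cellTest φ m n K)| =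
      |S.h m (n + 1) K - S.h m n K| * |S.cellTest φ m n K| *
        ((S.M m).cellArea K * |S.h m (n + 1) K - S.h m n K|) := by
    rw [abs_mul, abs_mul, abs_pow, abs_of_pos hA]; ring
  rw [h3]
  exact mul_le_mul_of_nonneg_right (mul_le_mul h2 (hL _) (abs_nonneg _)
    ((abs_nonneg _).trans h2)) (by positivity)

/-- Upwinding of the mass fluxes dissipates potential energy. -/
lemma work_le (hg : 0 ≤ g) (hφ0 : ∀ x t, 0 ≤ t → 0 ≤ φ (x, t)) (m n : ℕ) :
    g * S.work φ m n ≤ ∑ i, ∑ σ ∈ (S.M m).cells,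
      ((S.M m).edgeLen i σ * (1 / 2 * g * S.h m n σ ^ 2 - 1 / 2 * g * S.h m n (σ - e i) ^ 2) *
          S.u m n i σ * S.edgeTest φ i m n σ +
        g * ((S.M m).edgeLen i σ * (S.flux i m n σ *
          (S.h m n σ * (S.cellTest φ m n σ - S.edgeTest φ i m n σ) - S.h m n (σ - e i) *
              (S.cellTest φ m n (σ - e i) - S.edgeTest φ i m n σ))))) := by
  rw [work, Finset.mul_sum]
  refine Finset.sum_le_sum fun i _ => ?_
  rw [Finset.mul_sum]
  refine Finset.sum_le_sum fun σ _ => ?_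
  have hl : 0 < (S.M m).edgeLen i σ := (S.M m).len_pos _ _
  have hφe : 0 ≤ S.edgeTest φ i m n σ := hφ0 _ _ (mul_nonneg n.cast_nonneg (S.τ_pos m).le)
  rw [massFlux_eq, flux, ← sub_nonneg]
  split_ifs with hu
  · have h1 : 0 ≤ 1 / 2 * g * (S.M m).edgeLen i σ * S.edgeTest φ i m n σ * S.u m n i σ *
        (S.h m n σ - S.h m n (σ - e i)) ^ 2 := by positivity
    refine h1.trans (le_of_eq (by ring))
  · have hu' : 0 ≤ -S.u m n i σ := by linarith
    have h1 : 0 ≤ 1 / 2 * g * (S.M m).edgeLen i σ * S.edgeTest φ i m n σ * -S.u m n i σ *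
        (S.h m n σ - S.h m n (σ - e i)) ^ 2 := by positivity
    refine h1.trans (le_of_eq (by ring))

/-- The kinetic energy balance on the dual meshes, tested against a test function. -/
noncomputable def kinetic (φ : (Fin 2 → ℝ) × ℝ → ℝ) (m : ℕ) : ℝ :=
  ∑ i, ∑ n ∈ Finset.range (S.N m), ∑ σ ∈ (S.M m).cells,
    ((S.M m).dualArea i σ * ((S.M m).dualHeight i (S.h m (n + 1)) σ *
          (S.u m (n + 1) i σ ^ 2 / 2) -
        (S.M m).dualHeight i (S.h m n) σ * (S.u m n i σ ^ 2 / 2)) +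
      S.τ m * ∑ j, (S.dualTransport (fun x => x ^ 2 / 2) i j m n σ -
        S.dualTransport (fun x => x ^ 2 / 2) i j m n (σ - e j))) *
    S.edgeTest φ i m (n + 1) σ

/-- The work of the topography, tested against a test function. -/
noncomputable def topographyWork (φ : (Fin 2 → ℝ) × ℝ → ℝ) (m : ℕ) : ℝ :=
  ∑ i, ∑ n ∈ Finset.range (S.N m), ∑ σ ∈ (S.M m).cells,
    S.τ m * (S.M m).dualArea i σ * (g * centeredHeight i (S.h m (n + 1)) σ * S.DZ m i σ *
      S.u m (n + 1) i σ * S.edgeTest φ i m (n + 1) σ)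

/-- The time variation of the squared height, tested against a test function. -/
noncomputable def potential (φ : (Fin 2 → ℝ) × ℝ → ℝ) (m : ℕ) : ℝ :=
  ∑ n ∈ Finset.range (S.N m), ∑ K ∈ (S.M m).cells, (S.M m).cellArea K *
    ((S.h m (n + 1) K ^ 2 - S.h m n K ^ 2) * S.cellTest φ m n K)

/-- The discrete counterpart of the integral of `h² u · ∇φ`, as in `sumLim_pressureWork`. -/
noncomputable def pressureWork (φ : (Fin 2 → ℝ) × ℝ → ℝ) (m : ℕ) : ℝ :=
  ∑ i, ∑ n ∈ Finset.range (S.N m), ∑ σ ∈ (S.M m).cells,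
    S.τ m * ((S.M m).edgeLen i σ * (S.flux i m (n + 1) σ *
      (S.h m (n + 1) σ * (S.cellTest φ m (n + 1) σ - S.edgeTest φ i m (n + 1) σ) -
        S.h m (n + 1) (σ - e i) *
          (S.cellTest φ m (n + 1) (σ - e i) - S.edgeTest φ i m (n + 1) σ))))

/-- The discrete counterpart of the left-hand side of the entropy inequality. -/
lemma sumLim_entropy (hφ : IsTest Ω T φ) :
    SumLim (volume.restrict (Ω ×ˢ Ioo 0 T)) (volume.restrict Ω)
      (fun m => S.kinetic φ m + S.topographyWork φ m + 1 / 2 * g * S.potential φ m -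
        g * S.pressureWork φ m)
      (fun q => -(entropy g (hbar q) (fun i => ubar i q) (z q.1) * dt φ q
          + ∑ k, entropyFlux g (hbar q) (fun i => ubar i q) (z q.1) k * dx k φ q))
      (fun x => -(entropy g (h₀ x) (fun i => u₀ i x) (z x) * φ (x, 0))) := by
  have h1 := SumLim.sum (s := Finset.univ) fun i _ =>
    S.sumLim_transport hφ (f := fun x => x ^ 2 / 2) (by fun_prop) i
  have h2 := SumLim.sum (s := Finset.univ) fun i _ =>
    S.sumLim_topography hφ (f := fun x => x) continuous_id i
  have hCC : ∀ m n σ, |S.h m n σ ^ 2| ≤ S.C ^ 2 := fun m n σ => by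
    rw [abs_pow]; exact pow_le_pow_left₀ (abs_nonneg _) (S.h_abs_le _ _ _) 2
  have h3 := S.sumLim_time hφ (s := 0) (j := 0) (B := S.C ^ 2) (B' := 1)
    (a := fun m n σ => S.h m n σ ^ 2) (A := fun q => hbar q ^ 2) (A₀ := fun x => h₀ x ^ 2)
    (c := fun _ _ => 1) (cb := fun _ => 1) (p := fun m => (S.M m).center)
    (by simp) (fun m => (S.M m).center_mem_cell) hCC (by simp)
    (fun q hq => (hq.h_conv.mono (by simp)).comp (continuous_pow 2))
    (fun x hx => (hx.h_conv.mono (by simp)).comp (continuous_pow 2))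
    (fun x _ => LocTendsto.const 1)
  have h4 := SumLim.sum (s := Finset.univ) fun i _ => S.sumLim_pressureWork hφ i
  -- the mass equation tested against `g z φ` turns the work of the topography into a time
  -- derivative
  have h5 := S.mass_identity hφ (c := S.Z) (Dc := S.DZ) (cb := z) (cd := fun k => pd k z)
    S.Z_bound S.DZ_bound S.Z_sub S.Z_conv S.DZ_conv
  refine ((((h1.add h2).add (h3.const_mul (1 / 2 * g))).add (h4.const_mul (-g))).add
    (h5.const_mul (-g))).congr (Eventually.of_forall fun m => ?_) (fun q => ?_) (fun x => ?_)
  · simp only [add_zero, mul_one, mul_zero]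
    rw [kinetic, topographyWork, potential, pressureWork, sub_eq_add_neg, neg_mul]
    rfl
  · simp only [entropy, entropyFlux, Fin.sum_univ_two]
    ring
  · simp only [entropy, Fin.sum_univ_two]
    ring

/-- The work of the pressure gradient, tested against a test function. -/
noncomputable def pressurePower (φ : (Fin 2 → ℝ) × ℝ → ℝ) (m : ℕ) : ℝ :=
  ∑ i, ∑ n ∈ Finset.range (S.N m), ∑ σ ∈ (S.M m).cells,
    S.τ m * ((S.M m).edgeLen i σ *
      (1 / 2 * g * S.h m (n + 1) σ ^ 2 - 1 / 2 * g * S.h m (n + 1) (σ - e i) ^ 2) *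
        S.u m (n + 1) i σ * S.edgeTest φ i m (n + 1) σ)

lemma kinetic_le (hφ0 : ∀ x t, 0 ≤ t → 0 ≤ φ (x, t)) {m : ℕ}
    (he : ∀ i, S.Supported m (fun n => S.edgeTest φ i m (n + 1)))
    (hcfl : 8 * S.cfl m * S.C ^ 2 ≤ 1 / S.C) :
    S.kinetic φ m + S.topographyWork φ m + S.pressurePower φ m ≤ 0 := by
  rw [kinetic, topographyWork, pressurePower, ← Finset.sum_add_distrib, ← Finset.sum_add_distrib]
  refine Finset.sum_nonpos fun i _ => ?_
  rw [← Finset.sum_add_distrib, ← Finset.sum_add_distrib]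
  refine Finset.sum_nonpos fun n _ => ?_
  rw [← Finset.sum_add_distrib, ← Finset.sum_add_distrib]
  refine Finset.sum_nonpos fun σ _ => ?_
  by_cases h0 : S.edgeTest φ i m (n + 1) σ = 0
  · rw [h0]; simp
  obtain ⟨hn, hin⟩ := he i n σ h0
  have h1 := S.kinetic_ineq hcfl (n := n) (by omega) (hin.mem_intEdges i)
  have h2 : 0 ≤ S.edgeTest φ i m (n + 1) σ :=
    hφ0 _ _ (mul_nonneg (Nat.cast_nonneg _) (S.τ_pos m).le)
  refine le_trans (le_of_eq ?_) (mul_nonpos_of_nonneg_of_nonpos h2 h1)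
  ring

lemma sum_work_le (hg : 0 ≤ g) (hφ0 : ∀ x t, 0 ≤ t → 0 ≤ φ (x, t)) (m : ℕ) :
    g * ∑ n ∈ Finset.range (S.N m), S.τ m * S.work φ m (n + 1) ≤
      S.pressurePower φ m + g * S.pressureWork φ m := by
  have h1 : ∀ n, g * (S.τ m * S.work φ m (n + 1)) ≤ _ := fun n =>
    (mul_left_comm _ _ _).trans_le
      (mul_le_mul_of_nonneg_left (S.work_le hg hφ0 m (n + 1)) (S.τ_pos m).le)
  rw [Finset.mul_sum]
  refine (Finset.sum_le_sum fun n _ => h1 n).trans (le_of_eq ?_)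
  rw [pressurePower, pressureWork, Finset.mul_sum, ← Finset.sum_add_distrib]
  simp only [Finset.mul_sum (s := Finset.univ)]
  rw [Finset.sum_comm]
  refine Finset.sum_congr rfl fun i _ => ?_
  rw [Finset.mul_sum, ← Finset.sum_add_distrib]
  refine Finset.sum_congr rfl fun n _ => ?_
  rw [Finset.mul_sum, Finset.mul_sum, ← Finset.sum_add_distrib]
  refine Finset.sum_congr rfl fun σ _ => ?_
  ring

lemma potential_eq {m : ℕ} (hc : S.Supported m (S.cellTest φ m)) :
    S.potential φ m = 2 * (∑ n ∈ Finset.range (S.N m), S.τ m * S.work φ m (n + 1) +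
      S.τ m * S.work φ m 0) + S.rem φ m := by
  have hz : S.work φ m (S.N m) = 0 := by
    have hz' : ∀ K, S.cellTest φ m (S.N m) K = 0 := fun K => by
      by_contra h
      have := (hc _ _ h).1
      omega
    simp [work, hz']
  rw [potential, Finset.sum_congr rfl fun n _ => S.potential_balance hc n, Finset.sum_add_distrib,
    ← Finset.mul_sum, rem, ← Finset.sum_range_succ' (fun n => S.τ m * S.work φ m n),
    Finset.sum_range_succ, hz, mul_zero, add_zero]

/-- The discrete entropy inequality, up to the error of the potential energy balance. -/
lemma entropy_ineq_discrete (hg : 0 ≤ g) (hφ0 : ∀ x t, 0 ≤ t → 0 ≤ φ (x, t)) {m : ℕ}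
    (hc : S.Supported m (S.cellTest φ m))
    (he : ∀ i, S.Supported m (fun n => S.edgeTest φ i m (n + 1)))
    (hcfl : 8 * S.cfl m * S.C ^ 2 ≤ 1 / S.C) :
    S.kinetic φ m + S.topographyWork φ m + 1 / 2 * g * S.potential φ m - g * S.pressureWork φ m
      ≤ g * (S.τ m * S.work φ m 0) + 1 / 2 * g * S.rem φ m := by
  have h1 := S.kinetic_le hφ0 he hcfl
  have h2 := S.sum_work_le hg hφ0 m
  rw [S.potential_eq hc]
  linarith

include S in
/-- If the ratio of the time step to the mesh size tends to zero and the total variation in time of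
the heights is bounded, the limit satisfies the entropy inequality. -/
theorem isWeakEntropy (hg : 0 ≤ g) (hz : Continuous z)
    (hτ : Tendsto (fun m => S.τ m / (S.M m).size) atTop (𝓝 0))
    (hV : ∃ V, ∀ m, ∑ n ∈ Finset.range (S.N m - 1), ∑ K ∈ (S.M m).cells,
      (S.M m).cellArea K * |S.h m (n + 1) K - S.h m n K| ≤ V)
    (hw : IsWeakSolution Ω T g z h₀ u₀ hbar ubar) (hu₀ : ∀ i, IntegrableOn (u₀ i) Ω)
    (hbar_int : IntegrableOn hbar (Ω ×ˢ Ioo 0 T))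
    (ubar_int : ∀ i, IntegrableOn (ubar i) (Ω ×ˢ Ioo 0 T)) :
    IsWeakEntropy Ω T g z h₀ u₀ hbar ubar := by
  have hzb : ∀ x ∈ Ω, |z x| ≤ S.C := fun x hx =>
    le_of_tendsto (S.Z_conv x hx (S.idx x) (by simp [idx])).abs
      (Eventually.of_forall fun m => S.Z_bound _ _)
  have i1 : IntegrableOn (fun q => entropy g (hbar q) (fun i => ubar i q) (z q.1))
      (Ω ×ˢ Ioo 0 T) := by
    have a1 := integrable_finsetSum Finset.univ fun i _ => hw.integrable_huu i i
    have a2 : IntegrableOn (fun q => z q.1 * hbar q) (Ω ×ˢ Ioo 0 T) := by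
      refine hbar_int.bdd_mul (c := S.C) (by fun_prop) ?_
      filter_upwards [S.ae_regularAt] with q hq using hzb _ hq.mem.1
    refine (((a1.const_mul (1 / 2)).add (hw.integrable_h_sq.const_mul (1 / 2 * g))).add
      (a2.const_mul g)).congr (Eventually.of_forall fun q => ?_)
    simp only [entropy, Pi.add_apply, Fin.sum_univ_two]
    ring
  have i0 : IntegrableOn (fun x => entropy g (h₀ x) (fun i => u₀ i x) (z x)) Ω := by
    have a1 := integrable_finsetSum Finset.univ fun i (_ : i ∈ Finset.univ) =>
      (hw.integrable_h₀u₀ i).bdd_mul (hu₀ i).1 (S.ae_abs_u₀_le i)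
    have a2 : IntegrableOn (fun x => z x * h₀ x) Ω := by
      refine hw.integrable_h₀.bdd_mul (c := S.C) (by fun_prop) ?_
      filter_upwards [S.ae_initRegularAt] with q hq using hzb _ hq.mem
    have a3 := hw.integrable_h₀.bdd_mul hw.integrable_h₀.1 S.ae_abs_h₀_le
    refine (((a1.const_mul (1 / 2)).add (a3.const_mul (1 / 2 * g))).add
      (a2.const_mul g)).congr (Eventually.of_forall fun q => ?_)
    simp only [entropy, Pi.add_apply, Fin.sum_univ_two]
    ring
  refine ⟨i1, fun k => ?_, i0, fun φ hφ hφ0 => ?_⟩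
  · refine ((i1.add (hw.integrable_h_sq.const_mul (1 / 2 * g))).bdd_mul (ubar_int k).1
      (S.ae_abs_ubar_le k)).congr (Eventually.of_forall fun q => ?_)
    simp only [entropyFlux, Pi.add_apply]
    ring
  · have hlim := (S.sumLim_entropy hφ).tendsto
    rw [integral_neg, integral_neg, ← sub_eq_add_neg] at hlim
    obtain ⟨L, hL0, hLφ, hLip⟩ := hφ.exists_bound
    obtain ⟨V, hV⟩ := hV
    have hcfl : Tendsto S.cfl atTop (𝓝 0) := by
      have h := hτ.const_mul S.C
      rwa [mul_zero] at h
    have hc1 : Tendsto (fun m => 8 * S.cfl m * S.C ^ 2) atTop (𝓝 0) := by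
      simpa using (hcfl.const_mul 8).mul_const (S.C ^ 2)
    set A := g * (S.C ^ 2 * (2 * (S.C * L + S.C * L)) * (volume Ω).toReal) +
      1 / 2 * g * (4 * S.C ^ 2 * L * V) with hA
    have hb : Tendsto (fun m => S.cfl m * A) atTop (𝓝 0) := by simpa using hcfl.mul_const A
    refine le_of_tendsto_of_tendsto hlim hb ?_
    filter_upwards [S.cellTest_supported hφ, eventually_all.2 fun i => S.edgeTest_supported hφ i,
      hc1.eventually (ge_mem_nhds (one_div_pos.2 S.C_pos))] with m hc he hcm
    refine (S.entropy_ineq_discrete hg hφ0 hc he hcm).trans ?_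
    have hcfl0 : 0 ≤ S.cfl m := by
      refine mul_nonneg S.C_pos.le (div_nonneg (S.τ_pos m).le (Real.sSup_nonneg ?_))
      rintro _ ⟨K, _, rfl⟩
      exact Real.sqrt_nonneg _
    have b1 := mul_le_mul_of_nonneg_left ((le_abs_self _).trans (S.τ_work_le hLφ m 0)) hg
    have b2 := mul_le_mul_of_nonneg_left ((le_abs_self _).trans (S.rem_le hLφ hc (hV m) hcfl0))
      (by positivity : 0 ≤ 1 / 2 * g)
    rw [hA]
    linarith

end ConvergentScheme

/-! ### The discrete topography -/

namespace MACGrid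

lemma isCompact_closedCell (M : MACGrid) (K : Fin 2 → ℤ) : IsCompact (M.closedCell K) := by
  rw [closedCell_eq_Icc]; exact isCompact_Icc

lemma isBounded_domain (M : MACGrid) : Bornology.IsBounded M.domain :=
  (M.cells.isCompact_biUnion fun K _ => M.isCompact_closedCell K).isBounded.subset interior_subset

lemma closedCell_subset_closure_domain (M : MACGrid) {K : Fin 2 → ℤ} (hK : K ∈ M.cells) :
    M.closedCell K ⊆ closure M.domain := by
  have h1 : interior (M.closedCell K) ⊆ M.domain :=
    interior_mono (subset_biUnion_of_mem (u := fun K => M.closedCell K) hK)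
  have h2 : Convex ℝ (M.closedCell K) := by
    rw [closedCell_eq_Icc]; exact convex_Icc _ _
  have h3 : M.center K ∈ interior (M.closedCell K) := by
    rw [closedCell_eq_Icc, ← pi_univ_Icc, interior_pi_set finite_univ]
    intro k _
    change _ ∈ interior (Icc _ _)
    rw [interior_Icc]
    have := M.len_pos k (K k)
    unfold len at this
    constructor <;> simp only [MACGrid.center] <;> linarith
  refine subset_closure.trans ?_
  rw [← h2.closure_interior_eq_closure_of_nonempty_interior ⟨_, h3⟩]
  exact closure_mono h1

lemma cell_ae_eq (M : MACGrid) (K : Fin 2 → ℤ) : M.cell K =ᵐ[volume] M.closedCell K := by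
  rw [cell_eq_pi, closedCell_eq_Icc]
  exact Measure.univ_pi_Ico_ae_eq_Icc

lemma volume_real_cell (M : MACGrid) (K : Fin 2 → ℤ) : volume.real (M.cell K) = M.cellArea K := by
  rw [Measure.real, M.volume_cell, ENNReal.toReal_ofReal (M.cellArea_pos K).le]

/-- The mass center is the mean of the coordinates, by symmetry. -/
lemma setIntegral_linear_sub_center (M : MACGrid) (K : Fin 2 → ℤ) (D : (Fin 2 → ℝ) →L[ℝ] ℝ) :
    ∫ y in M.cell K, D (y - M.center K) = 0 := by
  rw [setIntegral_congr_set (M.cell_ae_eq K)]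
  have h1 := (Measure.measurePreserving_sub_left (volume : Measure (Fin 2 → ℝ))
    ((2 : ℝ) • M.center K)).setIntegral_preimage_emb
      (Homeomorph.subLeft ((2 : ℝ) • M.center K)).measurableEmbedding
      (fun y => D (y - M.center K)) (M.closedCell K)
  have h2 : (fun y => (2 : ℝ) • M.center K - y) ⁻¹' M.closedCell K = M.closedCell K := by
    ext y
    simp only [closedCell, mem_preimage, mem_ofPred_eq, Pi.sub_apply, Pi.smul_apply, smul_eq_mul,
      MACGrid.center, mem_Icc]
    refine forall_congr' fun k => ?_
    constructor <;> rintro ⟨h, h'⟩ <;> constructor <;> linarith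
  have h3 : ∀ y, D ((2 : ℝ) • M.center K - y - M.center K) = -D (y - M.center K) := fun y => by
    rw [← map_neg]; congr 1; rw [two_smul]; abel
  rw [h2] at h1
  simp only [h3, integral_neg] at h1
  linarith

/-- If `z` differs from an affine function by at most `ε` times the distance on the cell `K`, its
mean value over `K` differs by at most `ε` times the mesh size from its value at the center. -/
lemma abs_average_sub_le (M : MACGrid) {K : Fin 2 → ℤ} (hK : K ∈ M.cells) {z : (Fin 2 → ℝ) → ℝ}
    (hz : Continuous z) (D : (Fin 2 → ℝ) →L[ℝ] ℝ) {ε : ℝ} (hε : 0 ≤ ε)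
    (h : ∀ y ∈ M.cell K, |z y - z (M.center K) - D (y - M.center K)| ≤ ε * dist y (M.center K)) :
    |(⨍ y in M.cell K, z y) - z (M.center K)| ≤ ε * M.size := by
  have hA := M.cellArea_pos K
  have hfin : volume (M.cell K) < ⊤ := by rw [M.volume_cell]; exact ENNReal.ofReal_lt_top
  have hint : ∀ f : (Fin 2 → ℝ) → ℝ, Continuous f → IntegrableOn f (M.cell K) := fun f hf =>
    (hf.continuousOn.integrableOn_compact (M.isCompact_closedCell K)).mono_set
      (M.cell_subset_closedCell K)
  have h1 : ‖∫ y in M.cell K, (z y - z (M.center K) - D (y - M.center K))‖ ≤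
      ε * M.size * volume.real (M.cell K) :=
    norm_setIntegral_le_of_norm_le_const hfin fun y hy =>
      (h y hy).trans (mul_le_mul_of_nonneg_left (M.dist_le_size hK (M.cell_subset_closedCell K hy)
        (M.cell_subset_closedCell K (M.center_mem_cell K))) hε)
  rw [integral_sub (hint _ (by fun_prop)) (hint _ (by fun_prop)),
    integral_sub (hint _ (by fun_prop)) (hint _ (by fun_prop)), M.setIntegral_linear_sub_center,
    setIntegral_const, sub_zero, smul_eq_mul, M.volume_real_cell, Real.norm_eq_abs] at h1
  rw [setAverage_eq, M.volume_real_cell, smul_eq_mul]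
  have h2 : (M.cellArea K)⁻¹ * (∫ y in M.cell K, z y) - z (M.center K) =
      (M.cellArea K)⁻¹ * ((∫ y in M.cell K, z y) - M.cellArea K * z (M.center K)) := by
    field_simp
  rw [h2, abs_mul, abs_of_pos (inv_pos.2 hA), inv_mul_le_iff₀ hA, mul_comm (M.cellArea K) (ε * M.size)]
  exact h1

end MACGrid

/-- A `C¹` function is bounded and Lipschitz continuous on a bounded set. -/
lemma exists_bound_lipschitz_of_contDiff {E : Type*} [NormedAddCommGroup E] [NormedSpace ℝ E]
    [ProperSpace E] {z : E → ℝ} (hz : ContDiff ℝ 1 z) {s : Set E} (hs : Bornology.IsBounded s) :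
    ∃ B : ℝ, 0 ≤ B ∧ (∀ x ∈ s, |z x| ≤ B) ∧ ∀ x ∈ s, ∀ y ∈ s, |z x - z y| ≤ B * dist x y := by
  obtain ⟨R, hR⟩ := hs.subset_closedBall 0
  have hc := isCompact_closedBall (0 : E) R
  obtain ⟨B₁, hB₁⟩ := hc.exists_bound_of_continuousOn hz.continuous.continuousOn
  obtain ⟨B₂, hB₂⟩ := hc.exists_bound_of_continuousOn (hz.continuous_fderiv one_ne_zero).continuousOn
  have hB : B₂ ≤ max B₁ (max B₂ 0) := (le_max_left _ _).trans (le_max_right _ _)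
  refine ⟨max B₁ (max B₂ 0), (le_max_right _ _).trans (le_max_right _ _), fun x hx =>
    (hB₁ x (hR hx)).trans (le_max_left _ _), fun x hx y hy => ?_⟩
  rw [dist_eq_norm]
  exact (convex_closedBall (0 : E) R).norm_image_sub_le_of_norm_fderiv_le
    (fun x _ => hz.differentiable one_ne_zero x) (fun x hx => (hB₂ x hx).trans hB) (hR hy) (hR hx)

/-- The discrete topography is consistent with its values at the mass centers, to an order higher
than one. -/
lemma topography_error {Ω : Set (Fin 2 → ℝ)} {M : ℕ → MACGrid}
    (hM : ∀ m, (M m).domain = Ω) (hsize : Tendsto (fun m => (M m).size) atTop (𝓝 0))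
    {z : (Fin 2 → ℝ) → ℝ} (hz : ContDiff ℝ 1 z) {zM : ℕ → (Fin 2 → ℤ) → ℝ}
    (hzM : (∀ m, ∀ K ∈ (M m).cells, zM m K = z ((M m).center K)) ∨
      (∀ m, ∀ K ∈ (M m).cells, zM m K = ⨍ x in (M m).cell K, z x)) :
    (∃ B, 0 ≤ B ∧ ∀ m, ∀ K ∈ (M m).cells, |zM m K - z ((M m).center K)| ≤ B * (M m).size) ∧
    ∀ x ∈ Ω, ∀ r : ℕ, ∀ ε > 0, ∀ᶠ m in atTop, ∀ K : Fin 2 → ℤ, (∀ k, |K k - (M m).idx x k| ≤ r) →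
      |zM m K - z ((M m).center K)| ≤ ε * (M m).size := by
  have hpos : ∀ m, ∀ K ∈ (M m).cells, 0 ≤ (M m).size := fun m K hK =>
    ((M m).len_pos 0 (K 0)).le.trans ((M m).len_le_size hK 0)
  rcases hzM with hzM | hzM
  · refine ⟨⟨0, le_rfl, fun m K hK => by simp [hzM m K hK]⟩, fun x hx r ε hε => ?_⟩
    filter_upwards [MACGrid.eventually_near hM hsize hx r one_pos] with m hm K hK
    have hc := (hm K hK).1
    rw [hzM m K hc, sub_self, abs_zero]
    exact mul_nonneg hε.le (hpos m K hc)
  · constructor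
    · obtain ⟨B, hB0, -, hB⟩ := exists_bound_lipschitz_of_contDiff hz
        (hM 0 ▸ (M 0).isBounded_domain).closure
      have hsub : ∀ m, ∀ K ∈ (M m).cells, (M m).closedCell K ⊆ closure Ω := fun m K hK =>
        hM m ▸ (M m).closedCell_subset_closure_domain hK
      refine ⟨B, hB0, fun m K hK => ?_⟩
      rw [hzM m K hK]
      refine (M m).abs_average_sub_le hK hz.continuous 0 hB0 fun y hy => ?_
      rw [zero_apply, sub_zero]
      exact hB _ (hsub m K hK ((M m).cell_subset_closedCell K hy)) _
        (hsub m K hK ((M m).cell_subset_closedCell K ((M m).center_mem_cell K)))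
    · intro x hx r ε hε
      have h1 := ((hz.contDiffAt (x := x)).hasStrictFDerivAt one_ne_zero).isLittleO.bound hε
      obtain ⟨d, hd, h1⟩ := Metric.eventually_nhds_iff.1 h1
      filter_upwards [MACGrid.eventually_near hM hsize hx r hd] with m hm K hK
      obtain ⟨hc, hp⟩ := hm K hK
      rw [hzM m K hc]
      refine (M m).abs_average_sub_le hc hz.continuous (fderiv ℝ z x) hε.le fun y hy => ?_
      rw [dist_eq_norm]
      refine h1 (y := (y, (M m).center K)) (max_lt ?_ ?_)
      · exact hp _ ((M m).cell_subset_closedCell K hy)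
      · exact hp _ ((M m).cell_subset_closedCell K ((M m).center_mem_cell K))

/-- The discrete topography, extended by zero, and its discrete gradient. -/
lemma exists_discrete_topography {Ω : Set (Fin 2 → ℝ)} {M : ℕ → MACGrid}
    (hM : ∀ m, (M m).domain = Ω) (hsize : Tendsto (fun m => (M m).size) atTop (𝓝 0))
    {C₁ : ℝ} (hC₁ : ∀ m, ∀ K ∈ (M m).cells, ∀ i, (M m).size ≤ C₁ * (M m).len i (K i))
    {z : (Fin 2 → ℝ) → ℝ} (hz : ContDiff ℝ 1 z) {zM : ℕ → (Fin 2 → ℤ) → ℝ}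
    (hzM : (∀ m, ∀ K ∈ (M m).cells, zM m K = z ((M m).center K)) ∨
      (∀ m, ∀ K ∈ (M m).cells, zM m K = ⨍ x in (M m).cell K, z x)) :
    ∃ (C : ℝ) (Z : ℕ → (Fin 2 → ℤ) → ℝ) (DZ : ℕ → Fin 2 → (Fin 2 → ℤ) → ℝ),
      (∀ m, ∀ K ∈ (M m).cells, Z m K = zM m K) ∧ (∀ m K, |Z m K| ≤ C) ∧
      (∀ m i σ, |DZ m i σ| ≤ C) ∧
      (∀ m i, ∀ σ ∈ (M m).intEdges i,
        Z m σ - Z m (σ - e i) = ((M m).center σ i - (M m).center (σ - e i) i) * DZ m i σ) ∧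
      (∀ x ∈ Ω, LocTendsto (fun m => (M m).idx x) 5 Z (z x)) ∧
      ∀ x ∈ Ω, ∀ i, LocTendsto (fun m => (M m).idx x) 5 (fun m => DZ m i) (pd i z x) := by
  classical
  obtain ⟨⟨B, hB0, hB⟩, herr⟩ := topography_error hM hsize hz hzM
  obtain ⟨A, hA0, hA, hLip⟩ :=
    exists_bound_lipschitz_of_contDiff hz
        (hM 0 ▸ (M 0).isBounded_domain).closure
  obtain ⟨D, hD⟩ := hsize.bddAbove_range
  replace hD : ∀ m, (M m).size ≤ D := fun m => hD ⟨m, rfl⟩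
  have hcen : ∀ m, ∀ K ∈ (M m).cells, (M m).center K ∈ closure Ω := fun m K hK =>
    hM m ▸ (M m).closedCell_subset_closure_domain hK
      ((M m).cell_subset_closedCell K ((M m).center_mem_cell K))
  set d : ℕ → Fin 2 → (Fin 2 → ℤ) → ℝ :=
    fun m i σ => (M m).center σ i - (M m).center (σ - e i) i with hd
  have hd0 : ∀ m i σ, 0 < d m i σ := fun m i σ => by
    rw [hd]
    simp only [center_sub_center]
    linarith [(M m).len_pos i (σ i - 1), (M m).len_pos i (σ i)]
  have hdiff : ∀ m i (σ : Fin 2 → ℤ), (M m).center σ - (M m).center (σ - e i) =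
      d m i σ • Pi.single i 1 := fun m i σ => by
    ext k
    by_cases hk : k = i
    · subst hk; simp [hd]
    · simp [hk, MACGrid.center, e_ne hk]
  have hds : ∀ m i, ∀ σ ∈ (M m).intEdges i, (M m).size ≤ C₁ * d m i σ := fun m i σ hσ => by
    obtain ⟨h1, h2⟩ := (M m).mem_intEdges.1 hσ
    have h3 := hC₁ m _ h1 i
    have h4 := hC₁ m _ h2 i
    simp only [Pi.sub_apply, e_same] at h4
    simp only [hd, center_sub_center]
    linarith
  set Z : ℕ → (Fin 2 → ℤ) → ℝ := fun m K => if K ∈ (M m).cells then zM m K else 0 with hZ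
  set DZ : ℕ → Fin 2 → (Fin 2 → ℤ) → ℝ := fun m i σ =>
    if σ ∈ (M m).intEdges i then (zM m σ - zM m (σ - e i)) / d m i σ else 0 with hDZ
  have hpos : ∀ m, ∀ K ∈ (M m).cells, 0 ≤ (M m).size := fun m K hK =>
    ((M m).len_pos 0 (K 0)).le.trans ((M m).len_le_size hK 0)
  refine ⟨max (A + B * |D|) (A + 2 * B * C₁), Z, DZ, fun m K hK => if_pos hK, fun m K => ?_,
    fun m i σ => ?_, fun m i σ hσ => ?_, fun x hx κ hκ => ?_, fun x hx i κ hκ => ?_⟩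
  · refine le_trans ?_ (le_max_left _ _)
    simp only [hZ]
    split_ifs with hK
    · have h1 := hB m K hK
      have h2 := hA _ (hcen m K hK)
      have h3 := mul_le_mul_of_nonneg_left ((hD m).trans (le_abs_self D)) hB0
      have h4 := abs_sub_abs_le_abs_sub (zM m K) (z ((M m).center K))
      linarith
    · rw [abs_zero]; positivity
  · simp only [hDZ]
    split_ifs with hσ
    · refine le_trans ?_ (le_max_right _ _)
      obtain ⟨h1, h2⟩ := (M m).mem_intEdges.1 hσ
      rw [abs_div, abs_of_pos (hd0 m i σ), div_le_iff₀ (hd0 m i σ)]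
      have h3 := hLip _ (hcen m _ h1) _ (hcen m _ h2)
      rw [dist_eq_norm, hdiff, norm_smul, Pi.norm_single, norm_one, mul_one, Real.norm_eq_abs,
        abs_of_pos (hd0 m i σ)] at h3
      have h4 := hB m _ h1
      have h5 := hB m _ h2
      have h6 := mul_le_mul_of_nonneg_left (hds m i σ hσ) hB0
      rw [abs_le] at *
      constructor <;> nlinarith
    · rw [abs_zero]; exact le_max_of_le_left (by positivity)
  · obtain ⟨h1, h2⟩ := (M m).mem_intEdges.1 hσ
    simp only [hZ, hDZ, if_pos hσ, if_pos h1, if_pos h2]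
    rw [mul_div_cancel₀ _ (hd0 m i σ).ne']
  · -- the error is at most the mesh size
    have h1 : Tendsto (fun m => z ((M m).center (κ m))) atTop (𝓝 (z x)) := by
      refine (hz.continuous.tendsto x).comp (Metric.tendsto_nhds.2 fun ε hε => ?_)
      filter_upwards [MACGrid.eventually_near hM hsize hx 5 hε] with m hm
      exact (hm _ (hκ m)).2 _ ((M m).cell_subset_closedCell _ ((M m).center_mem_cell _))
    have h2 : Tendsto (fun m => Z m (κ m) - z ((M m).center (κ m))) atTop (𝓝 0) := by
      refine squeeze_zero_norm' ?_ hsize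
      filter_upwards [herr x hx 5 1 one_pos, MACGrid.eventually_near hM hsize hx 5 one_pos]
        with m hm hm'
      simp only [hZ, if_pos (hm' _ (hκ m)).1]
      simpa using hm _ (hκ m)
    simpa using h2.add h1
  · have hκ' : ∀ m k, |κ m k - (M m).idx x k| ≤ (6 : ℕ) ∧
        |(κ m - e i) k - (M m).idx x k| ≤ (6 : ℕ) := fun m k => by
      have h1 := hκ m k
      rw [abs_le, abs_le]
      rw [abs_le] at h1
      by_cases hk : k = i
      · subst hk; simp only [Pi.sub_apply, e_same]; push_cast at *; omega
      · simp only [Pi.sub_apply, e_ne hk]; push_cast at *; omega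
    have hlim : ∀ K : ℕ → Fin 2 → ℤ, (∀ m k, |K m k - (M m).idx x k| ≤ (6 : ℕ)) →
        Tendsto (fun m => (M m).center (K m)) atTop (𝓝 x) := fun K hK =>
      Metric.tendsto_nhds.2 fun ε hε => by
        filter_upwards [MACGrid.eventually_near hM hsize hx 6 hε] with m hm
        exact (hm _ (hK m)).2 _ ((M m).cell_subset_closedCell _ ((M m).center_mem_cell _))
    have h1 := tendsto_diffQuotient (hz.contDiffAt (x := x)) (hlim _ fun m k => (hκ' m k).2)
      (hlim κ fun m k => (hκ' m k).1) (fun m => (hd0 m i (κ m)).ne') (fun m => hdiff m i (κ m))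
    have h2 : Tendsto (fun m => DZ m i (κ m) -
        (z ((M m).center (κ m)) - z ((M m).center (κ m - e i))) / d m i (κ m)) atTop (𝓝 0) := by
      rw [Metric.tendsto_nhds]
      intro ε hε
      have hε' : 0 < ε / (2 * (|C₁| + 1)) := by positivity
      filter_upwards [herr x hx 6 _ hε', MACGrid.eventually_near hM hsize hx 6 one_pos]
        with m hm hm'
      have hσ : κ m ∈ (M m).intEdges i :=
        (M m).mem_intEdges.2 ⟨(hm' _ fun k => (hκ' m k).1).1, (hm' _ fun k => (hκ' m k).2).1⟩
      have h3 := hm _ fun k => (hκ' m k).1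
      have h4 := hm _ fun k => (hκ' m k).2
      have h5 := hds m i _ hσ
      have h6 := hd0 m i (κ m)
      simp only [hDZ, if_pos hσ]
      rw [dist_zero_right, Real.norm_eq_abs, ← sub_div, abs_div, abs_of_pos h6, div_lt_iff₀ h6]
      have h7 : ε / (2 * (|C₁| + 1)) * (M m).size ≤ ε / (2 * (|C₁| + 1)) * (|C₁| * d m i (κ m)) :=
        mul_le_mul_of_nonneg_left (h5.trans (mul_le_mul_of_nonneg_right (le_abs_self _) h6.le)) hε'.le
      have h8 : 2 * (ε / (2 * (|C₁| + 1)) * (|C₁| * d m i (κ m))) < ε * d m i (κ m) := by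
        have : 2 * (ε / (2 * (|C₁| + 1)) * (|C₁| * d m i (κ m))) =
          ε * d m i (κ m) * (|C₁| / (|C₁| + 1)) := by field_simp
        rw [this]
        refine mul_lt_of_lt_one_right (by positivity) ?_
        rw [div_lt_one (by positivity)]
        linarith
      rw [abs_lt]
      rw [abs_le] at h3 h4
      constructor <;> linarith
    simpa [pd] using h2.add h1

/-! ### Pointwise convergence of the discrete unknowns -/

lemma LocTendsto.of_forall_shift {κ₀ : ℕ → Fin 2 → ℤ} {r : ℕ} {A : ℕ → (Fin 2 → ℤ) → ℝ} {w : ℝ}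
    (h : ∀ s ∈ Fintype.piFinset fun _ : Fin 2 => Finset.Icc (-(r : ℤ)) r,
      Tendsto (fun m => A m (κ₀ m + s)) atTop (𝓝 w)) : LocTendsto κ₀ r A w := by
  intro κ hκ
  rw [Metric.tendsto_nhds]
  intro ε hε
  filter_upwards [(eventually_all_finset _).2 fun s hs => Metric.tendsto_nhds.1 (h s hs) ε hε]
    with m hm
  have := hm (κ m - κ₀ m) (Fintype.mem_piFinset.2 fun k => Finset.mem_Icc.2 (abs_le.1 (hκ m k)))
  rwa [add_sub_cancel] at this

/-- The functions equal to `a m j - w` on the blocks `P m j`. -/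
noncomputable def blockDiff {α ι : Type*} (J : ℕ → Finset ι) (P : ℕ → ι → Set α)
    (a : ℕ → ι → ℝ) (w : α → ℝ) (m : ℕ) (q : α) : ℝ :=
  ∑ j ∈ J m, (P m j).indicator (fun q => a m j - w q) q

section BlockDiff

variable {α ι : Type*} {J : ℕ → Finset ι} {P : ℕ → ι → Set α} {a : ℕ → ι → ℝ} {w : α → ℝ} {m : ℕ}

lemma blockDiff_eq (hP : (J m : Set ι).PairwiseDisjoint (P m)) {j : ι} (hj : j ∈ J m) {q : α}
    (hq : q ∈ P m j) : blockDiff J P a w m q = a m j - w q := by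
  rw [blockDiff, Finset.sum_eq_single_of_mem j hj, indicator_of_mem hq]
  intro k hk hkj
  exact indicator_of_notMem (fun h => disjoint_left.1 (hP hk hj hkj) h hq) _

variable [MeasurableSpace α] {μ : Measure α} [IsFiniteMeasure μ]

lemma integrable_blockDiff (hw : Integrable w μ) (hP : ∀ j ∈ J m, MeasurableSet (P m j)) :
    Integrable (blockDiff J P a w m) μ :=
  integrable_finsetSum _ fun j hj => ((integrable_const _).sub hw).indicator (hP j hj)

lemma integral_abs_blockDiff_le (hw : Integrable w μ) (hP : ∀ j ∈ J m, MeasurableSet (P m j)) :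
    ∫ q, |blockDiff J P a w m q| ∂μ ≤ ∑ j ∈ J m, ∫ q in P m j, |a m j - w q| ∂μ := by
  have hi : ∀ j ∈ J m, Integrable ((P m j).indicator fun q => |a m j - w q|) μ := fun j hj =>
    ((integrable_const _).sub hw).abs.indicator (hP j hj)
  have h1 : ∑ j ∈ J m, ∫ q in P m j, |a m j - w q| ∂μ =
      ∫ q, ∑ j ∈ J m, (P m j).indicator (fun q => |a m j - w q|) q ∂μ := by
    rw [integral_finsetSum _ hi]
    exact Finset.sum_congr rfl fun j hj => (integral_indicator (hP j hj)).symm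
  rw [h1]
  refine integral_mono (integrable_blockDiff hw hP).abs (integrable_finsetSum _ hi) fun q => ?_
  refine (Finset.abs_sum_le_sum_abs _ _).trans (Finset.sum_le_sum fun j _ => le_of_eq ?_)
  by_cases h : q ∈ P m j <;> simp [h]

end BlockDiff

lemma tendsto_integral_abs_of_eLpNorm {α : Type*} [MeasurableSpace α] {μ : Measure α}
    {f : ℕ → α → ℝ} (hf : ∀ m, Integrable (f m) μ)
    (h : Tendsto (fun m => eLpNorm (f m) 1 μ) atTop (𝓝 0)) :
    Tendsto (fun m => ∫ q, |f m q| ∂μ) atTop (𝓝 0) := by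
  refine ((ENNReal.tendsto_toReal ENNReal.zero_ne_top).comp h).congr fun m => ?_
  simp only [Function.comp_apply, eLpNorm_one_eq_lintegral_enorm]
  exact (integral_norm_eq_lintegral_enorm (hf m).1).symm

namespace MACGrid

variable {Ω : Set (Fin 2 → ℝ)} {M : ℕ → MACGrid}

lemma eventually_dist_le (hM : ∀ m, (M m).domain = Ω)
    (hsize : Tendsto (fun m => (M m).size) atTop (𝓝 0))
    {x : Fin 2 → ℝ} (hx : x ∈ Ω) (r : ℕ) :
    ∀ᶠ m in atTop, ∀ L : Fin 2 → ℤ, (∀ k, |L k - (M m).idx x k| ≤ r) →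
      L ∈ (M m).cells ∧ ∀ p ∈ (M m).cell ((M m).idx x), ∀ p' ∈ (M m).cell L,
        dist p p' ≤ (4 * r + 2) * (M m).size := by
  have hΩ : IsOpen Ω := hM 0 ▸ (M 0).isOpen_domain
  obtain ⟨d, hd, hball⟩ := Metric.isOpen_iff.1 hΩ x hx
  have h1' : Tendsto (fun m => 4 * (M m).size * r) atTop (𝓝 0) := by
    simpa using (hsize.const_mul 4).mul_const (r : ℝ)
  filter_upwards [h1'.eventually (gt_mem_nhds hd)] with m hm' L hL
  have hx' : x ∈ (M m).domain := by rw [hM m]; exact hx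
  obtain ⟨hc, hxc⟩ := (M m).idx_spec hx'
  obtain ⟨hLc, y, hy, hd'⟩ := (M m).exists_near r hxc hc
    ((Metric.closedBall_subset_ball hm').trans (by rwa [hM m])) hL
  refine ⟨hLc, fun p hp p' hp' => ?_⟩
  have h2 := (M m).dist_le_size hc ((M m).cell_subset_closedCell _ hp)
    ((M m).cell_subset_closedCell _ hxc)
  have h3 := (M m).dist_le_size hLc ((M m).cell_subset_closedCell _ hy)
    ((M m).cell_subset_closedCell _ hp')
  linarith [dist_triangle4 p x y p']

lemma restrict_domain_restrict (M : MACGrid) {A : Set (Fin 2 → ℝ)} (hA : A ⊆ M.cellUnion)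
    (hAm : MeasurableSet A) : (volume.restrict M.domain).restrict A = volume.restrict A := by
  rw [Measure.restrict_congr_set M.domain_ae_eq, Measure.restrict_restrict hAm,
    inter_eq_left.2 hA]

/-- A family of blocks attached to the cells or to the interior edges of the mesh. The block `D L`
is defined when the cells `L` and `L - t` belong to the mesh, and lies in the union of both. -/
structure Blocks (M : MACGrid) (t : Fin 2 → ℤ) (D : (Fin 2 → ℤ) → Set (Fin 2 → ℝ)) (c : ℝ) :
    Prop where
  measurable : ∀ L, MeasurableSet (D L)
  unique : ∀ {L L' x}, x ∈ D L → x ∈ D L' → L = L'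
  subset : ∀ L, D L ⊆ M.cell (L - t) ∪ M.cell L
  area_le : ∀ K ∈ M.cells, ∀ L ∈ M.cells, L - t ∈ M.cells →
    M.cellArea K ≤ c * volume.real (D L)

lemma blocks_cell (M : MACGrid) {η : ℝ} (hη0 : 0 ≤ η) (hη : M.regularity ≤ η) :
    M.Blocks 0 M.cell (η ^ 4) where
  measurable := M.measurableSet_cell
  unique := M.cell_unique
  subset L := subset_union_right
  area_le K hK L hL _ := by
    rw [M.volume_real_cell]; exact M.cellArea_le_of_regularity hη0 hη hK hL

lemma blocks_dualCell (M : MACGrid) {η : ℝ} (hη0 : 0 ≤ η) (hη : M.regularity ≤ η) (i : Fin 2) :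
    M.Blocks (e i) (M.dualCell i) (η ^ 4) where
  measurable := M.measurableSet_dualCell i
  unique := M.dualCell_unique
  subset := M.dualCell_subset i
  area_le K hK L hL hL' := by
    rw [Measure.real, M.volume_dualCell (M.mem_intEdges.2 ⟨hL, hL'⟩),
      ENNReal.toReal_ofReal (M.dualArea_pos i L).le, dualArea]
    have h1 := M.cellArea_le_of_regularity hη0 hη hK hL
    have h2 := M.cellArea_le_of_regularity hη0 hη hK hL'
    linarith

lemma Blocks.subset_cellUnion {M : MACGrid} {t : Fin 2 → ℤ} {D : (Fin 2 → ℤ) → Set (Fin 2 → ℝ)}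
    {c : ℝ} (hD : M.Blocks t D c) {L : Fin 2 → ℤ} (hL : L ∈ M.cells) (hL' : L - t ∈ M.cells) :
    D L ⊆ M.cellUnion :=
  (hD.subset L).trans (union_subset (M.cell_subset_cellUnion hL') (M.cell_subset_cellUnion hL))

open Classical in
/-- The cells `K` such that the block attached to `K + s` exists and is near `K`. -/
noncomputable def nearCells (M : MACGrid) (D : (Fin 2 → ℤ) → Set (Fin 2 → ℝ)) (t s : Fin 2 → ℤ)
    (r : ℕ) : Finset (Fin 2 → ℤ) :=
  M.cells.filter fun K => K + s ∈ M.cells ∧ K + s - t ∈ M.cells ∧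
    ∀ p ∈ M.cell K, ∀ p' ∈ M.cell K ∪ D (K + s), dist p p' ≤ (4 * r + 2) * M.size

lemma mem_nearCells (M : MACGrid) {D : (Fin 2 → ℤ) → Set (Fin 2 → ℝ)} {t s : Fin 2 → ℤ} {r : ℕ}
    {K : Fin 2 → ℤ} : K ∈ M.nearCells D t s r ↔ K ∈ M.cells ∧ K + s ∈ M.cells ∧
      K + s - t ∈ M.cells ∧
      ∀ p ∈ M.cell K, ∀ p' ∈ M.cell K ∪ D (K + s), dist p p' ≤ (4 * r + 2) * M.size := by
  simp only [nearCells, Finset.mem_filter]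

lemma eventually_mem_nearCells (hM : ∀ m, (M m).domain = Ω)
    (hsize : Tendsto (fun m => (M m).size) atTop (𝓝 0))
    {t : Fin 2 → ℤ} {D : ℕ → (Fin 2 → ℤ) → Set (Fin 2 → ℝ)} {c : ℝ}
    (hD : ∀ m, (M m).Blocks t (D m) c) {s : Fin 2 → ℤ} {r : ℕ}
    (hs : ∀ k, |s k| ≤ r) (hst : ∀ k, |s k - t k| ≤ r) {x : Fin 2 → ℝ} (hx : x ∈ Ω) :
    ∀ᶠ m in atTop, (M m).idx x ∈ (M m).nearCells (D m) t s r := by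
  filter_upwards [eventually_dist_le hM hsize hx r] with m hm
  have h1 := hm ((M m).idx x + s) fun k => by simpa using hs k
  have h2 := hm ((M m).idx x + s - t) fun k => by
    have := hst k
    simp only [Pi.sub_apply, Pi.add_apply]
    rwa [add_sub_assoc, add_sub_cancel_left]
  have h0 := hm ((M m).idx x) fun k => by simp
  refine (M m).mem_nearCells.2 ⟨h0.1, h1.1, h2.1, fun p hp p' hp' => ?_⟩
  rcases hp' with hp' | hp'
  · exact h0.2 p hp p' hp'
  · rcases (hD m).subset _ hp' with h | h
    exacts [h2.2 p hp p' h, h1.2 p hp p' h]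

/-- The values `a m` attached to blocks, assumed to be close to `w` in mean over the blocks,
are close to `w` on neighbouring cells too. -/
lemma exists_blockDiff_init (hM : ∀ m, (M m).domain = Ω)
    (hsize : Tendsto (fun m => (M m).size) atTop (𝓝 0)) (hΩ : volume Ω < ⊤)
    {t : Fin 2 → ℤ} {D : ℕ → (Fin 2 → ℤ) → Set (Fin 2 → ℝ)} {c : ℝ}
    (hD : ∀ m, (M m).Blocks t (D m) c) {w : (Fin 2 → ℝ) → ℝ} (hw : IntegrableOn w Ω)
    {a : ℕ → (Fin 2 → ℤ) → ℝ}
    (ha : ∀ m, ∀ L ∈ (M m).cells, L - t ∈ (M m).cells → a m L = ⨍ x in D m L, w x)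
    {s : Fin 2 → ℤ} {r : ℕ} (hs : ∀ k, |s k| ≤ r) (hst : ∀ k, |s k - t k| ≤ r) :
    ∃ G : ℕ → (Fin 2 → ℝ) → ℝ, (∀ m, Integrable (G m) (volume.restrict Ω)) ∧
      Tendsto (fun m => ∫ x, |G m x| ∂volume.restrict Ω) atTop (𝓝 0) ∧
      ∀ x ∈ Ω, ∀ᶠ m in atTop, G m x = a m ((M m).idx x + s) - w x := by
  have : IsFiniteMeasure (volume.restrict Ω) := ⟨by simpa using hΩ⟩
  have hρ : Tendsto (fun m => (4 * r + 2) * (M m).size) atTop (𝓝 0) := by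
    simpa using hsize.const_mul (4 * (r : ℝ) + 2)
  set J := fun m => (M m).nearCells (D m) t s r with hJ
  have hJ1 : ∀ m, ∀ K ∈ J m, K ∈ (M m).cells ∧ K + s ∈ (M m).cells ∧ K + s - t ∈ (M m).cells ∧
    ∀ p ∈ (M m).cell K, ∀ p' ∈ (M m).cell K ∪ D m (K + s),
      dist p p' ≤ (4 * r + 2) * (M m).size := fun m K hK => (M m).mem_nearCells.1 hK
  have hPd : ∀ m, (J m : Set (Fin 2 → ℤ)).PairwiseDisjoint (M m).cell := fun m K _ L _ hKL =>
    disjoint_left.2 fun x hx hx' => hKL ((M m).cell_unique hx hx')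
  have hvol : ∀ m, ∀ A ⊆ (M m).cellUnion, MeasurableSet A →
      (volume.restrict Ω).real A = volume.real A := fun m A hA hAm => by
    rw [Measure.real, Measure.real, ← hM m, (M m).volume_restrict_domain hA hAm]
  refine ⟨blockDiff J (fun m => (M m).cell) (fun m K => a m (K + s)) w, fun m =>
    integrable_blockDiff hw fun K _ => (M m).measurableSet_cell K, ?_, fun x hx => ?_⟩
  · refine squeeze_zero (fun m => integral_nonneg fun _ => abs_nonneg _) (fun m =>
      integral_abs_blockDiff_le hw fun K _ => (M m).measurableSet_cell K) ?_
    refine tendsto_sum_setIntegral_abs_sub (f := fun _ => w) (B := fun m K => D m (K + s))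
      (c := c) (fun _ => hw) hw (by simp) (fun m K _ => (M m).measurableSet_cell K)
      (fun m K _ => (hD m).measurable _) hPd (fun m K _ L _ hKL => ?_) (fun m K hK => ?_) hρ
      (fun m K hK => ⟨_, (M m).center_mem_cell K⟩) (fun m K hK => (hJ1 m K hK).2.2.2)
      (fun m K hK v => ?_)
    · exact disjoint_left.2 fun x hx hx' => hKL (add_left_injective s ((hD m).unique hx hx'))
    · obtain ⟨h1, h2, h3, -⟩ := hJ1 m K hK
      rw [hvol m _ ((M m).cell_subset_cellUnion h1) ((M m).measurableSet_cell K),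
        hvol m _ ((hD m).subset_cellUnion h2 h3) ((hD m).measurable _), (M m).volume_real_cell]
      exact (hD m).area_le K h1 _ h2 h3
    · obtain ⟨h1, h2, h3, -⟩ := hJ1 m K hK
      have hsub := (hD m).subset_cellUnion h2 h3
      have hme := (hD m).measurable (K + s)
      have hwB : IntegrableOn w (D m (K + s)) := by
        rw [IntegrableOn, ← (M m).restrict_domain_restrict hsub hme, hM m]
        exact Integrable.restrict hw
      have hfin : volume (D m (K + s)) < ⊤ := by
        refine (measure_mono (hsub.trans (iUnion₂_mono fun K _ =>
          (M m).cell_subset_closedCell K))).trans_lt ?_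
        exact ((M m).cells.isCompact_biUnion fun K _ => (M m).isCompact_closedCell K).measure_lt_top
      have hpos : 0 < volume.real (D m (K + s)) := by
        have h4 := (hD m).area_le K h1 _ h2 h3
        have h5 := (M m).cellArea_pos K
        by_contra! h6
        have h7 : volume.real (D m (K + s)) = 0 := le_antisymm h6 measureReal_nonneg
        rw [h7, mul_zero] at h4
        linarith
      have hc : IntegrableOn (fun _ => v) (D m (K + s)) := integrableOn_const hfin.ne
      rw [hvol m _ hsub hme, ha m _ h2 h3, ← hM m, (M m).restrict_domain_restrict hsub hme,
        setAverage_eq, smul_eq_mul]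
      refine le_trans (le_of_eq ?_) (abs_integral_le_integral_abs (f := fun x => w x - v))
      rw [integral_sub hwB hc, setIntegral_const, smul_eq_mul, ← abs_of_pos hpos, ← abs_mul,
        abs_of_pos hpos, mul_sub, mul_inv_cancel_left₀ hpos.ne']
  · filter_upwards [eventually_mem_nearCells hM hsize hD hs hst hx] with m hm
    exact blockDiff_eq (J := J) (P := fun m => (M m).cell) (hPd m) hm ((M m).idx_spec (by rwa [hM m])).2

/-- The piecewise constant function with the values `a` on the blocks. -/
lemma Blocks.sum_indicator {M : MACGrid} {t : Fin 2 → ℤ} {D : (Fin 2 → ℤ) → Set (Fin 2 → ℝ)}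
    {c : ℝ} (hD : M.Blocks t D c) {τ : ℝ} (hτ : 0 < τ) {N n : ℕ} (hn : n < N)
    {F : Finset (Fin 2 → ℤ)} {L : Fin 2 → ℤ} (hL : L ∈ F) (a : ℕ → (Fin 2 → ℤ) → ℝ)
    {q : (Fin 2 → ℝ) × ℝ} (hq : q ∈ D L ×ˢ Ico (n * τ) ((n + 1) * τ)) :
    ∑ n ∈ Finset.range N, ∑ L ∈ F,
      (D L ×ˢ Ico (n * τ) ((n + 1) * τ)).indicator (fun _ => a n L) q = a n L := by
  have hq0 : 0 ≤ q.2 := le_trans (by positivity) hq.2.1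
  rw [Finset.sum_eq_single_of_mem n (Finset.mem_range.2 hn), Finset.sum_eq_single_of_mem L hL,
    indicator_of_mem hq]
  · intro L' _ hL'
    exact indicator_of_notMem (fun h => hL' (hD.unique h.1 hq.1)) _
  · intro n' _ hn'
    refine Finset.sum_eq_zero fun L' _ => indicator_of_notMem (fun h => hn' ?_) _
    rw [← (mem_slab_iff hτ hq0).1 h.2, (mem_slab_iff hτ hq0).1 hq.2]

lemma Blocks.integrable_sum_indicator {M : MACGrid} {t : Fin 2 → ℤ}
    {D : (Fin 2 → ℤ) → Set (Fin 2 → ℝ)} {c : ℝ} (hD : M.Blocks t D c) (τ : ℝ) (N : ℕ)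
    (F : Finset (Fin 2 → ℤ)) (a : ℕ → (Fin 2 → ℤ) → ℝ) {μ : Measure ((Fin 2 → ℝ) × ℝ)}
    [IsFiniteMeasure μ] :
    Integrable (fun q => ∑ n ∈ Finset.range N, ∑ L ∈ F,
      (D L ×ˢ Ico (n * τ) ((n + 1) * τ)).indicator (fun _ => a n L) q) μ :=
  integrable_finsetSum _ fun _ _ => integrable_finsetSum _ fun L _ =>
    (integrable_const _).indicator ((hD.measurable L).prod measurableSet_Ico)

/-- The analogue of `exists_blockDiff_init` in space and time, for values `a` which are those of
functions converging in `L¹`. -/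
lemma exists_blockDiff (hM : ∀ m, (M m).domain = Ω)
    (hsize : Tendsto (fun m => (M m).size) atTop (𝓝 0)) (hΩ : volume Ω < ⊤)
    {T : ℝ} {N : ℕ → ℕ} {τ : ℕ → ℝ} (hτ : ∀ m, 0 < τ m) (hT : ∀ m, N m * τ m = T)
    (hτ_lim : Tendsto τ atTop (𝓝 0))
    {t : Fin 2 → ℤ} {D : ℕ → (Fin 2 → ℤ) → Set (Fin 2 → ℝ)} {c : ℝ}
    (hD : ∀ m, (M m).Blocks t (D m) c) {F : ℕ → Finset (Fin 2 → ℤ)}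
    (hF : ∀ m, ∀ L ∈ (M m).cells, L - t ∈ (M m).cells → L ∈ F m)
    {w : (Fin 2 → ℝ) × ℝ → ℝ} (hw : IntegrableOn w (Ω ×ˢ Ioo 0 T))
    {a : ℕ → ℕ → (Fin 2 → ℤ) → ℝ}
    (hlim : Tendsto (fun m => eLpNorm (fun q => (∑ n ∈ Finset.range (N m), ∑ L ∈ F m,
      (D m L ×ˢ Ico (n * τ m) ((n + 1) * τ m)).indicator (fun _ => a m n L) q) - w q) 1
      (volume.restrict (Ω ×ˢ Ioo 0 T))) atTop (𝓝 0))
    {s : Fin 2 → ℤ} {r : ℕ} (hs : ∀ k, |s k| ≤ r) (hst : ∀ k, |s k - t k| ≤ r) :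
    ∃ G : ℕ → (Fin 2 → ℝ) × ℝ → ℝ, (∀ m, Integrable (G m) (volume.restrict (Ω ×ˢ Ioo 0 T))) ∧
      Tendsto (fun m => ∫ x, |G m x| ∂volume.restrict (Ω ×ˢ Ioo 0 T)) atTop (𝓝 0) ∧
      ∀ q ∈ Ω ×ˢ Ioo 0 T, ∀ᶠ m in atTop,
        G m q = a m ⌊q.2 / τ m⌋₊ ((M m).idx q.1 + s) - w q := by
  have hfin : IsFiniteMeasure (volume.restrict (Ω ×ˢ Ioo 0 T)) := ⟨by
    rw [Measure.restrict_apply_univ, Measure.volume_eq_prod, Measure.prod_prod, Real.volume_Ioo]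
    exact ENNReal.mul_lt_top hΩ ENNReal.ofReal_lt_top⟩
  set μ := volume.restrict (Ω ×ˢ Ioo 0 T) with hμ
  set f := fun m (q : (Fin 2 → ℝ) × ℝ) => ∑ n ∈ Finset.range (N m), ∑ L ∈ F m,
      (D m L ×ˢ Ico (n * τ m) ((n + 1) * τ m)).indicator (fun _ => a m n L) q with hf
  have hfi : ∀ m, Integrable (f m) μ := fun m => (hD m).integrable_sum_indicator _ _ _ _
  have hρ : Tendsto (fun m => (4 * r + 2) * (M m).size + τ m) atTop (𝓝 0) := by
    simpa using (hsize.const_mul (4 * (r : ℝ) + 2)).add hτ_lim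
  set J := fun m => Finset.range (N m) ×ˢ (M m).nearCells (D m) t s r with hJ
  have hJ1 : ∀ m, ∀ j ∈ J m, j.1 < N m ∧ j.2 ∈ (M m).cells ∧ j.2 + s ∈ (M m).cells ∧
      j.2 + s - t ∈ (M m).cells ∧ ∀ p ∈ (M m).cell j.2, ∀ p' ∈ (M m).cell j.2 ∪ D m (j.2 + s),
        dist p p' ≤ (4 * r + 2) * (M m).size := fun m j hj => by
    obtain ⟨h1, h2⟩ := Finset.mem_product.1 hj
    exact ⟨Finset.mem_range.1 h1, (M m).mem_nearCells.1 h2⟩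
  set I : ℕ → ℕ → Set ℝ := fun m n => Ico (n * τ m) ((n + 1) * τ m) with hI
  have hIu : ∀ m n n' x, x ∈ I m n → x ∈ I m n' → n = n' := fun m n n' x h h' => by
    have hx : 0 ≤ x := le_trans (mul_nonneg n.cast_nonneg (hτ m).le) h.1
    rw [← (mem_slab_iff (hτ m) hx).1 h, (mem_slab_iff (hτ m) hx).1 h']
  have hIv : ∀ m n, volume.real (I m n) = τ m := fun m n => by
    rw [Measure.real, Real.volume_Ico, ENNReal.toReal_ofReal (by linarith [hτ m])]; ring
  set P : ℕ → ℕ × (Fin 2 → ℤ) → Set ((Fin 2 → ℝ) × ℝ) :=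
    fun m j => (M m).cell j.2 ×ˢ I m j.1 with hP
  have hPm : ∀ m j, MeasurableSet (P m j) := fun m j =>
    ((M m).measurableSet_cell _).prod measurableSet_Ico
  have hPd : ∀ m, (J m : Set (ℕ × (Fin 2 → ℤ))).PairwiseDisjoint (P m) :=
    fun m j _ j' _ hjj => disjoint_left.2 fun x hx hx' => hjj
      (Prod.ext (hIu m _ _ _ hx.2 hx'.2) ((M m).cell_unique hx.1 hx'.1))
  have hvol : ∀ m, ∀ A ⊆ (M m).cellUnion, MeasurableSet A → ∀ n < N m,
      μ.real (A ×ˢ I m n) = volume.real A * τ m := fun m A hA hAm n hn => by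
    rw [Measure.real, hμ, ← hM m, (M m).volume_restrict_prod hA hAm
      (slab_subset (hτ m) (hT m) hn) measurableSet_Ico, ENNReal.toReal_mul, ← Measure.real,
      ← Measure.real, hIv]
  refine ⟨blockDiff J P (fun m j => a m j.1 (j.2 + s)) w, fun m =>
    integrable_blockDiff hw fun j _ => hPm m j, ?_, fun q hq => ?_⟩
  · refine squeeze_zero (fun m => integral_nonneg fun _ => abs_nonneg _) (fun m =>
      integral_abs_blockDiff_le hw fun j _ => hPm m j) ?_
    refine tendsto_sum_setIntegral_abs_sub (f := f) (B := fun m j => D m (j.2 + s) ×ˢ I m j.1)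
      (c := c) hfi hw (tendsto_integral_abs_of_eLpNorm (fun m => (hfi m).sub hw) hlim)
      (fun m j _ => hPm m j) (fun m j _ => ((hD m).measurable _).prod measurableSet_Ico) hPd
      (fun m j _ j' _ hjj => ?_) (fun m j hj => ?_) hρ
      (fun m j hj => ⟨((M m).center j.2, j.1 * τ m), (M m).center_mem_cell _, ?_⟩)
      (fun m j hj p hp p' hp' => ?_) (fun m j hj v => ?_)
    · exact disjoint_left.2 fun x hx hx' => hjj (Prod.ext (hIu m _ _ _ hx.2 hx'.2)
        (add_left_injective s ((hD m).unique hx.1 hx'.1)))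
    · obtain ⟨h0, h1, h2, h3, -⟩ := hJ1 m j hj
      rw [hvol m _ ((M m).cell_subset_cellUnion h1) ((M m).measurableSet_cell _) _ h0,
        hvol m _ ((hD m).subset_cellUnion h2 h3) ((hD m).measurable _) _ h0,
        (M m).volume_real_cell, ← mul_assoc]
      exact mul_le_mul_of_nonneg_right ((hD m).area_le _ h1 _ h2 h3) (hτ m).le
    · exact ⟨le_rfl, by have := hτ m; simp only [add_mul]; linarith⟩
    · have hmem : p'.1 ∈ (M m).cell j.2 ∪ D m (j.2 + s) ∧ p'.2 ∈ I m j.1 := by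
        rcases hp' with h | h
        exacts [⟨Or.inl h.1, h.2⟩, ⟨Or.inr h.1, h.2⟩]
      have h1 := (hJ1 m j hj).2.2.2.2 p.1 hp.1 p'.1 hmem.1
      have h2 : dist p.2 p'.2 ≤ τ m := by
        refine (Real.dist_le_of_mem_Icc (Ico_subset_Icc_self hp.2)
          (Ico_subset_Icc_self hmem.2)).trans (le_of_eq (by ring))
      have h3 := hτ m
      rw [Prod.dist_eq]
      exact max_le (by linarith) (by linarith [dist_nonneg.trans h1])
    · obtain ⟨h0, h1, h2, h3, -⟩ := hJ1 m j hj
      have hBm : MeasurableSet (D m (j.2 + s) ×ˢ I m j.1) :=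
        ((hD m).measurable _).prod measurableSet_Ico
      have hEq : EqOn (fun q => |f m q - v|) (fun _ => |a m j.1 (j.2 + s) - v|)
          (D m (j.2 + s) ×ˢ I m j.1) := fun q hq => by
        simp only [hf]
        rw [(hD m).sum_indicator (hτ m) h0 (hF m _ h2 h3) (a m) hq]
      refine le_of_eq ?_
      rw [setIntegral_congr_fun hBm hEq, setIntegral_const, smul_eq_mul]
  · have h1 : ∀ᶠ m in atTop, ⌊q.2 / τ m⌋₊ < N m := Eventually.of_forall fun m =>
      floor_lt_of_lt (hτ m) (hT m) hq.2.1.le hq.2.2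
    filter_upwards [eventually_mem_nearCells hM hsize hD hs hst hq.1, h1] with m hm hm'
    refine blockDiff_eq (J := J) (P := P) (j := (⌊q.2 / τ m⌋₊, (M m).idx q.1)) (hPd m)
      (Finset.mem_product.2 ⟨Finset.mem_range.2 hm', hm⟩)
      ⟨((M m).idx_spec (by rw [hM m]; exact hq.1)).2, (mem_slab_iff (hτ m) hq.2.1.le).2 rfl⟩

end MACGrid

/-! ### Extraction of a convergent scheme -/

/-- Along a subsequence, the discrete unknowns and the discrete initial data converge almost
everywhere, for all the values attached to neighbouring cells and edges. -/
lemma exists_subseq_locTendsto {Ω : Set (Fin 2 → ℝ)} {T : ℝ} {h₀ : (Fin 2 → ℝ) → ℝ}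
    {u₀ : Fin 2 → (Fin 2 → ℝ) → ℝ} (hh₀ : IntegrableOn h₀ Ω) (hu₀ : ∀ i, IntegrableOn (u₀ i) Ω)
    {M : ℕ → MACGrid} (hM : ∀ m, (M m).domain = Ω)
    (hsize : Tendsto (fun m => (M m).size) atTop (𝓝 0)) {η : ℝ} (hη0 : 0 ≤ η)
    (hη : ∀ m, (M m).regularity ≤ η) {N : ℕ → ℕ} {τ : ℕ → ℝ} (hτ : ∀ m, 0 < τ m)
    (hT : ∀ m, N m * τ m = T) (hτ_lim : Tendsto τ atTop (𝓝 0))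
    {h : ℕ → ℕ → (Fin 2 → ℤ) → ℝ} {u : ℕ → ℕ → Fin 2 → (Fin 2 → ℤ) → ℝ}
    (hinit : ∀ m, ∀ K ∈ (M m).cells, h m 0 K = ⨍ x in (M m).cell K, h₀ x)
    (uinit : ∀ m i, ∀ σ ∈ (M m).intEdges i, u m 0 i σ = ⨍ x in (M m).dualCell i σ, u₀ i x)
    {hbar : (Fin 2 → ℝ) × ℝ → ℝ} {ubar : Fin 2 → (Fin 2 → ℝ) × ℝ → ℝ}
    (hbar_int : IntegrableOn hbar (Ω ×ˢ Ioo 0 T))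
    (ubar_int : ∀ i, IntegrableOn (ubar i) (Ω ×ˢ Ioo 0 T))
    (hconv : Tendsto (fun m => eLpNorm (fun q => (M m).heightFun (τ m) (N m) (h m) q - hbar q) 1
      (volume.restrict (Ω ×ˢ Ioo 0 T))) atTop (𝓝 0))
    (uconv : ∀ i, Tendsto (fun m =>
      eLpNorm (fun q => (M m).velocityFun (τ m) (N m) (u m) i q - ubar i q) 1
      (volume.restrict (Ω ×ˢ Ioo 0 T))) atTop (𝓝 0)) :
    ∃ ns : ℕ → ℕ, StrictMono ns ∧
      (∀ᵐ q ∂(volume.restrict (Ω ×ˢ Ioo 0 T)), LocTendsto (fun m => (M (ns m)).idx q.1) 5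
        (fun m => h (ns m) (⌊q.2 / τ (ns m)⌋₊ + 1)) (hbar q)) ∧
      (∀ i, ∀ᵐ q ∂(volume.restrict (Ω ×ˢ Ioo 0 T)), LocTendsto (fun m => (M (ns m)).idx q.1) 5
        (fun m => u (ns m) (⌊q.2 / τ (ns m)⌋₊ + 1) i) (ubar i q)) ∧
      (∀ᵐ x ∂(volume.restrict Ω), LocTendsto (fun m => (M (ns m)).idx x) 5
        (fun m => h (ns m) 0) (h₀ x)) ∧
      ∀ i, ∀ᵐ x ∂(volume.restrict Ω), LocTendsto (fun m => (M (ns m)).idx x) 5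
        (fun m => u (ns m) 0 i) (u₀ i x) := by
  have hΩo : IsOpen Ω := hM 0 ▸ (M 0).isOpen_domain
  have hΩ : volume Ω < ⊤ := hM 0 ▸ (M 0).isBounded_domain.measure_lt_top
  have hDc := fun m => (M m).blocks_cell hη0 (hη m)
  have hDe := fun i m => (M m).blocks_dualCell hη0 (hη m) i
  obtain ⟨box, hbox⟩ : ∃ box : Finset (Fin 2 → ℤ),
    box = Fintype.piFinset fun _ => Finset.Icc (-((5 : ℕ) : ℤ)) (5 : ℕ) := ⟨_, rfl⟩
  have hb5 : ∀ s ∈ box, ∀ k, -5 ≤ s k ∧ s k ≤ 5 := fun s hs k => by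
    rw [hbox] at hs
    exact Finset.mem_Icc.1 (Fintype.mem_piFinset.1 hs k)
  have hbs : ∀ s ∈ box, ∀ k, |s k| ≤ (6 : ℕ) := fun s hs k => by
    have := hb5 s hs k
    rw [abs_le]; push_cast at *; omega
  have hbs0 : ∀ s ∈ box, ∀ k, |s k - (0 : Fin 2 → ℤ) k| ≤ (6 : ℕ) := fun s hs k => by
    simpa using hbs s hs k
  have hbse : ∀ i, ∀ s ∈ box, ∀ k, |s k - e i k| ≤ (6 : ℕ) := fun i s hs k => by
    have := hb5 s hs k
    rw [abs_le]
    by_cases hk : k = i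
    · subst hk; simp only [e_same]; push_cast at *; omega
    · simp only [e_ne hk]; push_cast at *; omega
  -- `none` stands for the height and `some i` for the velocity in direction `i`
  let val : Option (Fin 2) → ℕ → ℕ → (Fin 2 → ℤ) → ℝ :=
    fun o m n => o.elim (h m n) (fun i => u m n i)
  let lim : Option (Fin 2) → (Fin 2 → ℝ) × ℝ → ℝ := fun o => o.elim hbar ubar
  let lim₀ : Option (Fin 2) → (Fin 2 → ℝ) → ℝ := fun o => o.elim h₀ u₀
  obtain ⟨S, hS⟩ : ∃ S : Finset ((Fin 2 → ℤ) × Option (Fin 2)), ∀ s o, (s, o) ∈ S ↔ s ∈ box :=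
    ⟨box ×ˢ Finset.univ, fun s o => by rw [Finset.mem_product]; simp⟩
  have e1 : ∀ k : (Fin 2 → ℤ) × Option (Fin 2), k ∈ S → ∃ G : ℕ → (Fin 2 → ℝ) × ℝ → ℝ,
      (∀ m, Integrable (G m) (volume.restrict (Ω ×ˢ Ioo 0 T))) ∧
      Tendsto (fun m => ∫ x, |G m x| ∂volume.restrict (Ω ×ˢ Ioo 0 T)) atTop (𝓝 0) ∧
      ∀ q ∈ Ω ×ˢ Ioo 0 T, ∀ᶠ m in atTop,
        G m q = val k.2 m (⌊q.2 / τ m⌋₊ + 1) ((M m).idx q.1 + k.1) - lim k.2 q := by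
    rintro ⟨s, o⟩ hk
    have hs := (hS s o).1 hk
    rcases o with _ | i
    · exact exists_blockDiff hM hsize hΩ hτ hT hτ_lim hDc (fun m L hL _ => hL) hbar_int
        (a := fun m n => h m (n + 1)) hconv (hbs s hs) (hbs0 s hs)
    · exact exists_blockDiff hM hsize hΩ hτ hT hτ_lim (hDe i)
        (fun m L hL hL' => (M m).intEdges_subset_edges i ((M m).mem_intEdges.2 ⟨hL, hL'⟩))
        (ubar_int i) (a := fun m n => u m (n + 1) i) (uconv i) (hbs s hs) (hbse i s hs)
  have e2 : ∀ k : (Fin 2 → ℤ) × Option (Fin 2), k ∈ S → ∃ G : ℕ → (Fin 2 → ℝ) → ℝ,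
      (∀ m, Integrable (G m) (volume.restrict Ω)) ∧
      Tendsto (fun m => ∫ x, |G m x| ∂volume.restrict Ω) atTop (𝓝 0) ∧
      ∀ x ∈ Ω, ∀ᶠ m in atTop, G m x = val k.2 m 0 ((M m).idx x + k.1) - lim₀ k.2 x := by
    rintro ⟨s, o⟩ hk
    have hs := (hS s o).1 hk
    rcases o with _ | i
    · exact exists_blockDiff_init hM hsize hΩ hDc hh₀ (fun m L hL _ => hinit m L hL)
        (hbs s hs) (hbs0 s hs)
    · exact exists_blockDiff_init hM hsize hΩ (hDe i) (hu₀ i)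
        (fun m L hL hL' => uinit m i L ((M m).mem_intEdges.2 ⟨hL, hL'⟩)) (hbs s hs) (hbse i s hs)
  choose! G hGi hGl hGe using e1
  choose! H hHi hHl hHe using e2
  obtain ⟨n₁, hn₁, ae₁⟩ := exists_seq_tendsto_ae_of_integral S hGi hGl
  obtain ⟨n₂, hn₂, ae₂⟩ := exists_seq_tendsto_ae_of_integral S (G := fun k m => H k (n₁ m))
    (fun k hk m => hHi k hk (n₁ m)) (fun k hk => (hHl k hk).comp hn₁.tendsto_atTop)
  have hns := hn₁.comp hn₂
  have k1 : ∀ o, ∀ᵐ q ∂(volume.restrict (Ω ×ˢ Ioo 0 T)),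
      LocTendsto (fun m => (M (n₁ (n₂ m))).idx q.1) 5
        (fun m => val o (n₁ (n₂ m)) (⌊q.2 / τ (n₁ (n₂ m))⌋₊ + 1)) (lim o q) := fun o => by
    filter_upwards [ae₁, ae_restrict_mem (hΩo.measurableSet.prod measurableSet_Ioo)] with q hq hqm
    refine LocTendsto.of_forall_shift fun s hs => ?_
    have hk : (s, o) ∈ S := (hS s o).2 (hbox ▸ hs)
    have h1 := ((hq (s, o) hk).comp hn₂.tendsto_atTop).add_const (lim o q)
    rw [zero_add] at h1
    refine h1.congr' ?_
    filter_upwards [hns.tendsto_atTop.eventually (hGe (s, o) hk q hqm)] with m hm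
    simp only [Function.comp_apply] at hm ⊢
    rw [hm, sub_add_cancel]
  have k2 : ∀ o, ∀ᵐ x ∂(volume.restrict Ω),
      LocTendsto (fun m => (M (n₁ (n₂ m))).idx x) 5
        (fun m => val o (n₁ (n₂ m)) 0) (lim₀ o x) := fun o => by
    filter_upwards [ae₂, ae_restrict_mem hΩo.measurableSet] with x hx hxm
    refine LocTendsto.of_forall_shift fun s hs => ?_
    have hk : (s, o) ∈ S := (hS s o).2 (hbox ▸ hs)
    have h1 := (hx (s, o) hk).add_const (lim₀ o x)
    rw [zero_add] at h1
    refine h1.congr' ?_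
    filter_upwards [hns.tendsto_atTop.eventually (hHe (s, o) hk x hxm)] with m hm
    simp only [Function.comp_apply] at hm ⊢
    rw [hm, sub_add_cancel]
  exact ⟨fun m => n₁ (n₂ m), hns, k1 none, fun i => k1 (some i), k2 none, fun i => k2 (some i)⟩

lemma MACGrid.massFlux_congr (M : MACGrid) {h h' : (Fin 2 → ℤ) → ℝ}
    {u : Fin 2 → (Fin 2 → ℤ) → ℝ} (hh : ∀ K ∈ M.cells, h K = h' K)
    (hu : ∀ i, ∀ σ ∉ M.intEdges i, u i σ = 0) : M.massFlux h u = M.massFlux h' u := by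
  ext i σ
  rw [massFlux, massFlux]
  by_cases hσ : σ ∈ M.intEdges i
  · obtain ⟨h1, h2⟩ := M.mem_intEdges.1 hσ
    rw [hh _ h1, hh _ h2]
  · rw [hu i σ hσ, mul_zero, mul_zero]

lemma MACGrid.convection_congr (M : MACGrid) {h h' : (Fin 2 → ℤ) → ℝ}
    {u : Fin 2 → (Fin 2 → ℤ) → ℝ} (hF : M.massFlux h u = M.massFlux h' u) :
    M.convection h u = M.convection h' u := by
  have h1 : M.dualFlux h u = M.dualFlux h' u := by
    ext i j σ; simp only [dualFlux, hF]
  have h2 : M.momentumFlux h u = M.momentumFlux h' u := by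
    unfold momentumFlux; rw [h1]
  unfold convection; rw [h2]

/-- A subsequence of the given sequence of discrete solutions is a convergent scheme. -/
lemma exists_convergentScheme {Ω : Set (Fin 2 → ℝ)} {T g : ℝ} {z : (Fin 2 → ℝ) → ℝ}
    (hz : ContDiff ℝ 1 z) {h₀ : (Fin 2 → ℝ) → ℝ} {u₀ : Fin 2 → (Fin 2 → ℝ) → ℝ}
    (hh₀ : IntegrableOn h₀ Ω) (hu₀ : ∀ i, IntegrableOn (u₀ i) Ω)
    {M : ℕ → MACGrid} (hM : ∀ m, (M m).domain = Ω)
    (hsize : Tendsto (fun m => (M m).size) atTop (𝓝 0)) {η : ℝ} (hη0 : 0 ≤ η)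
    (hη : ∀ m, (M m).regularity ≤ η) {N : ℕ → ℕ} (hN : ∀ m, 0 < N m)
    {τ : ℕ → ℝ} (hτ : ∀ m, 0 < τ m)
    (hT : ∀ m, N m * τ m = T) (hτ_lim : Tendsto τ atTop (𝓝 0))
    {zM : ℕ → (Fin 2 → ℤ) → ℝ}
    (hzM : (∀ m, ∀ K ∈ (M m).cells, zM m K = z ((M m).center K)) ∨
      (∀ m, ∀ K ∈ (M m).cells, zM m K = ⨍ x in (M m).cell K, z x))
    {h : ℕ → ℕ → (Fin 2 → ℤ) → ℝ} {u : ℕ → ℕ → Fin 2 → (Fin 2 → ℤ) → ℝ}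
    (hsol : ∀ m, (M m).IsSolution g (τ m) (N m) h₀ u₀ (zM m) (h m) (u m)) {C₁ C₂ : ℝ}
    (hC₁ : 0 < C₁)
    (hh : ∀ m, ∀ n < N m, ∀ K ∈ (M m).cells, 1 / C₁ < h m n K ∧ h m n K ≤ C₁)
    (hu : ∀ m, ∀ n < N m, ∀ i, ∀ σ ∈ (M m).edges i, |u m n i σ| ≤ C₂)
    {hbar : (Fin 2 → ℝ) × ℝ → ℝ} {ubar : Fin 2 → (Fin 2 → ℝ) × ℝ → ℝ}
    (hbar_int : IntegrableOn hbar (Ω ×ˢ Ioo 0 T))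
    (ubar_int : ∀ i, IntegrableOn (ubar i) (Ω ×ˢ Ioo 0 T))
    (hconv : Tendsto (fun m => eLpNorm (fun q => (M m).heightFun (τ m) (N m) (h m) q - hbar q) 1
      (volume.restrict (Ω ×ˢ Ioo 0 T))) atTop (𝓝 0))
    (uconv : ∀ i, Tendsto (fun m =>
      eLpNorm (fun q => (M m).velocityFun (τ m) (N m) (u m) i q - ubar i q) 1
      (volume.restrict (Ω ×ˢ Ioo 0 T))) atTop (𝓝 0)) :
    ∃ (ns : ℕ → ℕ) (S : ConvergentScheme Ω T g z h₀ u₀ hbar ubar), StrictMono ns ∧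
      (∀ m, S.M m = M (ns m)) ∧ (∀ m, S.N m = N (ns m)) ∧ (∀ m, S.τ m = τ (ns m)) ∧
      ∀ m, ∀ n < N (ns m), ∀ K ∈ (M (ns m)).cells, S.h m n K = h (ns m) n K := by
  classical
  obtain ⟨ns, hns, l1, l2, l3, l4⟩ := exists_subseq_locTendsto hh₀ hu₀ hM hsize hη0 hη hτ hT hτ_lim
    (fun m => (hsol m).init_height) (fun m => (hsol m).init_velocity) hbar_int ubar_int hconv uconv
  have hsz : ∀ m, ∀ K ∈ (M m).cells, ∀ i, (M m).size ≤ (η + η ^ 2) * (M m).len i (K i) :=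
    fun m K hK i => (M m).size_le_of_regularity hη0 (hη m) hK i
  have hMn : ∀ m, (M (ns m)).domain = Ω := fun m => hM _
  have hsizen : Tendsto (fun m => (M (ns m)).size) atTop (𝓝 0) := hsize.comp hns.tendsto_atTop
  have hτn : Tendsto (fun m => τ (ns m)) atTop (𝓝 0) := hτ_lim.comp hns.tendsto_atTop
  obtain ⟨C₃, Z, DZ, hZ, hZb, hDZb, hZs, hZc, hDZc⟩ := exists_discrete_topography
    (M := fun m => M (ns m)) hMn hsizen (fun m => hsz (ns m)) hz (zM := fun m => zM (ns m))
    (hzM.imp (fun h m => h (ns m)) (fun h m => h (ns m)))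
  set C := 1 + C₁ + |C₂| + (η + η ^ 2) + |C₃| with hC
  have hη1 : 0 ≤ η + η ^ 2 := by positivity
  have a2 := abs_nonneg C₂
  have a3 := abs_nonneg C₃
  have b3 := le_abs_self C₃
  have b2 := le_abs_self C₂
  set h' : ℕ → ℕ → (Fin 2 → ℤ) → ℝ := fun m n K =>
    if n < N (ns m) ∧ K ∈ (M (ns m)).cells then h (ns m) n K else 1 with hh'
  set u' : ℕ → ℕ → Fin 2 → (Fin 2 → ℤ) → ℝ := fun m n =>
    if n < N (ns m) then u (ns m) n else 0 with hu'
  have hh'_eq : ∀ m, ∀ n < N (ns m), ∀ K ∈ (M (ns m)).cells, h' m n K = h (ns m) n K :=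
    fun m n hn K hK => if_pos ⟨hn, hK⟩
  have hu'_eq : ∀ m, ∀ n < N (ns m), u' m n = u (ns m) n := fun m n hn => if_pos hn
  have hmf : ∀ m, ∀ n < N (ns m), (M (ns m)).massFlux (h' m n) (u (ns m) n) =
      (M (ns m)).massFlux (h (ns m) n) (u (ns m) n) := fun m n hn =>
    (M (ns m)).massFlux_congr (hh'_eq m n hn) ((hsol (ns m)).boundary n hn.le)
  have hpt : ∀ {x : Fin 2 → ℝ}, x ∈ Ω → ∀ κ : ℕ → Fin 2 → ℤ,
      (∀ m k, |κ m k - (M (ns m)).idx x k| ≤ (5 : ℕ)) →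
      ∀ᶠ m in atTop, κ m ∈ (M (ns m)).cells := fun {x} hx κ hκ => by
    filter_upwards [MACGrid.eventually_near hMn hsizen hx 5 one_pos] with m hm
    exact (hm _ (hκ m)).1
  have htm : ∀ t ∈ Ioo 0 T, ∀ᶠ m in atTop, ⌊t / τ (ns m)⌋₊ + 1 < N (ns m) := fun t ht => by
    filter_upwards [hτn.eventually (gt_mem_nhds (sub_pos.2 ht.2))] with m hm
    have h1 : ⌊(t + τ (ns m)) / τ (ns m)⌋₊ < N (ns m) :=
      floor_lt_of_lt (hτ _) (hT _) (add_nonneg ht.1.le (hτ _).le) (by linarith)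
    rwa [add_div, div_self (hτ _).ne', Nat.floor_add_one (div_nonneg ht.1.le (hτ _).le)] at h1
  have hΩo : IsOpen Ω := hM 0 ▸ (M 0).isOpen_domain
  refine ⟨ns, ⟨fun m => M (ns m), fun m => N (ns m), fun m => τ (ns m), Z, DZ, h', u', C, ?_, hMn,
    hM 0 ▸ (M 0).isBounded_domain.measure_lt_top, fun m => hτ _, fun m => hT _, hτn, hsizen,
    fun m K hK i => ?_, fun m n K => ?_, fun m n K => ?_, fun m n i σ => ?_, fun m n i σ hσ => ?_,
    fun m K => (hZb m K).trans (by linarith), fun m i σ => (hDZb m i σ).trans (by linarith), hZs,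
    fun m n hn K hK => ?_, fun m n hn i σ hσ => ?_, hZc, hDZc, ?_, fun i => ?_, ?_, fun i => ?_⟩,
    hns, fun _ => rfl, fun _ => rfl, fun _ => rfl, hh'_eq⟩
  · linarith
  · exact (hsz _ K hK i).trans (mul_le_mul_of_nonneg_right (by linarith) ((M (ns m)).len_pos _ _).le)
  · simp only [hh']
    split_ifs with hc
    · exact (one_div_le_one_div_of_le hC₁ (by linarith)).trans (hh _ n hc.1 K hc.2).1.le
    · rw [div_le_one (by linarith)]; linarith
  · simp only [hh']
    split_ifs with hc
    · exact (hh _ n hc.1 K hc.2).2.trans (by linarith)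
    · linarith
  · simp only [hu']
    split_ifs with hc
    · by_cases hσ : σ ∈ (M (ns m)).edges i
      · exact (hu _ n hc i σ hσ).trans (by linarith)
      · rw [(hsol (ns m)).boundary n hc.le i σ
          fun h => hσ ((M (ns m)).intEdges_subset_edges i h), abs_zero]
        linarith
    · simp only [Pi.zero_apply, abs_zero]; linarith
  · simp only [hu']
    split_ifs with hc
    · exact (hsol (ns m)).boundary n hc.le i σ hσ
    · rfl
  · have h1 := (hsol (ns m)).mass n (by omega) K hK
    simp only [divCell] at h1 ⊢
    rw [hh'_eq m _ hn K hK, hh'_eq m n (by omega) K hK, hu'_eq m n (by omega), hmf m n (by omega)]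
    exact h1
  · have h1 := (hsol (ns m)).momentum n (by omega) i σ hσ
    obtain ⟨c1, c2⟩ := (M (ns m)).mem_intEdges.1 hσ
    have hcv : (M (ns m)).convection (h' m n) (u' m n) i σ =
        (M (ns m)).convection (h (ns m) n) (u (ns m) n) i σ := by
      rw [hu'_eq m n (by omega), (M (ns m)).convection_congr (hmf m n (by omega))]
    rw [hcv]
    simp only [discreteGrad, dualHeight, centeredHeight] at h1 ⊢
    rw [hh'_eq m _ hn _ c1, hh'_eq m _ hn _ c2, hh'_eq m n (by omega) _ c1,
      hh'_eq m n (by omega) _ c2, hu'_eq m _ hn, hu'_eq m n (by omega), hZ m _ c1, hZ m _ c2]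
    exact h1
  · filter_upwards [l1, ae_restrict_mem (hΩo.measurableSet.prod measurableSet_Ioo)]
      with q hq hqm κ hκ
    refine (hq κ hκ).congr' ?_
    filter_upwards [hpt hqm.1 κ hκ, htm q.2 hqm.2] with m hm hm'
    exact (hh'_eq m _ hm' _ hm).symm
  · filter_upwards [l2 i, ae_restrict_mem (hΩo.measurableSet.prod measurableSet_Ioo)]
      with q hq hqm κ hκ
    refine (hq κ hκ).congr' ?_
    filter_upwards [htm q.2 hqm.2] with m hm'
    rw [hu'_eq m _ hm']
  · filter_upwards [l3, ae_restrict_mem hΩo.measurableSet] with x hx hxm κ hκ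
    refine (hx κ hκ).congr' ?_
    filter_upwards [hpt hxm κ hκ] with m hm
    exact (hh'_eq m _ (hN _) _ hm).symm
  · filter_upwards [l4 i] with x hx κ hκ
    refine (hx κ hκ).congr' (Eventually.of_forall fun m => ?_)
    change u (ns m) 0 i (κ m) = u' m 0 i (κ m)
    rw [hu'_eq m _ (hN _)]

end

/-! ### Weak consistency of the scheme -/

theorem mainTheorem1
    (Ω : Set (Fin 2 → ℝ)) (hΩ : IsConnected Ω) (T g : ℝ) (hT : 0 < T) (hg : 0 < g)
    (z : (Fin 2 → ℝ) → ℝ) (hz : ContDiff ℝ 1 z)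
    (h₀ : (Fin 2 → ℝ) → ℝ) (u₀ : Fin 2 → (Fin 2 → ℝ) → ℝ)
    (hh₀ : IntegrableOn h₀ Ω) (hu₀ : ∀ i, IntegrableOn (u₀ i) Ω)
    -- the meshes and the time steps
    (M : ℕ → MACGrid) (hM : ∀ m, (M m).domain = Ω)
    (N : ℕ → ℕ) (hN : ∀ m, 0 < N m)
    (δt : ℕ → ℝ) (hδt : ∀ m, δt m = T / N m)
    (hδt_lim : Tendsto δt atTop (𝓝 0))
    (hsize : Tendsto (fun m => (M m).size) atTop (𝓝 0))
    (hreg : ∃ η : ℝ, 0 < η ∧ ∀ m, (M m).regularity ≤ η)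
    -- the discrete topography: values at the mass centers, or mean values over the cells
    (zM : ℕ → (Fin 2 → ℤ) → ℝ)
    (hzM : (∀ m, ∀ K ∈ (M m).cells, zM m K = z ((M m).center K)) ∨
      (∀ m, ∀ K ∈ (M m).cells, zM m K = ⨍ x in (M m).cell K, z x))
    -- the discrete solutions and their bounds
    (h : ℕ → ℕ → (Fin 2 → ℤ) → ℝ) (u : ℕ → ℕ → Fin 2 → (Fin 2 → ℤ) → ℝ)
    (hsol : ∀ m, (M m).IsSolution g (δt m) (N m) h₀ u₀ (zM m) (h m) (u m))
    (hbound_h : ∃ C C' : ℝ, 0 < C ∧ 0 < C' ∧ ∀ m, ∀ n < N m, ∀ K ∈ (M m).cells,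
      (1 / C < h m n K ∧ h m n K ≤ C) ∧ (1 / C' < 1 / h m n K ∧ 1 / h m n K ≤ C'))
    (hbound_u : ∃ C : ℝ, ∀ m, ∀ n < N m, ∀ i, ∀ σ ∈ (M m).edges i, |u m n i σ| ≤ C)
    -- the limit
    (hbar : (Fin 2 → ℝ) × ℝ → ℝ) (ubar : Fin 2 → (Fin 2 → ℝ) × ℝ → ℝ)
    (hbar_int : IntegrableOn hbar (Ω ×ˢ Ioo 0 T))
    (ubar_int : ∀ i, IntegrableOn (ubar i) (Ω ×ˢ Ioo 0 T))
    (hconv : Tendsto (fun m => eLpNorm (fun q => (M m).heightFun (δt m) (N m) (h m) q - hbar q) 1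
      (volume.restrict (Ω ×ˢ Ioo 0 T))) atTop (𝓝 0))
    (uconv : ∀ i, Tendsto (fun m =>
      eLpNorm (fun q => (M m).velocityFun (δt m) (N m) (u m) i q - ubar i q) 1
      (volume.restrict (Ω ×ˢ Ioo 0 T))) atTop (𝓝 0)) :
    ShallowWater.IsWeakSolution Ω T g z h₀ u₀ hbar ubar ∧
    (Tendsto (fun m => δt m / (M m).size) atTop (𝓝 0) →
      (∃ C : ℝ, ∀ m, ∑ n ∈ Finset.range (N m), ∑ K ∈ (M m).cells,
        (M m).cellArea K * |h m (n + 1) K - h m n K| ≤ C) →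
      ShallowWater.IsWeakEntropy Ω T g z h₀ u₀ hbar ubar) := by
  obtain ⟨η, hη0, hη⟩ := hreg
  obtain ⟨C₁, C', hC₁, -, hh⟩ := hbound_h
  obtain ⟨C₂, hu⟩ := hbound_u
  have hN0 : ∀ m, (0 : ℝ) < N m := fun m => Nat.cast_pos.2 (hN m)
  obtain ⟨ns, S, hns, hSM, hSN, hSτ, hSh⟩ := exists_convergentScheme hz hh₀ hu₀ hM hsize hη0.le hη
    hN (fun m => hδt m ▸ div_pos hT (hN0 m))
    (fun m => by rw [hδt m, mul_div_cancel₀ _ (hN0 m).ne']) hδt_lim hzM hsol hC₁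
    (fun m n hn K hK => (hh m n hn K hK).1) hu hbar_int ubar_int hconv uconv
  have hw := S.isWeakSolution hbar_int ubar_int hh₀ hu₀
  refine ⟨hw, fun hcfl ⟨V, hV⟩ => S.isWeakEntropy hg.le hz.continuous ?_ ⟨V, fun m => ?_⟩ hw hu₀
    hbar_int ubar_int⟩
  · simp only [hSM, hSτ]
    exact hcfl.comp hns.tendsto_atTop
  · rw [hSM, hSN]
    refine le_trans ?_ (hV (ns m))
    refine (Finset.sum_le_sum fun n hn => Finset.sum_le_sum fun K hK => le_of_eq ?_).trans
      (Finset.sum_le_sum_of_subset_of_nonneg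
        (Finset.range_subset_range.2 (Nat.sub_le (N (ns m)) 1)) fun n _ _ =>
          Finset.sum_nonneg fun K _ => mul_nonneg ((M (ns m)).cellArea_pos K).le (abs_nonneg _))
    have hn' := Finset.mem_range.1 hn
    rw [hSh m _ (by omega) K hK, hSh m _ (by omega) K hK]
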